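/- **Definitions.** A geodesic metric space $Y$ is Gromov hyperbolic if it is $\delta$-hyperbolic for some $\delta$. Its boundary $\partial_\infty Y$ is the set of geodesic rays $[0,\infty)\to Y$ modulo finite Hausdorff distance; $[w,a)$ denotes a geodesic ray from $w$ in the class $a$. For $o\in Y$, $(a|b)_o\in[0,\infty]$ denotes the Gromov product on $\partial_\infty Y$. A metric $\rho$ on $\partial_\infty Y$ is *visual* with parameter $\epsilon>0$, with respect to $o$, if for some $C_0>0$ we have $\frac1{C_0}e^{-\epsilon(a|b)_o}\le\rho(a,b)\le C_0e^{-\epsilon(a|b)_o}$ for all $a,b$. A metric space $(Z,\rho)$ is *uniformly perfect* if for some $\lambda>1$, for all $z\in Z$ and $0<r\le\operatorname{diam}Z$, $B(z,r)\setminus B(z,r/\lambda)\neq\emptyset$. Let $X$ be a proper geodesic metric space and $\mathcal P$ a collection of uniformly coarsely connected subsets of $X$ with the restricted metrics $d_P$. A *uniform collection of admissible horoballs* for $\mathcal P$, with constants $\delta$, $C>0$, $L\ge1$, consists of a geodesic $\delta$-hyperbolic space $\mathcal H(P)$ with exactly one boundary point for each $P\in\mathcal P$, a subset $\hat P\subset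 P$ with every point of $P$ at distance at most $C$ from $\hat P$, an identification of $\hat P$ with a topologically embedded subset of $\mathcal H(P)$, and geodesic rays $\gamma_x$ in $\mathcal H(P)$ with $\gamma_x(0)=x$ for $x\in\hat P$, such that every point of $\mathcal H(P)$ is within $C$ of some $\gamma_x$; such that $d_{\mathcal H(P)}(x,y)\ge d_P(x,y)/L$ for all $x,y\in\hat P$ with $d_{\mathcal H(P)}(x,y)\le1$; and such that $d_{\mathcal H(P)}(\gamma_x(m),\gamma_y(n))$ differs from $2\log(d_P(x,y)e^{-\max\{m,n\}}+1)+|m-n|$ by at most $C$ for all $x,y\in\hat P$, $m,n\ge0$. The *cusped space* $\mathrm{Cusp}(X)$ is the path metric space obtained from $X$ and the $\mathcal H(P)$ by identifying each $\hat P\subset X$ with its copy in $\mathcal H(P)$. $(X,\mathcal P)$, with these horoballs, is *relatively hyperbolic* if $\mathrm{Cusp}(X)$ is a proper geodesic Gromov hyperbolic space. A relatively hyperbolic $(X,\mathcal P)$ is *visually complete* if for some $w\in\mathrm{Cusp}(X)$ there is $C\ge0$ such that for every $x\in\mathrm{Cusp}(X)$ there are distinct $a,b\in\partial_\infty\mathrm{Cusp}(X)$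 and geodesic rays $[w,a)$, $[w,b)$ such that $x$ is within distance $C$ of $[w,a)$, of $[w,b)$, and of some bi-infinite geodesic from $a$ to $b$. $\mathrm{Cusp}(X)$ is *visual* if for some $w$ there is $C\ge0$ such that every $x\in\mathrm{Cusp}(X)$ is within distance $C$ of some geodesic ray from $w$. **Statement.** (1) Let $(X,\mathcal P)$ be relatively hyperbolic. In the definitions of "visually complete" and of "visual", "for some $w$" may be replaced by any prescribed $w\in\mathrm{Cusp}(X)$. For every visual metric $\rho$ on $\partial_\infty\mathrm{Cusp}(X)$ (with respect to any base point), $(X,\mathcal P)$ is visually complete if and only if $\mathrm{Cusp}(X)$ is visual, $\partial_\infty\mathrm{Cusp}(X)$ has at least two points, and $(\partial_\infty\mathrm{Cusp}(X),\rho)$ is uniformly perfect. (2) Let $G$ be a group with subgroups $H_1,\dots,H_n$ ($n\ge0$), each of them infinite and different from $G$, and let $S$ be a finite generating set of $G$ such that $S\cap H_i$ generates $H_i$ for each $i$. Let $X$ be the Cayley graph of $G$ with respect to $S$, with edges of length one, and $\mathcal P$ the collection of copies in $X$ of the Cayley graphs of the $H_i$ (with respect to $S\cap H_i$) on all left cosets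 of the $H_i$. If $(X,\mathcal P)$ is relatively hyperbolic (with respect to some uniform collection of admissible horoballs) and $G$ is not virtually cyclic, then $(X,\mathcal P)$ (with these horoballs) is visually complete. -/

import Mathlib

open scoped NNReal ENNReal

noncomputable section

namespace RelHyp

universe u v

/-! ### Gluing metric spaces along chains -/

/-- `Chain step x y r`: the points `x` and `y` are joined by a finite chain of total length `r`,
every link of which is a step (traversed in either direction); `step a b s` says that `a` and `b`
are joined by a link of length `s`. -/
inductive Chain {T : Type u} (step : T → T → ℝ → Prop) : T → T → ℝ → Prop
  | nil (x : T) : Chain step x x 0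
  | fwd {x y z : T} {r s : ℝ} : step x y r → Chain step y z s → Chain step x z (r + s)
  | bwd {x y z : T} {r s : ℝ} : step y x r → Chain step y z s → Chain step x z (r + s)

namespace Chain

variable {T : Type u} {step : T → T → ℝ → Prop}

theorem append {x y z : T} {r s : ℝ} (h : Chain step x y r) (k : Chain step y z s) :
    Chain step x z (r + s) := by
  induction h with
  | nil => simpa using k
  | fwd a _ ih => rw [add_assoc]; exact fwd a (ih k)
  | bwd a _ ih => rw [add_assoc]; exact bwd a (ih k)

theorem single {x y : T} {r : ℝ} (h : step x y r) : Chain step x y r := by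
  simpa using fwd h (nil y)

theorem single' {x y : T} {r : ℝ} (h : step y x r) : Chain step x y r := by
  simpa using bwd h (nil y)

theorem symm {x y : T} {r : ℝ} (h : Chain step x y r) : Chain step y x r := by
  induction h with
  | nil => exact nil _
  | fwd a _ ih => rw [add_comm]; exact ih.append (single' a)
  | bwd a _ ih => rw [add_comm]; exact ih.append (single a)

theorem nonneg (hstep : ∀ x y r, step x y r → 0 ≤ r) {x y : T} {r : ℝ}
    (h : Chain step x y r) : 0 ≤ r := by
  induction h with
  | nil => exact le_rfl
  | fwd a _ ih => exact add_nonneg (hstep _ _ _ a) ih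
  | bwd a _ ih => exact add_nonneg (hstep _ _ _ a) ih

end Chain

/-- The quotient pseudometric: the distance between two points is the infimum of the lengths of
the chains joining them. (If the links are the pairs of points in a family of length spaces
together with links of length `0` between points that are to be identified, this is the path
pseudometric of the glued space.) -/
@[reducible]
def chainPseudoMetric {T : Type u} (step : T → T → ℝ → Prop)
    (hstep : ∀ x y r, step x y r → 0 ≤ r) (hconn : ∀ x y, ∃ r, Chain step x y r) :
    PseudoMetricSpace T where
  dist x y := sInf {r : ℝ | Chain step x y r}
  dist_self x := by
    apply le_antisymm
    · exact csInf_le ⟨0, fun r hr => hr.nonneg hstep⟩ (Chain.nil x)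
    · exact le_csInf (hconn x x) fun r hr => hr.nonneg hstep
  dist_comm x y := by
    congr 1
    ext r
    exact ⟨Chain.symm, Chain.symm⟩
  dist_triangle x y z := by
    have hbdd : ∀ a b : T, BddBelow {r : ℝ | Chain step a b r} :=
      fun a b => ⟨0, fun r hr => hr.nonneg hstep⟩
    refine le_of_forall_pos_le_add fun ε hε => ?_
    obtain ⟨r, hr, hr'⟩ := Real.lt_sInf_add_pos (hconn x y) (half_pos hε)
    change r < sInf {r : ℝ | Chain step x y r} + ε / 2 at hr'
    obtain ⟨s, hs, hs'⟩ := Real.lt_sInf_add_pos (hconn y z) (half_pos hε)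
    change s < sInf {r : ℝ | Chain step y z r} + ε / 2 at hs'
    have h := csInf_le (hbdd x z) (Chain.append hr hs)
    linarith

/-! ### Geodesics, hyperbolicity and the boundary at infinity -/

/-- Every two points are joined by a geodesic segment. -/
def IsGeodesicSpace (Y : Type u) [MetricSpace Y] : Prop :=
  ∀ x y : Y, ∃ γ : ℝ → Y, γ 0 = x ∧ γ (dist x y) = y ∧
    ∀ s ∈ Set.Icc 0 (dist x y), ∀ t ∈ Set.Icc 0 (dist x y), dist (γ s) (γ t) = |s - t|

/-- The Gromov product `(x | y)` with respect to `w`. -/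
def gromovProduct {Y : Type u} [MetricSpace Y] (w x y : Y) : ℝ :=
  (dist w x + dist w y - dist x y) / 2

/-- `Y` is `δ`-hyperbolic. -/
def IsHyperbolicWith (Y : Type u) [MetricSpace Y] (δ : ℝ) : Prop :=
  ∀ w x y z : Y, min (gromovProduct w x y) (gromovProduct w y z) - δ ≤ gromovProduct w x z

/-- `Y` is Gromov hyperbolic. -/
def IsGromovHyperbolic (Y : Type u) [MetricSpace Y] : Prop :=
  ∃ δ : ℝ, IsHyperbolicWith Y δ

/-- A geodesic ray `[0, ∞) → Y`. -/
structure GeodesicRay (Y : Type u) [MetricSpace Y] where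
  toFun : ℝ≥0 → Y
  isometry : Isometry toFun

instance (Y : Type u) [MetricSpace Y] : CoeFun (GeodesicRay Y) fun _ => ℝ≥0 → Y :=
  ⟨GeodesicRay.toFun⟩

/-- Two geodesic rays are equivalent if they are at finite Hausdorff distance. -/
instance GeodesicRay.setoid (Y : Type u) [MetricSpace Y] : Setoid (GeodesicRay Y) where
  r α β := Metric.hausdorffEDist (Set.range α) (Set.range β) ≠ ⊤
  iseqv :=
    { refl := fun α => by simp [Metric.hausdorffEDist_self]
      symm := fun {α β} h => by rwa [Metric.hausdorffEDist_comm]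
      trans := fun {α β γ} h k =>
        ne_top_of_le_ne_top (ENNReal.add_ne_top.2 ⟨h, k⟩) Metric.hausdorffEDist_triangle }

/-- The boundary at infinity `∂_∞ Y`: geodesic rays up to finite Hausdorff distance. (In a proper
geodesic hyperbolic space every class contains a ray from every prescribed base point.) -/
def GromovBoundary (Y : Type u) [MetricSpace Y] : Type u :=
  Quotient (GeodesicRay.setoid Y)

/-- The end point at infinity of a geodesic ray. -/
def GeodesicRay.endpoint {Y : Type u} [MetricSpace Y] (α : GeodesicRay Y) : GromovBoundary Y :=
  Quotient.mk _ α

/-- `α` is a geodesic ray `[w, a)`. -/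
def GeodesicRay.IsFromTo {Y : Type u} [MetricSpace Y] (α : GeodesicRay Y) (w : Y)
    (a : GromovBoundary Y) : Prop :=
  α 0 = w ∧ α.endpoint = a

/-- A bi-infinite geodesic `ℝ → Y`. -/
structure GeodesicLine (Y : Type u) [MetricSpace Y] where
  toFun : ℝ → Y
  isometry : Isometry toFun

/-- The half of a bi-infinite geodesic parametrized by `[0, ∞)`. -/
def GeodesicLine.posRay {Y : Type u} [MetricSpace Y] (ℓ : GeodesicLine Y) : GeodesicRay Y where
  toFun t := ℓ.toFun t
  isometry := ℓ.isometry.comp (Isometry.of_dist_eq fun _ _ => rfl)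

/-- The half of a bi-infinite geodesic parametrized by `(-∞, 0]`, with reversed orientation. -/
def GeodesicLine.negRay {Y : Type u} [MetricSpace Y] (ℓ : GeodesicLine Y) : GeodesicRay Y where
  toFun t := ℓ.toFun (-t)
  isometry := ℓ.isometry.comp (Isometry.of_dist_eq fun s t => by
    rw [dist_neg_neg]; rfl)

/-- `ℓ` is a bi-infinite geodesic from `a` to `b`. -/
def GeodesicLine.IsFromTo {Y : Type u} [MetricSpace Y] (ℓ : GeodesicLine Y)
    (a b : GromovBoundary Y) : Prop :=
  ℓ.negRay.endpoint = a ∧ ℓ.posRay.endpoint = b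

/-- The Gromov product `(a | b)` of two boundary points with respect to `o`, with values in
`[0, ∞]`. For rays `α`, `β` from `o` the number `(α(s) | β(t))` is nondecreasing in `s` and `t`,
so that the supremum over `s` and `t` is its limit as `s, t → ∞`. -/
def boundaryProduct {Y : Type u} [MetricSpace Y] (o : Y) (a b : GromovBoundary Y) : ℝ≥0∞ :=
  ⨆ (α : GeodesicRay Y) (β : GeodesicRay Y) (_ : α.IsFromTo o a) (_ : β.IsFromTo o b)
    (s : ℝ≥0) (t : ℝ≥0), ENNReal.ofReal (gromovProduct o (α s) (β t))

/-- `exp (-ε p)`, with `exp (-∞) = 0`. -/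
def expNeg (ε : ℝ) (p : ℝ≥0∞) : ℝ :=
  if p = ⊤ then 0 else Real.exp (-(ε * p.toReal))

/-- The metric `ρ` on `∂_∞ Y` is a visual metric with visual parameter `ε`
(with respect to the base point `o`). -/
def IsVisualMetric {Y : Type u} [MetricSpace Y] (o : Y) (ε : ℝ)
    (ρ : MetricSpace (GromovBoundary Y)) : Prop :=
  0 < ε ∧ ∃ C₀ : ℝ, 0 < C₀ ∧ ∀ a b : GromovBoundary Y,
    1 / C₀ * expNeg ε (boundaryProduct o a b) ≤ ρ.dist a b ∧
      ρ.dist a b ≤ C₀ * expNeg ε (boundaryProduct o a b)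

/-- A metric space is uniformly perfect if for some `λ > 1`, for every point `z` and every
`0 < r ≤ diam Z`, the set `B(z, r) \ B(z, r / λ)` is not empty. -/
def UniformlyPerfect (Z : Type u) [MetricSpace Z] : Prop :=
  ∃ l : ℝ, 1 < l ∧ ∀ (z : Z) (r : ℝ), 0 < r →
    ENNReal.ofReal r ≤ Metric.ediam (Set.univ : Set Z) →
      (Metric.ball z r \ Metric.ball z (r / l)).Nonempty

/-- `Y` is visual with respect to the base point `w`. -/
def IsVisualFrom (Y : Type u) [MetricSpace Y] (w : Y) : Prop :=
  ∃ C : ℝ, 0 ≤ C ∧ ∀ x : Y, ∃ α : GeodesicRay Y, α 0 = w ∧ ∃ t, dist x (α t) ≤ C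

/-- `Y` is visual. -/
def IsVisual (Y : Type u) [MetricSpace Y] : Prop :=
  ∃ w : Y, IsVisualFrom Y w

/-- The condition of visual completeness with respect to the base point `w`: there is `C` such
that every point is `C`-close to geodesic rays `[w, a)`, `[w, b)` and to a bi-infinite geodesic
from `a` to `b`, for some distinct boundary points `a`, `b`. -/
def IsVisuallyCompleteFrom (Y : Type u) [MetricSpace Y] (w : Y) : Prop :=
  ∃ C : ℝ, 0 ≤ C ∧ ∀ x : Y, ∃ (a b : GromovBoundary Y) (α β : GeodesicRay Y)
    (ℓ : GeodesicLine Y), a ≠ b ∧ α.IsFromTo w a ∧ β.IsFromTo w b ∧ ℓ.IsFromTo a b ∧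
      (∃ t, dist x (α t) ≤ C) ∧ (∃ t, dist x (β t) ≤ C) ∧ ∃ t, dist x (ℓ.toFun t) ≤ C

/-- Visual completeness, as a property of the cusped space `Y`. -/
def IsVisuallyComplete (Y : Type u) [MetricSpace Y] : Prop :=
  ∃ w : Y, IsVisuallyCompleteFrom Y w

/-! ### Admissible horoballs, cusped spaces and relative hyperbolicity -/

/-- A subset `P` of a metric space is `ε`-coarsely connected: any two of its points are joined by
a finite chain of points of `P` with jumps at most `ε`. -/
def IsCoarselyConnected {X : Type u} [MetricSpace X] (ε : ℝ) (P : Set X) : Prop :=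
  ∀ x y : P, Relation.ReflTransGen (fun a b : P => dist a b ≤ ε) x y

/-- An admissible horoball, with constants `δ`, `C`, `L`, for a subset `P` of a metric space `X`
(with the restricted metric). -/
structure AdmissibleHoroball {X : Type u} [MetricSpace X] (P : Set X) (δ C L : ℝ) where
  /-- the horoball `ℋ(P)` -/
  Carrier : Type v
  [metric : MetricSpace Carrier]
  /-- the subset `P̂` of `P` -/
  base : Set X
  base_subset : base ⊆ P
  base_dense : ∀ x ∈ P, ∃ y ∈ base, dist x y ≤ C
  /-- the identification of `P̂` with a subset of the horoball -/
  incl : base → Carrier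
  isEmbedding_incl : Topology.IsEmbedding incl
  /-- the geodesic rays `γ_x` -/
  ray : base → GeodesicRay Carrier
  C_pos : 0 < C
  one_le_L : 1 ≤ L
  geodesic : IsGeodesicSpace Carrier
  hyperbolic : IsHyperbolicWith Carrier δ
  boundary_unique : ∃ a : GromovBoundary Carrier, ∀ b, b = a
  ray_zero : ∀ x, ray x 0 = incl x
  ray_dense : ∀ p : Carrier, ∃ x t, dist p (ray x t) ≤ C
  dist_local : ∀ x y : base, dist (incl x) (incl y) ≤ 1 →
    dist x y / L ≤ dist (incl x) (incl y)
  dist_estimate : ∀ (x y : base) (m n : ℝ≥0),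
    |dist (ray x m) (ray y n) -
      (2 * Real.log (dist x y * Real.exp (-(max m n : ℝ)) + 1) + |(m : ℝ) - n|)| ≤ C

attribute [instance] AdmissibleHoroball.metric

/-- A uniform collection of admissible horoballs for a collection `𝓟` of subsets of `X`. -/
abbrev HoroballFamily {X : Type u} [MetricSpace X] (𝓟 : Set (Set X)) (δ C L : ℝ) :=
  ∀ P : 𝓟, AdmissibleHoroball.{u, v} (P : Set X) δ C L

section Cusp

variable {X : Type u} [MetricSpace X] {𝓟 : Set (Set X)} {δ C L : ℝ}

/-- The disjoint union of `X` and of all the horoballs. -/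
def PreCusp (H : HoroballFamily.{u, v} 𝓟 δ C L) : Type (max u v) :=
  X ⊕ (Σ P : 𝓟, (H P).Carrier)

/-- The links for the cusped space: pairs of points in `X`, pairs of points in a horoball, and,
with length `0`, the pairs consisting of a point of `P̂` in `X` and its copy in `ℋ(P)`. -/
inductive CuspStep (H : HoroballFamily.{u, v} 𝓟 δ C L) : PreCusp H → PreCusp H → ℝ → Prop
  | space (x y : X) : CuspStep H (Sum.inl x) (Sum.inl y) (dist x y)
  | horoball (P : 𝓟) (p q : (H P).Carrier) :
      CuspStep H (Sum.inr ⟨P, p⟩) (Sum.inr ⟨P, q⟩) (dist p q)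
  | glue (P : 𝓟) (x : (H P).base) :
      CuspStep H (Sum.inl (x : X)) (Sum.inr ⟨P, (H P).incl x⟩) 0

theorem CuspStep.nonneg (H : HoroballFamily.{u, v} 𝓟 δ C L) (x y : PreCusp H) (r : ℝ)
    (h : CuspStep H x y r) : 0 ≤ r := by
  cases h with
  | space => exact dist_nonneg
  | horoball => exact dist_nonneg
  | glue => exact le_rfl

theorem CuspStep.connected (H : HoroballFamily.{u, v} 𝓟 δ C L) (x y : PreCusp H) :
    ∃ r, Chain (CuspStep H) x y r := by
  have key : ∀ z : PreCusp H, ∃ (p : X) (r : ℝ), Chain (CuspStep H) z (Sum.inl p) r := by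
    rintro (p | ⟨P, p⟩)
    · exact ⟨p, 0, Chain.nil _⟩
    · obtain ⟨q, -, -⟩ := (H P).ray_dense p
      exact ⟨q, _, (Chain.single (CuspStep.horoball P p ((H P).incl q))).append
        (Chain.single' (CuspStep.glue P q))⟩
  obtain ⟨p, r, hr⟩ := key x
  obtain ⟨q, s, hs⟩ := key y
  exact ⟨_, (hr.append (Chain.single (CuspStep.space p q))).append hs.symm⟩

instance (H : HoroballFamily.{u, v} 𝓟 δ C L) : PseudoMetricSpace (PreCusp H) :=
  chainPseudoMetric (CuspStep H) (CuspStep.nonneg H) (CuspStep.connected H)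

/-- The cusped space `Cusp(X, {ℋ(P)})`: the path metric space obtained from `X` and the horoballs
by identifying each `P̂ ⊆ X` with its copy in `ℋ(P)`. -/
def Cusp (H : HoroballFamily.{u, v} 𝓟 δ C L) : Type (max u v) :=
  SeparationQuotient (PreCusp H)

instance (H : HoroballFamily.{u, v} 𝓟 δ C L) : MetricSpace (Cusp H) :=
  inferInstanceAs (MetricSpace (SeparationQuotient (PreCusp H)))

/-- `(X, 𝓟)` is relatively hyperbolic, with respect to the given horoballs. -/
structure IsRelativelyHyperbolic (H : HoroballFamily.{u, v} 𝓟 δ C L) : Prop where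
  geodesic_space : IsGeodesicSpace X
  proper_space : ProperSpace X
  coarselyConnected : ∃ ε : ℝ, 0 < ε ∧ ∀ P ∈ 𝓟, IsCoarselyConnected ε P
  geodesic_cusp : IsGeodesicSpace (Cusp H)
  proper_cusp : ProperSpace (Cusp H)
  hyperbolic_cusp : IsGromovHyperbolic (Cusp H)

end Cusp

/-! ### Cayley graphs as geodesic metric spaces -/

section Graph

variable {V : Type u}

/-- The disjoint union of the vertices of a graph and of one unit interval for every oriented
edge. -/
def PreRealization (Γ : SimpleGraph V) (_ : Γ.Preconnected) : Type u :=
  V ⊕ (Γ.Dart × unitInterval)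

/-- The links for the metric realization of a graph: pairs of points on an oriented edge, and,
with length `0`, the pairs consisting of the initial vertex of an oriented edge and the point `0`
of its interval, and of the same point on the two orientations of an edge. -/
inductive GraphStep (Γ : SimpleGraph V) (hΓ : Γ.Preconnected) :
    PreRealization Γ hΓ → PreRealization Γ hΓ → ℝ → Prop
  | edge (e : Γ.Dart) (s t : unitInterval) :
      GraphStep Γ hΓ (Sum.inr (e, s)) (Sum.inr (e, t)) (dist s t)
  | start (e : Γ.Dart) : GraphStep Γ hΓ (Sum.inl e.fst) (Sum.inr (e, 0)) 0
  | flip (e : Γ.Dart) (t : unitInterval) :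
      GraphStep Γ hΓ (Sum.inr (e, t)) (Sum.inr (e.symm, unitInterval.symm t)) 0

theorem GraphStep.nonneg (Γ : SimpleGraph V) (hΓ : Γ.Preconnected) (x y : PreRealization Γ hΓ)
    (r : ℝ) (h : GraphStep Γ hΓ x y r) : 0 ≤ r := by
  cases h with
  | edge => exact dist_nonneg
  | start => exact le_rfl
  | flip => exact le_rfl

theorem GraphStep.connected (Γ : SimpleGraph V) (hΓ : Γ.Preconnected)
    (x y : PreRealization Γ hΓ) : ∃ r, Chain (GraphStep Γ hΓ) x y r := by
  have key : ∀ z : PreRealization Γ hΓ,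
      ∃ (v : V) (r : ℝ), Chain (GraphStep Γ hΓ) z (Sum.inl v) r := by
    rintro (v | ⟨e, t⟩)
    · exact ⟨v, 0, Chain.nil _⟩
    · exact ⟨e.fst, _, (Chain.single (GraphStep.edge e t 0)).append
        (Chain.single' (GraphStep.start e))⟩
  have vert : ∀ v w : V, ∃ r, Chain (GraphStep Γ hΓ) (Sum.inl v) (Sum.inl w) r := by
    intro v w
    obtain ⟨p⟩ := hΓ v w
    induction p with
    | nil => exact ⟨0, Chain.nil _⟩
    | @cons a b c h p ih =>
      obtain ⟨r, hr⟩ := ih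
      let e : Γ.Dart := ⟨(a, b), h⟩
      have h1 : Chain (GraphStep Γ hΓ) (Sum.inl a) (Sum.inr (e, 0)) 0 :=
        Chain.single (GraphStep.start e)
      have h2 : Chain (GraphStep Γ hΓ) (Sum.inr (e, 0))
          (Sum.inr (e.symm, unitInterval.symm 0)) 0 := Chain.single (GraphStep.flip e 0)
      have h3 : Chain (GraphStep Γ hΓ) (Sum.inr (e.symm, unitInterval.symm 0))
          (Sum.inr (e.symm, 0)) _ := Chain.single (GraphStep.edge e.symm _ 0)
      have h4 : Chain (GraphStep Γ hΓ) (Sum.inr (e.symm, 0)) (Sum.inl b) 0 :=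
        Chain.single' (GraphStep.start e.symm)
      exact ⟨_, (((h1.append h2).append h3).append h4).append hr⟩
  obtain ⟨v, r, hr⟩ := key x
  obtain ⟨w, s, hs⟩ := key y
  obtain ⟨t, ht⟩ := vert v w
  exact ⟨_, (hr.append ht).append hs.symm⟩

instance (Γ : SimpleGraph V) (hΓ : Γ.Preconnected) : PseudoMetricSpace (PreRealization Γ hΓ) :=
  chainPseudoMetric (GraphStep Γ hΓ) (GraphStep.nonneg Γ hΓ) (GraphStep.connected Γ hΓ)

/-- The metric realization of a connected graph, all edges having length one. -/
def Realization (Γ : SimpleGraph V) (hΓ : Γ.Preconnected) : Type u :=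
  SeparationQuotient (PreRealization Γ hΓ)

instance (Γ : SimpleGraph V) (hΓ : Γ.Preconnected) : MetricSpace (Realization Γ hΓ) :=
  inferInstanceAs (MetricSpace (SeparationQuotient (PreRealization Γ hΓ)))

/-- A vertex, as a point of the realization. -/
def Realization.vertex {Γ : SimpleGraph V} {hΓ : Γ.Preconnected} (v : V) : Realization Γ hΓ :=
  SeparationQuotient.mk (X := PreRealization Γ hΓ) (Sum.inl v)

/-- The point at distance `t` from the start of an oriented edge. -/
def Realization.edgePoint {Γ : SimpleGraph V} {hΓ : Γ.Preconnected} (e : Γ.Dart)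
    (t : unitInterval) : Realization Γ hΓ :=
  SeparationQuotient.mk (X := PreRealization Γ hΓ) (Sum.inr (e, t))

end Graph

section Group

variable {G : Type u} [Group G]

theorem mulCayley_preconnected {S : Set G} (hS : Subgroup.closure S = ⊤) :
    (SimpleGraph.mulCayley S).Preconnected := by
  have step : ∀ (x s : G), s ∈ S → (SimpleGraph.mulCayley S).Reachable x (x * s) := by
    intro x s hs
    by_cases h : x = x * s
    · rw [← h]
    · exact SimpleGraph.Adj.reachable ((SimpleGraph.mulCayley_adj S _ _).2 ⟨h, Or.inl (by simpa)⟩)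
  have key : ∀ g : G, ∀ x : G, (SimpleGraph.mulCayley S).Reachable x (x * g) := by
    intro g
    have hg : g ∈ Subgroup.closure S := hS ▸ Subgroup.mem_top g
    induction hg using Subgroup.closure_induction with
    | mem s hs => exact fun x => step x s hs
    | one => intro x; rw [mul_one]
    | mul a b _ _ iha ihb => intro x; rw [← mul_assoc]; exact (iha x).trans (ihb (x * a))
    | inv a _ ih => intro x; simpa using (ih (x * a⁻¹)).symm
  intro x y
  simpa using key (x⁻¹ * y) x

/-- The Cayley graph of `G` with respect to the generating set `S`, as a metric space. Its edges
join `g` to `g * s` for `s ∈ S`. -/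
abbrev CayleySpace (S : Set G) (hS : Subgroup.closure S = ⊤) : Type u :=
  Realization (SimpleGraph.mulCayley S) (mulCayley_preconnected hS)

/-- The copy, on the left coset `g K`, of the Cayley graph of `K` with respect to `S ∩ K`: the
vertices in `g K` and the edges between them. -/
def cosetCopy (S : Set G) (hS : Subgroup.closure S = ⊤) (K : Subgroup G) (g : G) :
    Set (CayleySpace S hS) :=
  {p | (∃ v : G, g⁻¹ * v ∈ K ∧ p = Realization.vertex v) ∨
    ∃ (e : (SimpleGraph.mulCayley S).Dart) (t : unitInterval),
      g⁻¹ * e.fst ∈ K ∧ g⁻¹ * e.snd ∈ K ∧ p = Realization.edgePoint e t}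

/-- The peripheral collection of `(G, {K i})` in the Cayley graph: the copies of the Cayley graphs
of the subgroups on all their left cosets. -/
def peripherals (S : Set G) (hS : Subgroup.closure S = ⊤) {n : ℕ} (K : Fin n → Subgroup G) :
    Set (Set (CayleySpace S hS)) :=
  {P | ∃ (i : Fin n) (g : G), P = cosetCopy S hS (K i) g}

/-- `G` has a cyclic subgroup of finite index. -/
def IsVirtuallyCyclic (G : Type u) [Group G] : Prop :=
  ∃ Z : Subgroup G, IsCyclic Z ∧ Z.FiniteIndex

end Group

end RelHyp

end

open RelHyp

/-! Part (1) holds in every proper geodesic hyperbolic space; the cusps play no role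
(`visuallyComplete_characterization`). That rays from `w` and a line joining their ends pass near
`x` amounts to upper bounds for the Gromov products at `x` of `w` and of points far away. Such
bounds survive a change of `w` with bounded loss, and by properness they produce actual rays and
lines (`exists_ray_near`, `exists_ideal_triangle_near`). A visual metric turns a radius `r` at
infinity into a depth of about `log (1 / r) / ε`: an annulus about `z` of that radius contains a
point `b` when `[o, b)` branches off `[o, z)` near that depth, and this branching is what visual
completeness asks for there.

For part (2) it is enough to find, with a single `K`, at every point `x` and for every `N`, a
tripod: three points at distance at least `N` from `x` with pairwise products at `x` at most `K`.
Wherever `w` is, two of the three point away from it (`isVisuallyComplete_of_hasTripod`). At depth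
`m` in a horoball the three directions are up the vertical ray and down two rays whose base points
are about `exp m` apart (`Cusp.onRay_hasTripod`), so that only vertices of the Cayley graph remain.

Without peripheral subgroups the cusped space is the Cayley graph and the group acts by isometries.
The powers of some `u` run along a quasi-geodesic, and as the group is not virtually cyclic some
element is far from all of them; moved to its nearest power, it gives the third leg.

With a peripheral subgroup there are three distinct peripheral cosets, because distinct cosets have
bounded coarse intersection (`Cusp.dist_le_of_near_distinct`), and points far out on them form
tripods of all sizes at the identity. Translating these is the main difficulty: horoballs over
different cosets share nothing but their constants, so a translation extends to the cusped space
only as a coarse correspondence, Lipschitz up to a constant `B`. Legs shrink at most by the factor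
`B`, up to an additive constant, whereas products become at most linear in the logarithm of the leg
length, since a path of `2 ^ k` short steps that avoids a large ball turns by at most `k * δ`
(`Corresponds.gromovProduct_le`). Hence one size of tripod is large compared with its products at
all vertices at once, and concatenating such tripods gives all sizes (`HasTripod.extend`). -/

namespace RelHyp

/-! ### Gromov products, limits of geodesics, and ideal triangles in proper hyperbolic spaces. -/

section Hyperbolic

open Filter

variable {Y : Type*} [MetricSpace Y] {δ : ℝ}

/-! ### Gromov products -/

theorem gromovProduct_comm (w x y : Y) : gromovProduct w x y = gromovProduct w y x := by
  unfold gromovProduct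
  rw [dist_comm x y]
  ring

theorem gromovProduct_nonneg (w x y : Y) : 0 ≤ gromovProduct w x y := by
  unfold gromovProduct
  linarith [dist_triangle_left x y w]

theorem gromovProduct_le_left (w x y : Y) : gromovProduct w x y ≤ dist w x := by
  unfold gromovProduct
  linarith [dist_triangle w x y]

theorem gromovProduct_le_right (w x y : Y) : gromovProduct w x y ≤ dist w y := by
  rw [gromovProduct_comm]
  exact gromovProduct_le_left w y x

theorem gromovProduct_add (w x y : Y) :
    gromovProduct w x y + gromovProduct x w y = dist w x := by
  unfold gromovProduct
  rw [dist_comm x w]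
  ring

theorem gromovProduct_le_base (w w' x y : Y) :
    gromovProduct w x y ≤ gromovProduct w' x y + dist w w' := by
  unfold gromovProduct
  linarith [dist_triangle w w' x, dist_triangle w w' y]

theorem gromovProduct_le_change (w x x' y : Y) :
    gromovProduct w x y ≤ gromovProduct w x' y + dist x x' := by
  unfold gromovProduct
  linarith [dist_triangle w x' x, dist_triangle x' x y, dist_comm x x']

theorem dist_eq_sub_gromovProduct (w x y : Y) :
    dist x y = dist w x + dist w y - 2 * gromovProduct w x y := by
  unfold gromovProduct
  ring

theorem IsHyperbolicWith.nonneg (h : IsHyperbolicWith Y δ) (y : Y) : 0 ≤ δ := by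
  have := h y y y y
  simpa [gromovProduct] using this

theorem IsHyperbolicWith.four_point (h : IsHyperbolicWith Y δ) (x y z w : Y) :
    dist x y + dist z w ≤ max (dist x z + dist y w) (dist x w + dist y z) + 2 * δ := by
  have := h w x z y
  unfold gromovProduct at this
  rw [dist_comm z w, dist_comm y w, dist_comm x w, dist_comm y z]
  rcases min_le_iff.1 (le_refl (min ((dist w x + dist w z - dist x z) / 2)
    ((dist w z + dist w y - dist z y) / 2))) with h1 | h1
  · rcases le_total (dist x z + dist w y) (dist w x + dist z y) with h2 | h2
    · rw [max_eq_right h2]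
      rw [min_eq_left (h1.trans (min_le_right _ _))] at this
      linarith
    · rw [max_eq_left h2]
      rw [min_eq_left (h1.trans (min_le_right _ _))] at this
      linarith
  · rcases le_total (dist x z + dist w y) (dist w x + dist z y) with h2 | h2
    · rw [max_eq_right h2]
      rw [min_eq_right (h1.trans (min_le_left _ _))] at this
      linarith
    · rw [max_eq_left h2]
      rw [min_eq_right (h1.trans (min_le_left _ _))] at this
      linarith

/-- Hyperbolicity, in the form: a point `z` in the direction of `y` has the same small products
as `y`. -/
theorem IsHyperbolicWith.le_of_lt (h : IsHyperbolicWith Y δ) {w x y z : Y} {c : ℝ}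
    (h1 : gromovProduct w x y ≤ c) (h2 : c + δ < gromovProduct w z y) :
    gromovProduct w x z ≤ c + δ := by
  have := h w x z y
  rcases min_choice (gromovProduct w x z) (gromovProduct w z y) with h3 | h3 <;>
    rw [h3] at this <;> linarith

theorem IsHyperbolicWith.le_of_lt' (h : IsHyperbolicWith Y δ) {w x y x' y' : Y} {c : ℝ}
    (h1 : gromovProduct w x y ≤ c) (hx : c + 2 * δ < gromovProduct w x' x)
    (hy : c + 2 * δ < gromovProduct w y' y) :
    gromovProduct w x' y' ≤ c + 2 * δ := by
  have h0 := h.nonneg w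
  have h2 := h.le_of_lt (z := y') h1 (by linarith)
  rw [gromovProduct_comm] at h2
  have h3 := h.le_of_lt (z := x') h2 (by linarith)
  rw [gromovProduct_comm]
  linarith

theorem IsHyperbolicWith.le_gromovProduct (h : IsHyperbolicWith Y δ) {w x y z : Y} {c : ℝ}
    (h1 : c ≤ gromovProduct w x y) (h2 : c ≤ gromovProduct w y z) :
    c - δ ≤ gromovProduct w x z := by
  have := h w x y z
  linarith [le_min h1 h2]

/-- Among two points with small product, one has small product with any third point. -/
theorem IsHyperbolicWith.le_or_le (h : IsHyperbolicWith Y δ) {w a b : Y} {c : ℝ} (x : Y)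
    (h1 : gromovProduct w a b ≤ c) :
    gromovProduct w x a ≤ c + δ ∨ gromovProduct w x b ≤ c + δ := by
  by_contra! h2
  have := h w a x b
  rw [gromovProduct_comm w a x] at this
  linarith [lt_min h2.1 h2.2]

/-- Both `(p | b)_u` and `(b | q)_v` equal `t`. Moving the base point of the second to `u` costs
`dist u v`, so that `(p | q)_u` is at least `t - dist u v - δ`. -/
theorem IsHyperbolicWith.fellow_travel (h : IsHyperbolicWith Y δ) {u v p q b : Y} {t : ℝ}
    (hp : dist u p = t) (hpb : dist p b = dist u b - t)
    (hq : dist v q = t) (hqb : dist q b = dist v b - t) :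
    dist p q ≤ 3 * dist u v + 2 * δ := by
  have h1 : t - dist u v ≤ gromovProduct u p b := by
    unfold gromovProduct
    linarith [dist_nonneg (x := u) (y := v)]
  have h2 : t - dist u v ≤ gromovProduct u b q := by
    have : t = gromovProduct v b q := by
      unfold gromovProduct
      rw [dist_comm b q]
      linarith
    linarith [gromovProduct_le_base v u b q, dist_comm u v]
  have h3 := h.le_gromovProduct h1 h2
  rw [dist_eq_sub_gromovProduct u p q]
  linarith [dist_triangle u v q]

/-! ### Choice of geodesics -/

/-- A geodesic from `x` to `y`. -/
noncomputable def geod (hg : IsGeodesicSpace Y) (x y : Y) : ℝ → Y :=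
  Classical.choose (hg x y)

theorem geod_zero (hg : IsGeodesicSpace Y) (x y : Y) : geod hg x y 0 = x :=
  (Classical.choose_spec (hg x y)).1

theorem geod_dist (hg : IsGeodesicSpace Y) (x y : Y) : geod hg x y (dist x y) = y :=
  (Classical.choose_spec (hg x y)).2.1

theorem dist_geod (hg : IsGeodesicSpace Y) {x y : Y} {s t : ℝ} (hs : 0 ≤ s) (hs' : s ≤ dist x y)
    (ht : 0 ≤ t) (ht' : t ≤ dist x y) : dist (geod hg x y s) (geod hg x y t) = |s - t| :=
  (Classical.choose_spec (hg x y)).2.2 s ⟨hs, hs'⟩ t ⟨ht, ht'⟩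

theorem dist_left_geod (hg : IsGeodesicSpace Y) {x y : Y} {t : ℝ} (ht : 0 ≤ t)
    (ht' : t ≤ dist x y) : dist x (geod hg x y t) = t := by
  have := dist_geod hg le_rfl (ht.trans ht') ht ht'
  rwa [geod_zero, zero_sub, abs_neg, abs_of_nonneg ht] at this

theorem dist_geod_right (hg : IsGeodesicSpace Y) {x y : Y} {t : ℝ} (ht : 0 ≤ t)
    (ht' : t ≤ dist x y) : dist (geod hg x y t) y = dist x y - t := by
  have := dist_geod hg ht ht' (ht.trans ht') le_rfl
  rwa [geod_dist, abs_sub_comm, abs_of_nonneg (sub_nonneg.2 ht')] at this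

/-! ### Limits of geodesics -/

theorem dist_le_of_eventually {f g : ℕ → Y} {y z : Y} {c : ℝ}
    (hf : Tendsto f (hyperfilter ℕ) (nhds y)) (hg : Tendsto g (hyperfilter ℕ) (nhds z))
    (h : ∀ᶠ n in atTop, dist (f n) (g n) ≤ c) : dist y z ≤ c :=
  le_of_tendsto (hf.dist hg) (h.filter_mono Nat.hyperfilter_le_atTop)

/-- In a proper space, pointwise bounded maps which are eventually isometric have an isometric
limit along an ultrafilter. -/
theorem exists_isometry_limit [ProperSpace Y] {T : Type*} [PseudoMetricSpace T] (σ : ℕ → T → Y)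
    (hσ : ∀ s t, ∀ᶠ n in atTop, dist (σ n s) (σ n t) = dist s t)
    (t₀ : T) (p : Y) (r : ℝ) (hr : ∀ n, dist (σ n t₀) p ≤ r) :
    ∃ τ : T → Y, Isometry τ ∧ ∀ t, Tendsto (fun n => σ n t) (hyperfilter ℕ) (nhds (τ t)) := by
  have key : ∀ t, ∃ y, Tendsto (fun n => σ n t) (hyperfilter ℕ) (nhds y) := by
    intro t
    have h1 : ∀ᶠ n in (hyperfilter ℕ : Filter ℕ),
        σ n t ∈ Metric.closedBall p (dist t t₀ + r) := by
      filter_upwards [(hσ t t₀).filter_mono Nat.hyperfilter_le_atTop] with n hn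
      rw [Metric.mem_closedBall]
      linarith [dist_triangle (σ n t) (σ n t₀) p, hr n]
    obtain ⟨y, -, hy⟩ := (isCompact_closedBall p (dist t t₀ + r)).ultrafilter_le_nhds
      ((hyperfilter ℕ).map fun n => σ n t) (le_principal_iff.2 h1)
    exact ⟨y, hy⟩
  choose τ hτ using key
  refine ⟨τ, Isometry.of_dist_eq fun s t => ?_, hτ⟩
  refine tendsto_nhds_unique ((hτ s).dist (hτ t)) (tendsto_const_nhds.congr' ?_)
  filter_upwards [(hσ s t).filter_mono Nat.hyperfilter_le_atTop] with n hn
  exact hn.symm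

/-- Escape to infinity is measured from `x` rather than from `w`, since in the applications the
points `a n` are chosen as seen from the point that the ray has to approach. -/
theorem exists_ray_limit [ProperSpace Y] (hg : IsGeodesicSpace Y) (w x : Y) (a : ℕ → Y)
    (ha : ∀ n : ℕ, (n : ℝ) ≤ dist x (a n)) :
    ∃ α : GeodesicRay Y, α 0 = w ∧
      ∀ t : ℝ≥0, Tendsto (fun n => geod hg w (a n) t) (hyperfilter ℕ) (nhds (α t)) := by
  obtain ⟨α, hα, hlim⟩ := exists_isometry_limit (T := ℝ≥0) (fun n t => geod hg w (a n) t)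
    (fun s t => by
      -- For such `n` both parameters lie in `[0, dist w (a n)]`; outside that interval `geod` is
      -- arbitrary.
      filter_upwards [eventually_ge_atTop ⌈(s : ℝ) + t + dist w x⌉₊] with n hn
      have h1 : (s : ℝ) + t + dist w x ≤ n := Nat.ceil_le.1 hn
      have h2 := dist_triangle_left x (a n) w
      have h3 := ha n
      have hs := s.coe_nonneg
      have ht := t.coe_nonneg
      exact (dist_geod hg hs (by linarith) ht (by linarith)).trans rfl) 0 w 0 (fun n => by simp [geod_zero])
  refine ⟨⟨α, hα⟩, ?_, hlim⟩
  refine tendsto_nhds_unique (hlim 0) (tendsto_const_nhds.congr' (Eventually.of_forall fun n => ?_))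
  simp [geod_zero]

/-- A small product at `x` means that `x` nearly lies between `w` and `a`: then `(x | a)_w` is at
least `dist w x - K`, and the point of `[w, a]` at distance `dist w x` from `w` has product `dist w
x` with `a`. -/
theorem IsHyperbolicWith.dist_geod_le (hδ : IsHyperbolicWith Y δ) (hg : IsGeodesicSpace Y)
    {w x a : Y} {K : ℝ} (h : gromovProduct x w a ≤ K) (hd : dist w x ≤ dist w a) :
    dist x (geod hg w a (dist w x)) ≤ 2 * K + 2 * δ := by
  have h0 := gromovProduct_nonneg x w a
  have h1 : dist w x - K ≤ gromovProduct w x a := by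
    linarith [gromovProduct_add w x a]
  have h2 : dist w x - K ≤ gromovProduct w a (geod hg w a (dist w x)) := by
    unfold gromovProduct
    rw [dist_comm a, dist_geod_right hg dist_nonneg hd, dist_left_geod hg dist_nonneg hd]
    linarith
  have h3 := hδ.le_gromovProduct h1 h2
  rw [dist_eq_sub_gromovProduct w, dist_left_geod hg dist_nonneg hd]
  linarith

/-- The points `a` may escape in any directions; a limit along an ultrafilter retains the closeness
to `x`, which is all that is needed. -/
theorem exists_ray_near [ProperSpace Y] (hg : IsGeodesicSpace Y) (hδ : IsHyperbolicWith Y δ)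
    {w x : Y} {K : ℝ} (h : ∀ N : ℝ, ∃ a, N ≤ dist x a ∧ gromovProduct x w a ≤ K) :
    ∃ α : GeodesicRay Y, α 0 = w ∧ ∃ t, dist x (α t) ≤ 2 * K + 2 * δ := by
  choose a ha hwa using fun n : ℕ => h n
  obtain ⟨α, h0, hα⟩ := exists_ray_limit hg w x a ha
  refine ⟨α, h0, ⟨dist w x, dist_nonneg⟩, ?_⟩
  refine dist_le_of_eventually tendsto_const_nhds (hα _) ?_
  filter_upwards [eventually_ge_atTop ⌈2 * dist w x⌉₊] with n hn
  have h1 : 2 * dist w x ≤ n := Nat.ceil_le.1 hn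
  exact hδ.dist_geod_le hg (hwa n) (by linarith [ha n, dist_triangle_left x (a n) w])

/-! ### Endpoints -/

theorem GeodesicRay.dist_eq (α : GeodesicRay Y) (s t : ℝ≥0) :
    dist (α s) (α t) = |(s : ℝ) - t| :=
  (α.isometry.dist_eq s t).trans rfl

theorem GeodesicRay.dist_zero (α : GeodesicRay Y) (t : ℝ≥0) : dist (α 0) (α t) = t := by
  rw [α.dist_eq]
  simp

theorem GeodesicLine.dist_eq (ℓ : GeodesicLine Y) (s t : ℝ) :
    dist (ℓ.toFun s) (ℓ.toFun t) = |s - t| :=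
  (ℓ.isometry.dist_eq s t).trans rfl

/-- If `α t` is close to `β s`, then `s` and `t` differ by a bounded amount, because they are the
distances to the initial points; hence finite Hausdorff distance gives a bound at equal times. -/
theorem endpoint_eq_iff (α β : GeodesicRay Y) :
    α.endpoint = β.endpoint ↔ ∃ D : ℝ, ∀ t, dist (α t) (β t) ≤ D := by
  refine (Quotient.eq (r := GeodesicRay.setoid Y)).trans ?_
  constructor
  · intro h
    obtain ⟨D, hD⟩ := ENNReal.lt_iff_exists_nnreal_btwn.1 (lt_top_iff_ne_top.2 h)
    refine ⟨2 * D + dist (α 0) (β 0), fun t => ?_⟩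
    obtain ⟨_, ⟨s, rfl⟩, hs⟩ :=
      Metric.exists_edist_lt_of_hausdorffEDist_lt (Set.mem_range_self t) hD.1
    have hs' : dist (α t) (β s) ≤ D := by
      rw [edist_nndist, ENNReal.coe_lt_coe] at hs
      exact_mod_cast hs.le
    have h1 : |(t : ℝ) - s| ≤ D + dist (α 0) (β 0) := by
      rw [abs_le]
      constructor
      · linarith [dist_triangle4 (β 0) (α 0) (α t) (β s), α.dist_zero t, β.dist_zero s,
          dist_comm (α 0) (β 0)]
      · linarith [dist_triangle4 (α 0) (β 0) (β s) (α t), α.dist_zero t, β.dist_zero s,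
          dist_comm (α t) (β s)]
    have h2 := β.dist_eq s t
    rw [abs_sub_comm] at h2
    linarith [dist_triangle (α t) (β s) (β t)]
  · rintro ⟨D, hD⟩
    refine ne_top_of_le_ne_top (ENNReal.ofReal_ne_top (r := D))
      (Metric.hausdorffEDist_le_of_mem_edist ?_ ?_)
    · rintro _ ⟨t, rfl⟩
      exact ⟨_, ⟨t, rfl⟩, by rw [edist_dist]; exact ENNReal.ofReal_le_ofReal (hD t)⟩
    · rintro _ ⟨t, rfl⟩
      exact ⟨_, ⟨t, rfl⟩, by
        rw [edist_dist, dist_comm]; exact ENNReal.ofReal_le_ofReal (hD t)⟩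

theorem GromovBoundary.exists_rep (a : GromovBoundary Y) :
    ∃ α : GeodesicRay Y, α.endpoint = a :=
  Quotient.exists_rep a

/-- Every boundary point is the endpoint of a ray from any prescribed point. -/
theorem exists_ray_to [ProperSpace Y] (hg : IsGeodesicSpace Y) (hδ : IsHyperbolicWith Y δ)
    (w : Y) (a : GromovBoundary Y) : ∃ α : GeodesicRay Y, α.IsFromTo w a := by
  obtain ⟨β, rfl⟩ := a.exists_rep
  obtain ⟨α, h0, hα⟩ := exists_ray_limit hg w (β 0) (fun n => β n) (fun n => by
    rw [β.dist_zero]; simp)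
  refine ⟨α, h0, (endpoint_eq_iff _ _).2 ⟨3 * dist w (β 0) + 2 * δ, fun t => ?_⟩⟩
  refine dist_le_of_eventually (hα t) tendsto_const_nhds ?_
  filter_upwards [eventually_ge_atTop ⌈t + dist w (β 0)⌉₊] with n hn
  have h1 : t + dist w (β 0) ≤ n := Nat.ceil_le.1 hn
  have h2 := β.dist_zero n
  have h3 : dist (β 0) (β n) ≤ dist w (β 0) + dist w (β n) := dist_triangle_left _ _ _
  rw [NNReal.coe_natCast] at h2
  refine hδ.fellow_travel (b := β n) (t := t)
    (dist_left_geod hg t.2 (by linarith)) (dist_geod_right hg t.2 (by linarith))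
    (β.dist_zero t) ?_
  rw [h2, β.dist_eq, NNReal.coe_natCast, abs_sub_comm, abs_of_nonneg]
  linarith [dist_nonneg (x := w) (y := β 0)]

theorem GeodesicLine.endpoint_ne (ℓ : GeodesicLine Y) : ℓ.negRay.endpoint ≠ ℓ.posRay.endpoint := by
  intro h
  obtain ⟨D, hD⟩ := (endpoint_eq_iff _ _).1 h
  have h1 := hD ⟨|D| + 1, by positivity⟩
  have h2 := ℓ.dist_eq (-(|D| + 1)) (|D| + 1)
  change dist (ℓ.toFun (-(|D| + 1))) (ℓ.toFun (|D| + 1)) ≤ D at h1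
  rw [h2, abs_sub_comm, abs_of_nonneg (by linarith [abs_nonneg D])] at h1
  linarith [le_abs_self D, abs_nonneg D]

/-- If geodesics from `w` to `a`, from `w` to `b`, and from `a` to `b` pass near `x` for points
`a` and `b` arbitrarily far away, then there are rays from `w` and a bi-infinite geodesic joining
their endpoints which pass near `x`. -/
theorem exists_ideal_triangle_near [ProperSpace Y] (hg : IsGeodesicSpace Y)
    (hδ : IsHyperbolicWith Y δ) {w x : Y} {K : ℝ}
    (h : ∀ N : ℝ, ∃ a b, N ≤ dist x a ∧ N ≤ dist x b ∧ gromovProduct x a b ≤ K ∧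
      gromovProduct x w a ≤ K ∧ gromovProduct x w b ≤ K) :
    ∃ (a b : GromovBoundary Y) (α β : GeodesicRay Y) (ℓ : GeodesicLine Y),
      a ≠ b ∧ α.IsFromTo w a ∧ β.IsFromTo w b ∧ ℓ.IsFromTo a b ∧
      (∃ t, dist x (α t) ≤ 2 * K + 2 * δ) ∧ (∃ t, dist x (β t) ≤ 2 * K + 2 * δ) ∧
      ∃ t, dist x (ℓ.toFun t) ≤ 2 * K + 2 * δ := by
  choose a b ha hb hab hwa hwb using fun n : ℕ => h n
  have hK : 0 ≤ K := (gromovProduct_nonneg _ _ _).trans (hwa 0)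
  obtain ⟨α, hα0, hα⟩ := exists_ray_limit hg w x a ha
  obtain ⟨β, hβ0, hβ⟩ := exists_ray_limit hg w x b hb
  have key : ∀ c : ℕ → Y, (∀ n : ℕ, (n : ℝ) ≤ dist x (c n)) → (∀ n, gromovProduct x w (c n) ≤ K) →
      ∀ γ : GeodesicRay Y,
      (∀ t : ℝ≥0, Tendsto (fun n => geod hg w (c n) t) (hyperfilter ℕ) (nhds (γ t))) →
      ∃ t, dist x (γ t) ≤ 2 * K + 2 * δ := by
    intro c hc hwc γ hγ
    refine ⟨⟨dist w x, dist_nonneg⟩, dist_le_of_eventually tendsto_const_nhds (hγ _) ?_⟩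
    filter_upwards [eventually_ge_atTop ⌈2 * dist w x⌉₊] with n hn
    have h1 : 2 * dist w x ≤ n := Nat.ceil_le.1 hn
    exact hδ.dist_geod_le hg (hwc n) (by linarith [hc n, dist_triangle_left x (c n) w])
  -- The distance from `a n` at which the geodesic from `a n` to `b n` passes closest to `x` in the
  -- comparison tripod of `a n`, `b n`, `x`.
  set m : ℕ → ℝ := fun n => gromovProduct (a n) x (b n) with hm
  have hm0 : ∀ n, 0 ≤ m n := fun n => gromovProduct_nonneg _ _ _
  have hm1 : ∀ n, m n = dist x (a n) - gromovProduct x (a n) (b n) := fun n => by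
    linarith [gromovProduct_add x (a n) (b n)]
  have hm2 : ∀ n, dist (a n) (b n) - m n = dist x (b n) - gromovProduct x (a n) (b n) := by
    intro n
    rw [hm1]
    unfold gromovProduct
    ring
  have hmle : ∀ n, m n ≤ dist (a n) (b n) := fun n => gromovProduct_le_right _ _ _
  have hx : ∀ n, dist x (geod hg (a n) (b n) (m n)) ≤ K + 2 * δ := by
    intro n
    have h1 := hδ.four_point x (geod hg (a n) (b n) (m n)) (a n) (b n)
    have h2 := dist_left_geod hg (hm0 n) (hmle n)
    rw [dist_comm] at h2
    rw [h2, dist_geod_right hg (hm0 n) (hmle n)] at h1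
    have h3 : dist x (a n) + (dist (a n) (b n) - m n) =
      gromovProduct x (a n) (b n) + dist (a n) (b n) := by linarith [hm1 n]
    have h4 : dist x (b n) + m n =
      gromovProduct x (a n) (b n) + dist (a n) (b n) := by linarith [hm2 n]
    rw [h3, h4, max_self] at h1
    linarith [hab n]
  -- The geodesics are reparametrized so that time `0` is within `K + 2 * δ` of `x`. Both halves
  -- have length at least `n - K`, so the limit is defined on all of `ℝ`.
  obtain ⟨l, hl, hlim⟩ := exists_isometry_limit (T := ℝ)
    (fun n t => geod hg (a n) (b n) (t + m n))
    (fun s t => by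
      filter_upwards [eventually_ge_atTop ⌈|s| + |t| + K⌉₊] with n hn
      have h1 : |s| + |t| + K ≤ n := Nat.ceil_le.1 hn
      have := ha n
      have := hb n
      have := hab n
      have := hm1 n
      have := hm2 n
      have := abs_le.1 (le_refl |s|)
      have := abs_le.1 (le_refl |t|)
      rw [dist_geod hg (by linarith) (by linarith) (by linarith) (by linarith), Real.dist_eq]
      congr 1
      ring) 0 x (K + 2 * δ) (fun n => by simpa only [dist_comm, zero_add] using hx n)
  let ℓ : GeodesicLine Y := ⟨l, hl⟩
  have hpos : ℓ.posRay.endpoint = β.endpoint := by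
    refine (endpoint_eq_iff _ _).2 ⟨3 * (K + 2 * δ + dist w x) + 2 * δ, fun t => ?_⟩
    refine dist_le_of_eventually (hlim t) (hβ t) ?_
    filter_upwards [eventually_ge_atTop ⌈t + K + dist w x⌉₊] with n hn
    have h1 : t + K + dist w x ≤ n := Nat.ceil_le.1 hn
    have ht : (0 : ℝ) ≤ t := t.2
    have := hb n
    have := hab n
    have e2 := hm2 n
    have := hm0 n
    have hwx := dist_nonneg (x := w) (y := x)
    have e3 := dist_triangle_left x (b n) w
    have e4 := hδ.fellow_travel (u := geod hg (a n) (b n) (m n)) (v := w)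
      (p := geod hg (a n) (b n) (t + m n)) (q := geod hg w (b n) t) (b := b n) (t := t)
      (by rw [dist_geod hg (by linarith) (by linarith) (by linarith) (by linarith)]; simp)
      (by rw [dist_geod_right hg (by linarith) (by linarith),
        dist_geod_right hg (by linarith) (by linarith)]; ring)
      (dist_left_geod hg ht (by linarith)) (dist_geod_right hg ht (by linarith))
    have := dist_triangle_left (geod hg (a n) (b n) (m n)) w x
    linarith [hx n, dist_comm w x]
  have hneg : ℓ.negRay.endpoint = α.endpoint := by
    refine (endpoint_eq_iff _ _).2 ⟨3 * (K + 2 * δ + dist w x) + 2 * δ, fun t => ?_⟩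
    refine dist_le_of_eventually (hlim (-(t : ℝ))) (hα t) ?_
    filter_upwards [eventually_ge_atTop ⌈t + K + dist w x⌉₊] with n hn
    have h1 : t + K + dist w x ≤ n := Nat.ceil_le.1 hn
    have ht : (0 : ℝ) ≤ t := t.2
    have := ha n
    have := hab n
    have e1 := hm1 n
    have := hmle n
    have hwx := dist_nonneg (x := w) (y := x)
    have e3 := dist_triangle_left x (a n) w
    have e4 := hδ.fellow_travel (u := geod hg (a n) (b n) (m n)) (v := w)
      (p := geod hg (a n) (b n) (-t + m n)) (q := geod hg w (a n) t) (b := a n) (t := t)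
      (by
        rw [dist_geod hg (by linarith) (by linarith) (by linarith) (by linarith)]
        simp)
      (by
        rw [dist_comm, dist_left_geod hg (by linarith) (by linarith), dist_comm,
          dist_left_geod hg (by linarith) (by linarith)]
        ring)
      (dist_left_geod hg ht (by linarith)) (dist_geod_right hg ht (by linarith))
    have := dist_triangle_left (geod hg (a n) (b n) (m n)) w x
    linarith [hx n, dist_comm w x]
  refine ⟨ℓ.negRay.endpoint, ℓ.posRay.endpoint, α, β, ℓ, ℓ.endpoint_ne, ⟨hα0, hneg.symm⟩,
    ⟨hβ0, hpos.symm⟩, ⟨rfl, rfl⟩, key a ha hwa α hα, key b hb hwb β hβ, 0, ?_⟩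
  refine dist_le_of_eventually tendsto_const_nhds (hlim 0) (Eventually.of_forall fun n => ?_)
  simp only [zero_add]
  linarith [hx n]

end Hyperbolic

/-! ### Change of base point, products at infinity, and visual completeness against uniform
perfectness. -/

section Boundary

variable {Y : Type*} [MetricSpace Y] {δ : ℝ}

theorem GeodesicRay.le_gromovProduct_of_near (α : GeodesicRay Y) {x : Y} {s t : ℝ≥0} (hst : s ≤ t) :
    gromovProduct x (α 0) (α t) ≤ dist x (α s) := by
  have h1 := α.dist_zero t
  have h2 := dist_triangle x (α s) (α 0)
  have h3 := dist_triangle x (α s) (α t)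
  rw [α.dist_eq, abs_sub_comm, abs_of_nonneg (sub_nonneg.2 (NNReal.coe_le_coe.2 hst))] at h3
  rw [dist_comm (α s), α.dist_zero] at h2
  unfold gromovProduct
  linarith

theorem GeodesicRay.gromovProduct_zero (α : GeodesicRay Y) {s t : ℝ≥0} (hst : s ≤ t) :
    gromovProduct (α 0) (α s) (α t) = s := by
  unfold gromovProduct
  rw [α.dist_zero, α.dist_zero, α.dist_eq, abs_sub_comm,
    abs_of_nonneg (sub_nonneg.2 (NNReal.coe_le_coe.2 hst))]
  ring

/-! ### Change of base point -/

/-- Far points of a ray from `w` that passes near `x` have bounded product with `w` at `x`, and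
replacing `w` by `w'` adds at most `dist w w'`. -/
theorem IsVisualFrom.change_base [ProperSpace Y] (hg : IsGeodesicSpace Y)
    (hδ : IsHyperbolicWith Y δ) {w : Y} (h : IsVisualFrom Y w) (w' : Y) : IsVisualFrom Y w' := by
  obtain ⟨C, hC, h⟩ := h
  have hδ0 := hδ.nonneg w
  refine ⟨2 * (C + dist w w') + 2 * δ, by positivity, fun x => ?_⟩
  obtain ⟨α, rfl, t, ht⟩ := h x
  refine exists_ray_near hg hδ fun N => ?_
  obtain ⟨n, hn⟩ := exists_nat_ge (N + dist x (α 0))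
  refine ⟨α (max n t), ?_, ?_⟩
  · have h1 := α.dist_zero (max n t)
    have h2 : (n : ℝ) ≤ (max (n : ℝ≥0) t : ℝ≥0) := by
      exact_mod_cast le_max_left (n : ℝ≥0) t
    linarith [dist_triangle_left (α 0) (α (max n t)) x]
  · have h1 := α.le_gromovProduct_of_near (x := x) (le_max_right (n : ℝ≥0) t)
    linarith [gromovProduct_le_change x w' (α 0) (α (max n t)), dist_comm w' (α 0)]

theorem GeodesicLine.gromovProduct_le (ℓ : GeodesicLine Y) {x : Y} {u S : ℝ} (hu : |u| ≤ S) :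
    gromovProduct x (ℓ.toFun (-S)) (ℓ.toFun S) ≤ dist x (ℓ.toFun u) := by
  have h1 := dist_triangle x (ℓ.toFun u) (ℓ.toFun S)
  have h2 := dist_triangle x (ℓ.toFun u) (ℓ.toFun (-S))
  have h3 := abs_le.1 hu
  rw [ℓ.dist_eq, abs_sub_comm, abs_of_nonneg (by linarith)] at h1
  rw [ℓ.dist_eq, abs_of_nonneg (by linarith)] at h2
  unfold gromovProduct
  rw [ℓ.dist_eq, abs_sub_comm, abs_of_nonneg (by linarith [abs_nonneg u])]
  linarith

/-- Points on a ray far from `x` have large products with respect to `x` with the points of an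
equivalent ray. -/
theorem GeodesicRay.exists_gromovProduct_ge (hδ : IsHyperbolicWith Y δ) {α β : GeodesicRay Y}
    (h : α.endpoint = β.endpoint) (x : Y) (M : ℝ) :
    ∃ T : ℝ≥0, ∀ s t, T ≤ s → T ≤ t → M ≤ gromovProduct x (α s) (β t) := by
  obtain ⟨D, hD⟩ := (endpoint_eq_iff _ _).1 h
  have hD0 : 0 ≤ D := dist_nonneg.trans (hD 0)
  have h0 := hδ.nonneg x
  refine ⟨⟨|M| + D + dist x (α 0) + δ, by positivity⟩, fun s t hs ht => ?_⟩
  have hs' : |M| + D + dist x (α 0) + δ ≤ s := hs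
  have ht' : |M| + D + dist x (α 0) + δ ≤ t := ht
  rcases le_total s t with hst | hst
  · have e1 := α.gromovProduct_zero hst
    have e3 := gromovProduct_le_change x (α t) (β t) (α s)
    rw [gromovProduct_comm, gromovProduct_comm x (β t)] at e3
    linarith [gromovProduct_le_base (α 0) x (α s) (α t), hD t, le_abs_self M,
      dist_comm x (α 0)]
  · have e1 := α.gromovProduct_zero hst
    have e3 := gromovProduct_le_change x (α t) (β t) (α s)
    rw [gromovProduct_comm, gromovProduct_comm x (β t)] at e3
    rw [gromovProduct_comm] at e1
    linarith [gromovProduct_le_base (α 0) x (α s) (α t), hD t, le_abs_self M,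
      dist_comm x (α 0)]

/-- Far points of `α` and `β` lie, as seen from `x`, in the directions of the two ends of `ℓ`, and
these have product at most `C` because `ℓ` passes within `C` of `x`. -/
theorem GeodesicLine.exists_gromovProduct_le (hδ : IsHyperbolicWith Y δ) {α β : GeodesicRay Y}
    {ℓ : GeodesicLine Y} (h : ℓ.IsFromTo α.endpoint β.endpoint) {x : Y} {C : ℝ}
    (hx : ∃ u, dist x (ℓ.toFun u) ≤ C) :
    ∃ T : ℝ≥0, ∀ s t, T ≤ s → T ≤ t → gromovProduct x (α s) (β t) ≤ C + 2 * δ := by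
  obtain ⟨u, hu⟩ := hx
  obtain ⟨T₁, h1⟩ := GeodesicRay.exists_gromovProduct_ge hδ h.1 x (C + 2 * δ + 1)
  obtain ⟨T₂, h2⟩ := GeodesicRay.exists_gromovProduct_ge hδ h.2 x (C + 2 * δ + 1)
  refine ⟨max T₁ T₂, fun s t hs ht => ?_⟩
  -- With `|u| ≤ S` the point of `ℓ` near `x` lies between `ℓ (-S)` and `ℓ S`.
  let S : ℝ≥0 := max (max T₁ T₂) ⟨|u|, abs_nonneg u⟩
  have hS : |u| ≤ (S : ℝ) := le_max_right (max T₁ T₂) ⟨|u|, abs_nonneg u⟩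
  have hS' : max T₁ T₂ ≤ S := le_max_left _ _
  have h3 := ℓ.gromovProduct_le (x := x) hS
  have h4 := h1 S s ((le_max_left _ _).trans hS') ((le_max_left _ _).trans hs)
  have h5 := h2 S t ((le_max_right _ _).trans hS') ((le_max_right _ _).trans ht)
  rw [gromovProduct_comm] at h4 h5
  change _ ≤ gromovProduct x _ (ℓ.toFun (-S)) at h4
  change _ ≤ gromovProduct x _ (ℓ.toFun S) at h5
  exact hδ.le_of_lt' (h3.trans hu) (by linarith) (by linarith)

/-- The three products at `x` are bounded for far points of the old rays.
`exists_ideal_triangle_near` then supplies new boundary points, which never have to be compared with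
the old ones. -/
theorem IsVisuallyCompleteFrom.change_base [ProperSpace Y] (hg : IsGeodesicSpace Y)
    (hδ : IsHyperbolicWith Y δ) {w : Y} (h : IsVisuallyCompleteFrom Y w) (w' : Y) :
    IsVisuallyCompleteFrom Y w' := by
  obtain ⟨C, hC, h⟩ := h
  have hδ0 := hδ.nonneg w
  refine ⟨2 * (C + dist w w' + 2 * δ) + 2 * δ, by positivity, fun x => ?_⟩
  obtain ⟨a, b, α, β, ℓ, -, ⟨hα0, rfl⟩, ⟨hβ0, rfl⟩, hℓ, ⟨s, hs⟩, ⟨t, ht⟩, hu⟩ := h x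
  refine exists_ideal_triangle_near hg hδ fun N => ?_
  obtain ⟨T, hT⟩ := ℓ.exists_gromovProduct_le hδ hℓ hu
  obtain ⟨n, hn⟩ := exists_nat_ge (N + dist x w)
  let R : ℝ≥0 := max n (max T (max s t))
  have hR : (n : ℝ) ≤ R := by exact_mod_cast le_max_left (n : ℝ≥0) _
  have hRT : T ≤ R := (le_max_left _ _).trans (le_max_right _ _)
  have hRs : s ≤ R := (le_max_left _ _).trans ((le_max_right _ _).trans (le_max_right _ _))
  have hRt : t ≤ R := (le_max_right _ _).trans ((le_max_right _ _).trans (le_max_right _ _))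
  have e1 := α.dist_zero R
  have e2 := β.dist_zero R
  have e3 := α.le_gromovProduct_of_near (x := x) hRs
  have e4 := β.le_gromovProduct_of_near (x := x) hRt
  rw [hα0] at e1 e3
  rw [hβ0] at e2 e4
  have hw := dist_nonneg (x := w) (y := w')
  refine ⟨α R, β R, ?_, ?_, ?_, ?_, ?_⟩
  · linarith [dist_triangle_left w (α R) x]
  · linarith [dist_triangle_left w (β R) x]
  · linarith [hT R R hRT hRT]
  · linarith [gromovProduct_le_change x w' w (α R), dist_comm w w']
  · linarith [gromovProduct_le_change x w' w (β R), dist_comm w w']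

/-! ### Gromov products on the boundary -/

theorem le_boundaryProduct {o : Y} {a b : GromovBoundary Y} {α β : GeodesicRay Y}
    (hα : α.IsFromTo o a) (hβ : β.IsFromTo o b) (s t : ℝ≥0) :
    ENNReal.ofReal (gromovProduct o (α s) (β t)) ≤ boundaryProduct o a b :=
  le_iSup_of_le α <| le_iSup_of_le β <| le_iSup_of_le hα <| le_iSup_of_le hβ <|
    le_iSup_of_le s <| le_iSup_of_le t le_rfl

theorem boundaryProduct_le {o : Y} {a b : GromovBoundary Y} {c : ℝ}
    (h : ∀ α β : GeodesicRay Y, α.IsFromTo o a → β.IsFromTo o b → ∀ s t,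
      gromovProduct o (α s) (β t) ≤ c) : boundaryProduct o a b ≤ ENNReal.ofReal c :=
  iSup_le fun α => iSup_le fun β => iSup_le fun hα => iSup_le fun hβ => iSup_le fun s =>
    iSup_le fun t => ENNReal.ofReal_le_ofReal (h α β hα hβ s t)

theorem expNeg_le {ε c : ℝ} {p : ℝ≥0∞} (hε : 0 < ε) (h : ENNReal.ofReal c ≤ p) :
    expNeg ε p ≤ Real.exp (-(ε * c)) := by
  unfold expNeg
  split_ifs with hp
  · positivity
  · have := (ENNReal.ofReal_le_iff_le_toReal hp).1 h
    gcongr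

theorem le_expNeg {ε c : ℝ} {p : ℝ≥0∞} (hε : 0 < ε) (hc : 0 ≤ c) (h : p ≤ ENNReal.ofReal c) :
    Real.exp (-(ε * c)) ≤ expNeg ε p := by
  unfold expNeg
  rw [if_neg (ne_top_of_le_ne_top ENNReal.ofReal_ne_top h)]
  have := ENNReal.toReal_le_of_le_ofReal hc h
  gcongr

/-- The comparison goes through a common far time `S`: along each single ray the product with the
point at time `S` is the smaller time, and the two points at time `S` have large product. -/
theorem GeodesicRay.le_gromovProduct_of_endpoint_eq (hδ : IsHyperbolicWith Y δ)
    {α β : GeodesicRay Y} (h0 : α 0 = β 0) (h : α.endpoint = β.endpoint) {s t : ℝ≥0} {c : ℝ}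
    (hs : c ≤ s) (ht : c ≤ t) : c - 2 * δ ≤ gromovProduct (α 0) (α s) (β t) := by
  obtain ⟨T, hT⟩ := GeodesicRay.exists_gromovProduct_ge hδ h (α 0) c
  let S := max T (max s t)
  have h1 := hT S S (le_max_left _ _) (le_max_left _ _)
  have h2 := α.gromovProduct_zero (s := s) (t := S) ((le_max_left _ _).trans (le_max_right _ _))
  have h3 := β.gromovProduct_zero (s := t) (t := S) ((le_max_right _ _).trans (le_max_right _ _))
  rw [← h0, gromovProduct_comm] at h3
  have h4 := hδ.le_gromovProduct (h2.symm ▸ hs) h1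
  have := hδ.nonneg (α 0)
  linarith [hδ.le_gromovProduct h4 (by linarith : c - δ ≤ gromovProduct (α 0) (β S) (β t))]

/-- If a bi-infinite geodesic passes at distance `c` from `o`, then the Gromov product of its
endpoints is at most `c`, up to a constant. -/
theorem GeodesicLine.boundaryProduct_le (hδ : IsHyperbolicWith Y δ) {o : Y}
    {a b : GromovBoundary Y} {ℓ : GeodesicLine Y} (h : ℓ.IsFromTo a b) {c u : ℝ}
    (hu : dist o (ℓ.toFun u) ≤ c) :
    boundaryProduct o a b ≤ ENNReal.ofReal (c + 4 * δ) := by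
  refine RelHyp.boundaryProduct_le fun α β hα hβ s t => ?_
  have hδ0 := hδ.nonneg o
  obtain ⟨T, hT⟩ := ℓ.exists_gromovProduct_le (α := α) (β := β) hδ
    (by rw [hα.2, hβ.2]; exact h) ⟨u, hu⟩
  let S := max T (max s t)
  have hSs : s ≤ S := (le_max_left _ _).trans (le_max_right _ _)
  have hSt : t ≤ S := (le_max_right _ _).trans (le_max_right _ _)
  have h1 := hT S S (le_max_left _ _) (le_max_left _ _)
  have h2 := α.gromovProduct_zero hSs
  have h3 := β.gromovProduct_zero hSt
  have h4 := α.dist_zero s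
  have h5 := β.dist_zero t
  rw [hα.1] at h2 h4
  rw [hβ.1] at h3 h5
  have h6 := gromovProduct_le_left o (α s) (β t)
  have h7 := gromovProduct_le_right o (α s) (β t)
  rw [gromovProduct_comm] at h2
  -- Since `(α s | β t)` is at most `s = (α s | α S)`, moving from `α s` to `α S` loses only `δ`;
  -- likewise for `β`.
  have h8 := hδ.le_gromovProduct (h6.trans (h4.trans h2.symm).le) le_rfl
  have h9 := hδ.le_gromovProduct h8
    (by linarith : gromovProduct o (α s) (β t) - δ ≤ gromovProduct o (β t) (β S))
  linarith

/-- The Gromov product of two boundary points is almost attained along any two rays. -/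
theorem exists_le_gromovProduct (hδ : IsHyperbolicWith Y δ) {o : Y}
    {a b : GromovBoundary Y} {ε c : ℝ} (hε : 0 < ε) (hc : 0 ≤ c)
    (h : expNeg ε (boundaryProduct o a b) < Real.exp (-(ε * c)))
    {α β : GeodesicRay Y} (hα : α.IsFromTo o a) (hβ : β.IsFromTo o b) :
    ∃ T : ℝ≥0, ∀ s t, T ≤ s → T ≤ t → c - 4 * δ ≤ gromovProduct o (α s) (β t) := by
  have hδ0 := hδ.nonneg o
  by_contra! hcon
  -- If the products along `α`, `β` drop below `c - 4 * δ` arbitrarily far out, then no pair of rays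
  -- to `a`, `b` can have a product above `c`: transferring such a product to far points of `α`, `β`
  -- costs only `4 * δ`.
  refine h.not_ge (le_expNeg hε hc (boundaryProduct_le fun α' β' hα' hβ' s' t' => ?_))
  obtain ⟨s, t, hs, ht, hst⟩ := hcon (max s' t')
  by_contra! hlt
  have h4 := α'.dist_zero s'
  have h5 := β'.dist_zero t'
  rw [hα'.1] at h4
  rw [hβ'.1] at h5
  have h6 := gromovProduct_le_left o (α' s') (β' t')
  have h7 := gromovProduct_le_right o (α' s') (β' t')
  have hs1 : (s' : ℝ) ≤ s := NNReal.coe_le_coe.2 ((le_max_left _ _).trans hs)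
  have ht1 : (t' : ℝ) ≤ t := NNReal.coe_le_coe.2 ((le_max_right _ _).trans ht)
  have e1 := GeodesicRay.le_gromovProduct_of_endpoint_eq hδ (hα.1.trans hα'.1.symm)
    (hα.2.trans hα'.2.symm) (c := c) (s := s) (t := s') (by linarith) (by linarith)
  have e2 := GeodesicRay.le_gromovProduct_of_endpoint_eq hδ (hβ'.1.trans hβ.1.symm)
    (hβ'.2.trans hβ.2.symm) (c := c) (s := t') (t := t) (by linarith) (by linarith)
  rw [hα.1] at e1
  rw [hβ'.1] at e2
  have e3 := hδ.le_gromovProduct e1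
    (by linarith : c - 2 * δ ≤ gromovProduct o (α' s') (β' t'))
  have e4 := hδ.le_gromovProduct e3 (by linarith : c - 2 * δ - δ ≤ _)
  linarith

/-! ### Visual completeness and uniform perfectness -/

theorem IsVisuallyCompleteFrom.isVisualFrom {w : Y} (h : IsVisuallyCompleteFrom Y w) :
    IsVisualFrom Y w := by
  obtain ⟨C, hC, h⟩ := h
  refine ⟨C, hC, fun x => ?_⟩
  obtain ⟨_, _, α, _, _, -, hα, -, -, hx, -⟩ := h x
  exact ⟨α, hα.1, hx⟩

theorem IsVisuallyCompleteFrom.nontrivial {w : Y} (h : IsVisuallyCompleteFrom Y w) :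
    Nontrivial (GromovBoundary Y) := by
  obtain ⟨C, hC, h⟩ := h
  obtain ⟨a, b, _, _, _, hab, -⟩ := h w
  exact ⟨a, b, hab⟩

/-- At the point `x` of a ray to `z` at the depth that corresponds to `r`, visual completeness gives
`b` and `c`. Their rays pass near `x`, so both are closer than `r` to `z`; the line joining them
also passes near `x`, so they are not much closer than `r` to each other. Hence one of them is not
too close to `z`. -/
theorem IsVisuallyCompleteFrom.uniformlyPerfect [ProperSpace Y] (hg : IsGeodesicSpace Y)
    (hδ : IsHyperbolicWith Y δ) {o : Y} {ε : ℝ} {ρ : MetricSpace (GromovBoundary Y)}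
    (hρ : IsVisualMetric o ε ρ) (h : IsVisuallyCompleteFrom Y o) :
    @UniformlyPerfect (GromovBoundary Y) ρ := by
  obtain ⟨hε, C₀, hC₀, hρ⟩ := hρ
  obtain ⟨C, hC, h⟩ := h
  have hδ0 := hδ.nonneg o
  -- Chosen such that the lower bound for `ρ b c`, namely `1 / C₀` times `r / (2 * C₀)` divided by
  -- the exponential, is `2 * (r / M)`.
  set M := 4 * C₀ ^ 2 * Real.exp (ε * (2 * C + 4 * δ)) with hM
  have hMpos : 0 < M := by positivity
  refine ⟨M + 2, by linarith, fun z r hr hdiam => ?_⟩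
  have hexp1 : ∀ a b : GromovBoundary Y, expNeg ε (boundaryProduct o a b) ≤ 1 := fun a b =>
    (expNeg_le (c := 0) hε (by simp)).trans (by simp)
  -- Products at infinity are nonnegative, so the diameter is at most `C₀`; this makes the logarithm
  -- in `t` nonnegative.
  have hr' : r ≤ C₀ := by
    have : Metric.ediam (Set.univ : Set (GromovBoundary Y)) ≤ ENNReal.ofReal C₀ := by
      refine Metric.ediam_le fun a _ b _ => ?_
      rw [edist_dist]
      exact ENNReal.ofReal_le_ofReal ((hρ a b).2.trans
        (mul_le_of_le_one_right hC₀.le (hexp1 a b)))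
    exact (ENNReal.ofReal_le_ofReal_iff hC₀.le).1 (hdiam.trans this)
  obtain ⟨α, hα⟩ := exists_ray_to hg hδ o z
  -- The solution of `exp (-ε (t - C)) = r / (2 * C₀)`: a ray passing within `C` of depth `t` ends
  -- at distance at most `r / 2` from `z`.
  set t : ℝ := C + Real.log (2 * C₀ / r) / ε with ht
  have hlog : 0 ≤ Real.log (2 * C₀ / r) :=
    Real.log_nonneg ((one_le_div hr).2 (by linarith))
  have ht0 : 0 ≤ t := by positivity
  have het : Real.exp (-(ε * (t - C))) = r / (2 * C₀) := by
    rw [ht, add_sub_cancel_left, mul_div_cancel₀ _ hε.ne', Real.exp_neg, Real.exp_log (by positivity),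
      inv_div]
  set x := α ⟨t, ht0⟩ with hx
  have hox : dist o x = t := by
    rw [← hα.1]
    exact α.dist_zero _
  obtain ⟨b, c, β, γ, ℓ, -, hβ, hγ, hℓ, hs, hs', u, hu⟩ := h x
  have key : ∀ (b : GromovBoundary Y) (β : GeodesicRay Y), β.IsFromTo o b →
      (∃ s, dist x (β s) ≤ C) → ρ.dist z b < r := by
    rintro b β hβ ⟨s, hs⟩
    have e1 : t - C ≤ gromovProduct o x (β s) := by
      unfold gromovProduct
      linarith [dist_triangle_right o x (β s)]
    have e2 := expNeg_le hε ((ENNReal.ofReal_le_ofReal e1).trans (le_boundaryProduct hα hβ _ _))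
    rw [het] at e2
    calc ρ.dist z b ≤ C₀ * expNeg ε (boundaryProduct o z b) := (hρ z b).2
      _ ≤ C₀ * (r / (2 * C₀)) := by gcongr
      _ = r / 2 := by field_simp
      _ < r := by linarith
  have hb := key b β hβ hs
  have hc := key c γ hγ hs'
  have hbc : 2 * (r / (M + 2)) ≤ ρ.dist b c := by
    have e1 := ℓ.boundaryProduct_le hδ (o := o) (c := t + C) hℓ
      (by linarith [dist_triangle o x (ℓ.toFun u)])
    have e2 := le_expNeg hε (by positivity) e1
    have e3 : Real.exp (-(ε * (t + C + 4 * δ))) =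
        r / (2 * C₀) / Real.exp (ε * (2 * C + 4 * δ)) := by
      rw [← het, ← Real.exp_sub]
      congr 1
      ring
    rw [e3] at e2
    calc 2 * (r / (M + 2)) ≤ 2 * (r / M) := by gcongr; linarith
      _ = 1 / C₀ * (r / (2 * C₀) / Real.exp (ε * (2 * C + 4 * δ))) := by
        rw [hM]
        field_simp
        ring
      _ ≤ 1 / C₀ * expNeg ε (boundaryProduct o b c) := by gcongr
      _ ≤ ρ.dist b c := (hρ b c).1
  have htri := ρ.dist_triangle b z c
  have hcomm := ρ.dist_comm z b
  have hcomm' := ρ.dist_comm z c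
  rcases le_or_gt (r / (M + 2)) (ρ.dist b z) with hbz | hbz
  · exact ⟨b, (show ρ.dist b z < r by rw [← hcomm]; exact hb), fun hb' => hbz.not_gt hb'⟩
  · refine ⟨c, (show ρ.dist c z < r by rw [← hcomm']; exact hc), fun hc' => ?_⟩
    have hc'' : ρ.dist c z < r / (M + 2) := hc'
    linarith

/-- If `x` is near `α t`, a point `b` of the annulus about the end of `α` with radius comparable to
`exp (-ε t)` has product `t` with that end, up to a constant. So the rays to both ends part near `α
t`, and the triangle formed by `o` and far points of the two rays has all its sides near `x`. -/
theorem IsVisualFrom.isVisuallyCompleteFrom [ProperSpace Y] (hg : IsGeodesicSpace Y)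
    (hδ : IsHyperbolicWith Y δ) {o : Y} {ε : ℝ} {ρ : MetricSpace (GromovBoundary Y)}
    (hρ : IsVisualMetric o ε ρ) (h : IsVisualFrom Y o) (hnt : Nontrivial (GromovBoundary Y))
    (hup : @UniformlyPerfect (GromovBoundary Y) ρ) : IsVisuallyCompleteFrom Y o := by
  obtain ⟨hε, C₀, hC₀, hρ⟩ := hρ
  obtain ⟨C, hC, h⟩ := h
  obtain ⟨l, hl, hup⟩ := hup
  have hδ0 := hδ.nonneg o
  obtain ⟨p, q, hpq⟩ := hnt
  have hD : 0 < ρ.dist p q := by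
    let _ := ρ
    exact dist_pos.2 hpq
  -- The first term keeps `r` below the diameter; the second makes `ρ < r` imply a product at
  -- infinity larger than `t`.
  set m := min (ρ.dist p q) (1 / C₀) with hm
  have hm0 : 0 < m := lt_min hD (by positivity)
  set C₁ := |Real.log (C₀ * l / m) / ε| with hC₁
  set K := 2 * C₁ + C + 10 * δ with hK
  have hK0 : 0 ≤ K := by positivity
  refine ⟨2 * K + 2 * δ, by positivity, fun x => ?_⟩
  obtain ⟨α, hα0, t, hxt⟩ := h x
  refine exists_ideal_triangle_near hg hδ fun N => ?_
  set r := m * Real.exp (-(ε * t)) with hr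
  have hr0 : 0 < r := by positivity
  have het1 : Real.exp (-(ε * t)) ≤ 1 := Real.exp_le_one_iff.2 (by
    have := t.coe_nonneg
    have : 0 ≤ ε * t := by positivity
    linarith)
  obtain ⟨b, hb, hb'⟩ := hup α.endpoint r hr0 (by
    let _ := ρ
    have e1 : edist p q ≤ Metric.ediam (Set.univ : Set (GromovBoundary Y)) :=
      Metric.edist_le_ediam_of_mem (Set.mem_univ _) (Set.mem_univ _)
    rw [edist_dist] at e1
    refine le_trans (ENNReal.ofReal_le_ofReal ?_) e1
    calc r ≤ m := mul_le_of_le_one_right hm0.le het1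
      _ ≤ ρ.dist p q := min_le_left _ _)
  have hb : ρ.dist α.endpoint b < r := by
    rw [ρ.dist_comm]
    exact hb
  have hb' : r / l ≤ ρ.dist α.endpoint b := by
    rw [ρ.dist_comm]
    exact not_lt.1 hb'
  obtain ⟨β, hβ⟩ := exists_ray_to hg hδ o b
  have hα : α.IsFromTo o α.endpoint := ⟨hα0, rfl⟩
  obtain ⟨T, hT⟩ := exists_le_gromovProduct hδ (c := t) hε t.coe_nonneg (by
    have e1 := (hρ α.endpoint b).1.trans_lt hb
    rw [one_div, inv_mul_lt_iff₀ hC₀] at e1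
    refine e1.trans_le ?_
    calc C₀ * r ≤ C₀ * ((1 / C₀) * Real.exp (-(ε * t))) :=
          mul_le_mul_of_nonneg_left (mul_le_mul_of_nonneg_right (min_le_right _ _)
            (Real.exp_pos _).le) hC₀.le
      _ = Real.exp (-(ε * t)) := by field_simp) hα hβ
  -- This is where uniform perfectness enters: `b` is not too close to the end of `α`, so the
  -- product cannot exceed `t` by more than `C₁`.
  have hupper : ∀ s s', gromovProduct o (α s) (β s') ≤ t + C₁ := by
    intro s s'
    by_contra! hlt
    have e1 := expNeg_le hε
      ((ENNReal.ofReal_le_ofReal hlt.le).trans (le_boundaryProduct hα hβ s s'))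
    have e1' := expNeg_le hε (le_boundaryProduct hα hβ s s')
    have e2 : Real.exp (-(ε * gromovProduct o (α s) (β s'))) < Real.exp (-(ε * (t + C₁))) := by
      gcongr
    have e3 : Real.exp (-(ε * (t + C₁))) ≤ r / (C₀ * l) := by
      have : Real.log (C₀ * l / m) ≤ ε * C₁ := by
        have := le_abs_self (Real.log (C₀ * l / m) / ε)
        rw [div_le_iff₀ hε] at this
        linarith
      have e4 : Real.exp (-(ε * C₁)) ≤ m / (C₀ * l) := by
        rw [Real.exp_neg, ← inv_div]
        refine inv_anti₀ (by positivity) ?_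
        rwa [← Real.log_le_iff_le_exp (by positivity)]
      calc Real.exp (-(ε * (t + C₁))) = Real.exp (-(ε * C₁)) * Real.exp (-(ε * t)) := by
            rw [← Real.exp_add]
            congr 1
            ring
        _ ≤ m / (C₀ * l) * Real.exp (-(ε * t)) := by gcongr
        _ = r / (C₀ * l) := by rw [hr]; ring
    have e5 : r / l ≤ C₀ * expNeg ε (boundaryProduct o α.endpoint b) :=
      hb'.trans (hρ _ _).2
    have e6 : C₀ * expNeg ε (boundaryProduct o α.endpoint b) < C₀ * (r / (C₀ * l)) := by
      gcongr
      linarith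
    have e7 : C₀ * (r / (C₀ * l)) = r / l := by
      field_simp
    linarith
  obtain ⟨n, hn⟩ := exists_nat_ge (N + dist x o)
  let R : ℝ≥0 := max n (max T t)
  have hRn : (n : ℝ) ≤ R := by exact_mod_cast le_max_left (n : ℝ≥0) _
  have hRT : T ≤ R := (le_max_left _ _).trans (le_max_right _ _)
  have hRt : t ≤ R := (le_max_right _ _).trans (le_max_right _ _)
  have d1 := α.dist_zero R
  have d2 := β.dist_zero R
  have d3 := α.dist_zero t
  rw [hα0] at d1 d3
  rw [hβ.1] at d2
  have p1 := hT R R hRT hRT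
  have p2 := hupper R R
  have d4 := α.dist_eq t R
  have hRt' : (t : ℝ) ≤ R := hRt
  rw [abs_sub_comm, abs_of_nonneg (by linarith)] at d4
  have p3 : t - 4 * δ ≤ gromovProduct o (α t) (α R) := by
    unfold gromovProduct
    linarith
  have p4 := hδ.le_gromovProduct p3 p1
  have hC10 : 0 ≤ C₁ := abs_nonneg _
  have q0 : gromovProduct (α t) o (α R) ≤ K - C := by
    unfold gromovProduct
    rw [dist_comm (α t) o]
    linarith
  have q1 : gromovProduct (α t) o (β R) ≤ K - C := by
    unfold gromovProduct at p4 ⊢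
    rw [dist_comm (α t) o]
    linarith
  have q2 : gromovProduct (α t) (α R) (β R) ≤ K - C := by
    unfold gromovProduct at p2 p4 ⊢
    linarith
  refine ⟨α R, β R, ?_, ?_, ?_, ?_, ?_⟩
  · linarith [dist_triangle_left o (α R) x]
  · linarith [dist_triangle_left o (β R) x]
  · linarith [gromovProduct_le_base x (α t) (α R) (β R)]
  · linarith [gromovProduct_le_base x (α t) o (α R)]
  · linarith [gromovProduct_le_base x (α t) o (β R)]

end Boundary

/-- The characterization of visual completeness by the boundary, and the independence of the base
points. -/
theorem visuallyComplete_characterization {Y : Type*} [MetricSpace Y] (hp : ProperSpace Y)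
    (hg : IsGeodesicSpace Y) (hh : IsGromovHyperbolic Y) :
    (∀ w : Y, IsVisuallyCompleteFrom Y w ↔ IsVisuallyComplete Y) ∧
    (∀ w : Y, IsVisualFrom Y w ↔ IsVisual Y) ∧
    ∀ (o : Y) (ε : ℝ) (ρ : MetricSpace (GromovBoundary Y)), IsVisualMetric o ε ρ →
      (IsVisuallyComplete Y ↔ IsVisual Y ∧ Nontrivial (GromovBoundary Y) ∧
        @UniformlyPerfect (GromovBoundary Y) ρ) := by
  obtain ⟨δ, hδ⟩ := hh
  have hc : ∀ w : Y, IsVisuallyCompleteFrom Y w ↔ IsVisuallyComplete Y := fun w =>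
    ⟨fun h => ⟨w, h⟩, fun ⟨_, h⟩ => h.change_base hg hδ w⟩
  have hv : ∀ w : Y, IsVisualFrom Y w ↔ IsVisual Y := fun w =>
    ⟨fun h => ⟨w, h⟩, fun ⟨_, h⟩ => h.change_base hg hδ w⟩
  refine ⟨hc, hv, fun o ε ρ hρ => ⟨fun h => ?_, fun ⟨h1, h2, h3⟩ => ?_⟩⟩
  · have h' := (hc o).2 h
    exact ⟨⟨o, h'.isVisualFrom⟩, h'.nontrivial, h'.uniformlyPerfect hg hδ hρ⟩
  · exact ⟨o, ((hv o).2 h1).isVisuallyCompleteFrom hg hδ hρ h2 h3⟩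

/-! ### Distances in the cusped space, by reduction of chains to two shapes. -/

section CuspMetric

variable {X : Type*} [MetricSpace X] {𝓟 : Set (Set X)} {δ C L : ℝ}

/-! ### Shortening chains in the cusped space -/

/-- `Exits H a x s`: the point `a` is connected inside its own piece to the point `x` of the base
space by a path of length `s`. -/
inductive Exits (H : HoroballFamily 𝓟 δ C L) : PreCusp H → X → ℝ → Prop
  | space (x : X) : Exits H (Sum.inl x) x 0
  | horoball (P : 𝓟) (p : (H P).Carrier) (x : (H P).base) :
      Exits H (Sum.inr ⟨P, p⟩) x (dist p ((H P).incl x))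

/-- The two shapes to which chains can be reduced: inside a horoball, or through the base space. -/
def Shortcut (H : HoroballFamily 𝓟 δ C L) (a b : PreCusp H) (r : ℝ) : Prop :=
  (∃ (P : 𝓟) (p q : (H P).Carrier), a = Sum.inr ⟨P, p⟩ ∧ b = Sum.inr ⟨P, q⟩ ∧ dist p q ≤ r) ∨
    ∃ x y s t, Exits H a x s ∧ Exits H b y t ∧ s + t ≤ r ∧
      (r < 1 → s + dist x y / max L 1 + t ≤ r)

theorem Exits.nonneg {H : HoroballFamily 𝓟 δ C L} {a : PreCusp H} {x : X} {s : ℝ}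
    (h : Exits H a x s) : 0 ≤ s := by
  cases h
  · exact le_rfl
  · exact dist_nonneg

theorem Shortcut.refl (H : HoroballFamily 𝓟 δ C L) (a : PreCusp H) : Shortcut H a a 0 := by
  rcases a with x | ⟨P, p⟩
  · exact Or.inr ⟨x, x, 0, 0, .space x, .space x, by simp, by simp⟩
  · exact Or.inl ⟨P, p, p, rfl, rfl, by simp⟩

/-- The constant is `max L 1` because `1 ≤ L` is known only once some horoball exists, while the
family may be empty. -/
theorem AdmissibleHoroball.dist_div_le {P : Set X} (A : AdmissibleHoroball P δ C L)
    {x y : A.base} (h : dist (A.incl x) (A.incl y) < 1) :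
    dist (x : X) y / max L 1 ≤ dist (A.incl x) (A.incl y) := by
  refine le_trans ?_ (A.dist_local x y h.le)
  have := A.one_le_L
  exact div_le_div_of_nonneg_left dist_nonneg (by linarith) (le_max_left L 1)

theorem Shortcut.space_trans {H : HoroballFamily 𝓟 δ C L} {x x' : X} {b : PreCusp H} {r : ℝ}
    (h : Shortcut H (Sum.inl x') b r) : Shortcut H (Sum.inl x) b (dist x x' + r) := by
  rcases h with ⟨P, p, q, h1, -⟩ | ⟨_, y, s, t, hs, ht, hst, hr⟩
  · cases h1
  · cases hs
    refine Or.inr ⟨x, y, 0, t, .space x, ht, by linarith [dist_nonneg (x := x) (y := x')],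
      fun h1 => ?_⟩
    have h2 := hr (by linarith [dist_nonneg (x := x) (y := x')])
    have h3 : dist x x' / max L 1 ≤ dist x x' := div_le_self dist_nonneg (le_max_right _ _)
    have h4 : dist x y / max L 1 ≤ dist x x' / max L 1 + dist x' y / max L 1 := by
      rw [← add_div]
      gcongr
      exact dist_triangle _ _ _
    linarith

theorem Shortcut.horoball_trans {H : HoroballFamily 𝓟 δ C L} {P : 𝓟} {p p' : (H P).Carrier}
    {b : PreCusp H} {r : ℝ} (h : Shortcut H (Sum.inr ⟨P, p'⟩) b r) :
    Shortcut H (Sum.inr ⟨P, p⟩) b (dist p p' + r) := by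
  rcases h with ⟨Q, q, q', h1, h2, h3⟩ | ⟨_, y, s, t, hs, ht, hst, hr⟩
  · cases h1
    exact Or.inl ⟨P, p, q', rfl, h2, (dist_triangle _ _ _).trans (by gcongr)⟩
  · cases hs with
    | horoball _ _ x =>
      have h0 := dist_triangle p p' ((H P).incl x)
      refine Or.inr ⟨x, y, _, t, .horoball P p x, ht, by linarith, fun h1 => ?_⟩
      have h2 := hr (by linarith [dist_nonneg (x := p) (y := p')])
      linarith

theorem Shortcut.glue_trans {H : HoroballFamily 𝓟 δ C L} {P : 𝓟} {x : (H P).base}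
    {b : PreCusp H} {r : ℝ} (h : Shortcut H (Sum.inr ⟨P, (H P).incl x⟩) b r) :
    Shortcut H (Sum.inl (x : X)) b (0 + r) := by
  rw [zero_add]
  rcases h with ⟨Q, q, q', h1, rfl, h3⟩ | ⟨_, y, s, t, hs, ht, hst, hr⟩
  · cases h1
    rw [dist_comm] at h3
    exact Or.inr ⟨x, x, 0, _, .space _, .horoball P q' x, by linarith, fun _ => by simpa using h3⟩
  · cases hs with
    | horoball _ _ x' =>
      refine Or.inr ⟨x, y, 0, t, .space _, ht, ?_, fun h1 => ?_⟩
      · linarith [dist_nonneg (x := (H P).incl x) (y := (H P).incl x')]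
      · have h2 := hr h1
        have h0 : 0 ≤ dist (x' : X) y / max L 1 := by positivity
        have h3 := (H P).dist_div_le (x := x) (y := x') (by linarith [ht.nonneg])
        have h4 : dist (x : X) y / max L 1 ≤ dist (x : X) x' / max L 1 + dist (x' : X) y / max L 1 := by
          rw [← add_div]
          gcongr
          exact dist_triangle _ _ _
        linarith

theorem Shortcut.glue_trans' {H : HoroballFamily 𝓟 δ C L} {P : 𝓟} {x : (H P).base}
    {b : PreCusp H} {r : ℝ} (h : Shortcut H (Sum.inl (x : X)) b r) :
    Shortcut H (Sum.inr ⟨P, (H P).incl x⟩) b (0 + r) := by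
  rw [zero_add]
  rcases h with ⟨Q, q, q', h1, -⟩ | ⟨_, y, s, t, hs, ht, hst, hr⟩
  · cases h1
  · cases hs
    have h0 : Exits H (Sum.inr ⟨P, (H P).incl x⟩) (x : X) 0 := by
      simpa using Exits.horoball (H := H) P ((H P).incl x) x
    exact Or.inr ⟨x, y, 0, t, h0, ht, hst, hr⟩

/-- Each link is absorbed into one of the two shapes. An excursion from the base space through a
horoball and back can be replaced by a link in the base space only if it is shorter than `1`, where
`dist_local` applies; for longer chains only the lengths of the two exits are remembered. -/
theorem Chain.shortcut {H : HoroballFamily 𝓟 δ C L} {a b : PreCusp H} {r : ℝ}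
    (h : Chain (CuspStep H) a b r) : Shortcut H a b r := by
  induction h with
  | nil a => exact Shortcut.refl H a
  | fwd h _ ih =>
    cases h with
    | space x y => exact ih.space_trans
    | horoball P p q => exact ih.horoball_trans
    | glue P x => exact ih.glue_trans
  | bwd h _ ih =>
    cases h with
    | space x y => rw [dist_comm]; exact ih.space_trans
    | horoball P p q => rw [dist_comm]; exact ih.horoball_trans
    | glue P x => exact ih.glue_trans'

/-! ### The metric of the cusped space -/

/-- A point of the base space, as a point of the cusped space. -/
noncomputable def Cusp.ofSpace (H : HoroballFamily 𝓟 δ C L) (x : X) : Cusp H :=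
  SeparationQuotient.mk (X := PreCusp H) (Sum.inl x)

/-- A point of a horoball, as a point of the cusped space. -/
noncomputable def Cusp.ofHoroball (H : HoroballFamily 𝓟 δ C L) (P : 𝓟) (p : (H P).Carrier) : Cusp H :=
  SeparationQuotient.mk (X := PreCusp H) (Sum.inr ⟨P, p⟩)

/-- The point of the cusped space on the ray `γ_x` at depth `m`. -/
noncomputable def Cusp.onRay (H : HoroballFamily 𝓟 δ C L) (P : 𝓟) (x : (H P).base) (m : ℝ≥0) : Cusp H :=
  Cusp.ofHoroball H P ((H P).ray x m)

variable (H : HoroballFamily 𝓟 δ C L)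

theorem Cusp.exists_rep (z : Cusp H) : (∃ x, z = Cusp.ofSpace H x) ∨
    ∃ P p, z = Cusp.ofHoroball H P p := by
  obtain ⟨x | ⟨P, p⟩, rfl⟩ := SeparationQuotient.surjective_mk (X := PreCusp H) z
  · exact Or.inl ⟨x, rfl⟩
  · exact Or.inr ⟨P, p, rfl⟩

theorem Cusp.dist_mk_le {a b : PreCusp H} {r : ℝ} (h : Chain (CuspStep H) a b r) :
    dist (SeparationQuotient.mk a : Cusp H) (SeparationQuotient.mk b) ≤ r :=
  csInf_le ⟨0, fun _ hr => hr.nonneg (CuspStep.nonneg H)⟩ h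

theorem Cusp.exists_shortcut {a b : PreCusp H} {c : ℝ}
    (h : dist (SeparationQuotient.mk a : Cusp H) (SeparationQuotient.mk b) < c) :
    ∃ r < c, Shortcut H a b r := by
  obtain ⟨r, hr, hrc⟩ := exists_lt_of_csInf_lt (CuspStep.connected H a b) h
  exact ⟨r, hrc, hr.shortcut⟩

theorem Cusp.dist_ofSpace_le (x y : X) :
    dist (Cusp.ofSpace H x) (Cusp.ofSpace H y) ≤ dist x y :=
  Cusp.dist_mk_le H (Chain.single (CuspStep.space x y))

theorem Cusp.dist_ofHoroball_le (P : 𝓟) (p q : (H P).Carrier) :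
    dist (Cusp.ofHoroball H P p) (Cusp.ofHoroball H P q) ≤ dist p q :=
  Cusp.dist_mk_le H (Chain.single (CuspStep.horoball P p q))

theorem Cusp.ofHoroball_incl (P : 𝓟) (x : (H P).base) :
    Cusp.ofHoroball H P ((H P).incl x) = Cusp.ofSpace H x :=
  dist_le_zero.1 (Cusp.dist_mk_le H (Chain.single' (CuspStep.glue P x)))

theorem Cusp.onRay_zero (P : 𝓟) (x : (H P).base) :
    Cusp.onRay H P x 0 = Cusp.ofSpace H x := by
  rw [Cusp.onRay, (H P).ray_zero, Cusp.ofHoroball_incl]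

theorem Cusp.dist_onRay_le (P : 𝓟) (x : (H P).base) (m n : ℝ≥0) :
    dist (Cusp.onRay H P x m) (Cusp.onRay H P x n) ≤ |(m : ℝ) - n| :=
  (Cusp.dist_ofHoroball_le H P _ _).trans (((H P).ray x).dist_eq m n).le

theorem Cusp.dist_ofSpace_onRay_le (P : 𝓟) (x : (H P).base) (m : ℝ≥0) :
    dist (Cusp.ofSpace H (x : X)) (Cusp.onRay H P x m) ≤ m := by
  rw [← Cusp.onRay_zero]
  simpa using Cusp.dist_onRay_le H P x 0 m

theorem Cusp.exists_onRay_near (P : 𝓟) (p : (H P).Carrier) :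
    ∃ x m, dist (Cusp.ofHoroball H P p) (Cusp.onRay H P x m) ≤ C := by
  obtain ⟨x, m, h⟩ := (H P).ray_dense p
  exact ⟨x, m, (Cusp.dist_ofHoroball_le H P _ _).trans h⟩

theorem AdmissibleHoroball.dist_ray_le {P : Set X} (A : AdmissibleHoroball P δ C L)
    (x y : A.base) (m : ℝ≥0) {B : ℝ} (h : dist (x : X) y ≤ B * Real.exp m) :
    dist (A.ray x m) (A.ray y m) ≤ 2 * Real.log (B + 1) + C := by
  have h1 := (abs_le.1 (A.dist_estimate x y m m)).2
  have h2 : dist x y * Real.exp (-(max m m : ℝ)) ≤ B := by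
    rw [max_self, Real.exp_neg, ← div_eq_mul_inv, div_le_iff₀ (Real.exp_pos _)]
    exact h
  have h3 : Real.log (dist x y * Real.exp (-(max m m : ℝ)) + 1) ≤ Real.log (B + 1) := by
    have : 0 ≤ dist x y * Real.exp (-(max m m : ℝ)) := by positivity
    gcongr
  rw [sub_self, abs_zero] at h1
  linarith

theorem Cusp.dist_onRay_onRay_le (P : 𝓟) (x y : (H P).base) (m : ℝ≥0) {B : ℝ}
    (h : dist (x : X) y ≤ B * Real.exp m) :
    dist (Cusp.onRay H P x m) (Cusp.onRay H P y m) ≤ 2 * Real.log (B + 1) + C :=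
  (Cusp.dist_ofHoroball_le H P _ _).trans ((H P).dist_ray_le x y m h)

/-- The logarithmic term of the distance estimate is nonnegative: depth is, up to `C`, a lower bound
for the cost of leaving a horoball. -/
theorem AdmissibleHoroball.le_dist_ray_incl {P : Set X} (A : AdmissibleHoroball P δ C L)
    (x y : A.base) (m : ℝ≥0) : m - C ≤ dist (A.ray x m) (A.incl y) := by
  have h1 := (abs_le.1 (A.dist_estimate x y m 0)).1
  rw [A.ray_zero] at h1
  have h3 : 0 ≤ Real.log (dist x y * Real.exp (-(max m (0 : ℝ≥0) : ℝ)) + 1) := by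
    refine Real.log_nonneg ?_
    have : 0 ≤ dist x y * Real.exp (-(max m (0 : ℝ≥0) : ℝ)) := by positivity
    linarith
  have h4 : |(m : ℝ) - (0 : ℝ≥0)| = m := by simp
  rw [h4] at h1
  linarith

variable {H} in
theorem Exits.le_of_ray {P : 𝓟} {x : (H P).base} {m : ℝ≥0} {y : X} {s : ℝ}
    (h : Exits H (Sum.inr ⟨P, (H P).ray x m⟩) y s) : m - C ≤ s := by
  cases h
  exact (H P).le_dist_ray_incl x _ m

theorem Cusp.le_dist_onRay_ofSpace (P : 𝓟) (x : (H P).base) (m : ℝ≥0) (y : X) :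
    m - C ≤ dist (Cusp.onRay H P x m) (Cusp.ofSpace H y) := by
  refine le_of_forall_gt_imp_ge_of_dense fun c hc => ?_
  obtain ⟨r, hr, ⟨Q, p, q, -, h2, -⟩ | ⟨_, _, s, t, hs, ht, hst, -⟩⟩ := Cusp.exists_shortcut H hc
  · cases h2
  · linarith [hs.le_of_ray, ht.nonneg]

theorem Cusp.le_dist_onRay_of_ne {P Q : 𝓟} (hPQ : P ≠ Q) (x : (H P).base) (y : (H Q).base)
    (m n : ℝ≥0) : m + n - 2 * C ≤ dist (Cusp.onRay H P x m) (Cusp.onRay H Q y n) := by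
  refine le_of_forall_gt_imp_ge_of_dense fun c hc => ?_
  obtain ⟨r, hr, ⟨R, p, q, h1, h2, -⟩ | ⟨_, _, s, t, hs, ht, hst, -⟩⟩ :=
    Cusp.exists_shortcut H hc
  · cases h1
    cases h2
    exact absurd rfl hPQ
  · linarith [hs.le_of_ray, ht.le_of_ray]

/-- A path either stays inside the horoball or leaves it at both ends, which costs `m - C` and `n -
C`. So passing to the cusped space does not shorten horoball distances up to `m + n - 2 * C`. -/
theorem Cusp.min_le_dist_onRay (P : 𝓟) (x y : (H P).base) (m n : ℝ≥0) :
    min (dist ((H P).ray x m) ((H P).ray y n)) (m + n - 2 * C) ≤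
      dist (Cusp.onRay H P x m) (Cusp.onRay H P y n) := by
  refine le_of_forall_gt_imp_ge_of_dense fun c hc => ?_
  obtain ⟨r, hr, ⟨R, p, q, h1, h2, h3⟩ | ⟨_, _, s, t, hs, ht, hst, -⟩⟩ :=
    Cusp.exists_shortcut H hc
  · cases h1
    cases h2
    exact (min_le_left _ _).trans (h3.trans hr.le)
  · refine (min_le_right _ _).trans ?_
    linarith [hs.le_of_ray, ht.le_of_ray]

/-- The inclusion of the base space may distort large distances exponentially, but not small ones;
hence distinct vertices remain uniformly separated in the cusped space. -/
theorem Cusp.dist_le_of_ofSpace_lt {x y : X}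
    (h : dist (Cusp.ofSpace H x) (Cusp.ofSpace H y) < 1) :
    dist x y ≤ max L 1 * dist (Cusp.ofSpace H x) (Cusp.ofSpace H y) := by
  have hL : 0 < max L 1 := by positivity
  rw [← div_le_iff₀' hL]
  refine le_of_forall_gt_imp_ge_of_dense fun c hc => ?_
  obtain ⟨r, hr, ⟨R, p, q, h1, -⟩ | ⟨_, _, s, t, hs, ht, -, h2⟩⟩ :=
    Cusp.exists_shortcut H (lt_min h hc)
  · cases h1
  · cases hs
    cases ht
    linarith [h2 (hr.trans_le (min_le_left _ _)), hr.trans_le (min_le_right _ _)]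

/-! ### Distinct peripheral sets have bounded coarse intersection -/

theorem exists_le_exp (r : ℝ) : ∃ m : ℝ≥0, ∀ n, m ≤ n → r ≤ Real.exp n := by
  refine ⟨⟨|r|, abs_nonneg r⟩, fun n hn => ?_⟩
  have h1 : |r| ≤ (n : ℝ) := hn
  linarith [Real.add_one_le_exp (n : ℝ), le_abs_self r]

/-- At a great depth `m` the rays from `p` and `p'` have come together, and so have those from `q`
and `q'`. The two deep points are at distance about `2 * m` from each other, but each is at distance
about `m` from both `p` and `p'`; the four-point condition leaves only a bounded amount for the
distance of `p` and `p'`. -/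
theorem Cusp.dist_le_of_near_distinct {δ' : ℝ} (hδ : IsHyperbolicWith (Cusp H) δ') {P Q : 𝓟}
    (hPQ : P ≠ Q) (p p' : (H P).base) (q q' : (H Q).base) {D : ℝ} (h : dist (p : X) q ≤ D)
    (h' : dist (p' : X) q' ≤ D) :
    dist (Cusp.ofSpace H (p : X)) (Cusp.ofSpace H (p' : X)) ≤
      D + 4 * Real.log 2 + 4 * C + 2 * δ' := by
  obtain ⟨m₁, h1⟩ := exists_le_exp (dist (p : X) p')
  obtain ⟨m₂, h2⟩ := exists_le_exp (dist (q : X) q')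
  set m := max m₁ m₂
  have e1 := Cusp.dist_onRay_onRay_le H P p p' m (B := 1)
    (by simpa using h1 m (le_max_left _ _))
  have e2 := Cusp.dist_onRay_onRay_le H Q q q' m (B := 1)
    (by simpa using h2 m (le_max_right _ _))
  have e3 := Cusp.le_dist_onRay_of_ne H hPQ p q m m
  have a1 := Cusp.dist_ofSpace_onRay_le H P p m
  have a2 := Cusp.dist_ofSpace_onRay_le H P p' m
  have b1 := Cusp.dist_ofSpace_onRay_le H Q q m
  have b2 := Cusp.dist_ofSpace_onRay_le H Q q' m
  have d1 := (Cusp.dist_ofSpace_le H (p : X) q).trans h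
  have d2 := (Cusp.dist_ofSpace_le H (p' : X) q').trans h'
  have c1 := dist_triangle (Cusp.ofSpace H (p : X)) (Cusp.ofSpace H (q : X)) (Cusp.onRay H Q q m)
  have c2 := dist_triangle (Cusp.ofSpace H (p' : X)) (Cusp.ofSpace H (q' : X))
    (Cusp.onRay H Q q' m)
  have c3 := dist_triangle_right (Cusp.ofSpace H (p' : X)) (Cusp.onRay H P p m)
    (Cusp.onRay H P p' m)
  have c4 := dist_triangle_right (Cusp.ofSpace H (p' : X)) (Cusp.onRay H Q q m)
    (Cusp.onRay H Q q' m)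
  have four := hδ.four_point (Cusp.ofSpace H (p : X)) (Cusp.ofSpace H (p' : X))
    (Cusp.onRay H P p m) (Cusp.onRay H Q q m)
  have hlog : (0 : ℝ) ≤ Real.log 2 := Real.log_nonneg one_le_two
  have e : (1 : ℝ) + 1 = 2 := by norm_num
  rw [e] at e1 e2
  have hC := (H P).C_pos
  have : max (dist (Cusp.ofSpace H (p : X)) (Cusp.onRay H P p m) +
      dist (Cusp.ofSpace H (p' : X)) (Cusp.onRay H Q q m))
      (dist (Cusp.ofSpace H (p : X)) (Cusp.onRay H Q q m) +
      dist (Cusp.ofSpace H (p' : X)) (Cusp.onRay H P p m)) ≤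
      2 * m + D + 4 * Real.log 2 + 2 * C := by
    apply max_le <;> linarith
  linarith

end CuspMetric

/-! ### Broken geodesics, tripods, and the turning of long paths. -/

section Tripods

variable {Y : Type*} [MetricSpace Y] {δ : ℝ}

/-! ### Local-to-global principle for broken geodesics -/

/-- Induction: seen from `x (n + 1)`, the point `x 0` lies in the direction of `x n`, so the product
with the next point grows only from `K` to `K + δ`, whatever `n` is. Each step then adds at least `R
- 2 * (K + δ)`, hence at least `1`, to the distance. -/
theorem IsHyperbolicWith.chain_end (hδ : IsHyperbolicWith Y δ) {K R : ℝ} (hK : 0 ≤ K)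
    (hR : 2 * K + 2 * δ + 1 ≤ R) (x : ℕ → Y) (n : ℕ)
    (hd : ∀ i < n + 1, R ≤ dist (x i) (x (i + 1)))
    (hp : ∀ i < n, gromovProduct (x (i + 1)) (x i) (x (i + 2)) ≤ K) :
    (n + 1 : ℝ) ≤ dist (x 0) (x (n + 1)) ∧ gromovProduct (x n) (x 0) (x (n + 1)) ≤ K + δ := by
  have hδ0 := hδ.nonneg (x 0)
  induction n with
  | zero =>
    refine ⟨?_, ?_⟩
    · simpa using (by linarith : (1 : ℝ) ≤ R).trans (hd 0 one_pos)
    · have := gromovProduct_le_left (x 0) (x 0) (x (0 + 1))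
      rw [dist_self] at this
      linarith
  | succ n ih =>
    obtain ⟨h1, h2⟩ := ih (fun i hi => hd i (by omega)) (fun i hi => hp i (by omega))
    have h3 := hp n (by omega)
    have h4 := hd n (by omega)
    have h5 := hd (n + 1) (by omega)
    have h6 := gromovProduct_add (x n) (x (n + 1)) (x 0)
    rw [gromovProduct_comm] at h3
    rw [gromovProduct_comm (x n)] at h6
    have h7 := hδ.le_of_lt (z := x 0) h3 (by
      rw [gromovProduct_comm]
      linarith)
    rw [gromovProduct_comm] at h7
    refine ⟨?_, h7⟩
    rw [dist_eq_sub_gromovProduct (x (n + 1)) (x 0), dist_comm _ (x 0)]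
    push_cast
    linarith

/-- Apply `chain_end` to the reversed chain: the broken geodesic never turns away from its initial
direction. -/
theorem IsHyperbolicWith.chain_start (hδ : IsHyperbolicWith Y δ) {K R : ℝ} (hK : 0 ≤ K)
    (hR : 2 * K + 2 * δ + 1 ≤ R) (x : ℕ → Y) (n : ℕ)
    (hd : ∀ i < n + 1, R ≤ dist (x i) (x (i + 1)))
    (hp : ∀ i < n, gromovProduct (x (i + 1)) (x i) (x (i + 2)) ≤ K) :
    R - K - δ ≤ gromovProduct (x 0) (x 1) (x (n + 1)) := by
  have h := (hδ.chain_end hK hR (fun i => x (n + 1 - i)) n (fun i hi => by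
    have e : n + 1 - i = n + 1 - (i + 1) + 1 := by omega
    rw [e, dist_comm]
    exact hd _ (by omega)) (fun i hi => by
    have e1 : n + 1 - i = n + 1 - (i + 2) + 2 := by omega
    have e2 : n + 1 - (i + 1) = n + 1 - (i + 2) + 1 := by omega
    rw [e1, e2, gromovProduct_comm]
    exact hp _ (by omega))).2
  have e1 : n + 1 - n = 1 := by omega
  simp only [e1, tsub_zero, tsub_self] at h
  have h1 := hd 0 (by omega)
  have h2 := gromovProduct_add (x 0) (x 1) (x (n + 1))
  rw [gromovProduct_comm (x 1)] at h2
  rw [zero_add] at h1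
  linarith [gromovProduct_comm (x 1) (x 0) (x (n + 1))]

/-- Three points of `V` at distance at least `R` from `v`, in pairwise different directions, up
to `K`. -/
def HasTripod (V : Set Y) (v : Y) (R K : ℝ) : Prop :=
  ∃ p : Fin 3 → Y, (∀ i, p i ∈ V) ∧ (∀ i, R ≤ dist v (p i)) ∧
    ∀ i j, i ≠ j → gromovProduct v (p i) (p j) ≤ K

theorem HasTripod.of_points {V : Set Y} {v p q r : Y} {R K : ℝ} (hp : p ∈ V) (hq : q ∈ V)
    (hr : r ∈ V) (hp' : R ≤ dist v p) (hq' : R ≤ dist v q) (hr' : R ≤ dist v r)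
    (hpq : gromovProduct v p q ≤ K) (hpr : gromovProduct v p r ≤ K)
    (hqr : gromovProduct v q r ≤ K) : HasTripod V v R K := by
  refine ⟨![p, q, r], fun i => ?_, fun i => ?_, fun i j hij => ?_⟩
  · fin_cases i <;> assumption
  · fin_cases i <;> assumption
  · have h1 := hpq
    have h2 := hpr
    have h3 := hqr
    rw [gromovProduct_comm] at h1 h2 h3
    fin_cases i <;> fin_cases j <;> first | exact absurd rfl hij | assumption

theorem HasTripod.mono {V : Set Y} {v : Y} {R R' K K' : ℝ} (h : HasTripod V v R K)
    (hR : R' ≤ R) (hK : K ≤ K') : HasTripod V v R' K' := by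
  obtain ⟨p, h1, h2, h3⟩ := h
  exact ⟨p, h1, fun i => hR.trans (h2 i), fun i j hij => (h3 i j hij).trans hK⟩

theorem HasTripod.change_base {V : Set Y} {v v' : Y} {R K D : ℝ} (h : HasTripod V v R K)
    (hD : dist v' v ≤ D) : HasTripod V v' (R - D) (K + D) := by
  obtain ⟨p, h1, h2, h3⟩ := h
  refine ⟨p, h1, fun i => ?_, fun i j hij => ?_⟩
  · linarith [h2 i, dist_triangle_left v (p i) v']
  · linarith [h3 i j hij, gromovProduct_le_base v' v (p i) (p j)]

theorem HasTripod.exists_opposite (hδ : IsHyperbolicWith Y δ) {V : Set Y} {v : Y} {R K : ℝ}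
    (h : HasTripod V v R K) (x : Y) :
    ∃ q ∈ V, R ≤ dist v q ∧ gromovProduct v x q ≤ K + δ := by
  obtain ⟨p, h1, h2, h3⟩ := h
  rcases hδ.le_or_le x (h3 0 1 (by decide)) with h | h
  · exact ⟨_, h1 _, h2 _, h⟩
  · exact ⟨_, h1 _, h2 _, h⟩

/-- At most one leg can point towards `x`. This is why three legs are needed: two must remain for
the two rays and the line joining their ends. -/
theorem HasTripod.exists_two_opposite (hδ : IsHyperbolicWith Y δ) {V : Set Y} {v : Y} {R K : ℝ}
    (h : HasTripod V v R K) (x : Y) :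
    ∃ a b, R ≤ dist v a ∧ R ≤ dist v b ∧ gromovProduct v a b ≤ K ∧
      gromovProduct v x a ≤ K + δ ∧ gromovProduct v x b ≤ K + δ := by
  obtain ⟨p, -, h2, h3⟩ := h
  rcases hδ.le_or_le x (h3 0 1 (by decide)) with h | h
  · rcases hδ.le_or_le x (h3 1 2 (by decide)) with h' | h'
    · exact ⟨_, _, h2 0, h2 1, h3 0 1 (by decide), h, h'⟩
    · exact ⟨_, _, h2 0, h2 2, h3 0 2 (by decide), h, h'⟩
  · rcases hδ.le_or_le x (h3 0 2 (by decide)) with h' | h'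
    · exact ⟨_, _, h2 1, h2 0, h3 1 0 (by decide), h, h'⟩
    · exact ⟨_, _, h2 1, h2 2, h3 1 2 (by decide), h, h'⟩

/-- If every point of `V` has a tripod in `V` of one size which is large with respect to the
products, then every point of `V` has tripods of all sizes. -/
theorem HasTripod.extend (hδ : IsHyperbolicWith Y δ) {V : Set Y} {R K : ℝ}
    (h : ∀ v ∈ V, HasTripod V v R K) (hR : 2 * K + 4 * δ + 1 ≤ R) {v : Y} (hv : v ∈ V) (N : ℝ) :
    HasTripod V v N (K + 2 * δ) := by
  have hδ0 := hδ.nonneg v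
  -- For `x` in `V`, `next u x` prolongs the step from `u` to `x` without turning back.
  choose! next hnext using fun (u x : Y) (hx : x ∈ V) => (h x hx).exists_opposite hδ u
  obtain ⟨p, h1, h2, h3⟩ := h v hv
  have hK : 0 ≤ K := (gromovProduct_nonneg _ _ _).trans (h3 0 1 (by decide))
  obtain ⟨n, hn⟩ := exists_nat_ge N
  have key : ∀ i, ∃ q ∈ V, N ≤ dist v q ∧ K + 2 * δ < gromovProduct v q (p i) := by
    intro i
    -- Pairs of consecutive points of a broken geodesic from `v` whose first step is the leg `p i`.
    -- Its far points replace the end of that leg.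
    let s : ℕ → Y × Y := fun n => Nat.rec (v, p i) (fun _ s => (s.2, next s.1 s.2)) n
    have hs : ∀ n, (s n).2 ∈ V := by
      intro n
      induction n with
      | zero => exact h1 i
      | succ n ih => exact (hnext _ _ ih).1
    have hd : ∀ j, R ≤ dist (s j).1 (s (j + 1)).1 := by
      intro j
      cases j with
      | zero => exact h2 i
      | succ j => exact (hnext _ _ (hs j)).2.1
    have hp : ∀ j, gromovProduct (s (j + 1)).1 (s j).1 (s (j + 2)).1 ≤ K + δ :=
      fun j => (hnext _ _ (hs j)).2.2
    refine ⟨(s (n + 1)).1, hs n, ?_, ?_⟩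
    · have := (hδ.chain_end (by linarith) (by linarith) (fun j => (s j).1) n (fun j _ => hd j)
        (fun j _ => hp j)).1
      change _ ≤ dist v _ at this
      linarith
    · have := hδ.chain_start (by linarith) (by linarith) (fun j => (s j).1) n (fun j _ => hd j)
        (fun j _ => hp j)
      rw [gromovProduct_comm] at this
      change _ ≤ gromovProduct v (s (n + 1)).1 (p i) at this
      linarith
  choose q hq hqN hqp using key
  exact ⟨q, hq, hqN, fun i j hij => hδ.le_of_lt' (h3 i j hij) (hqp i) (hqp j)⟩

theorem isVisuallyComplete_of_hasTripod [ProperSpace Y] (hg : IsGeodesicSpace Y)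
    (hδ : IsHyperbolicWith Y δ) {K : ℝ} (h : ∀ x N, HasTripod Set.univ (x : Y) N K) (w : Y) :
    IsVisuallyCompleteFrom Y w := by
  have hδ0 := hδ.nonneg w
  refine ⟨|2 * (K + δ) + 2 * δ|, abs_nonneg _, fun x => ?_⟩
  obtain ⟨a, b, α, β, ℓ, h0, h1, h2, h3, ⟨s, hs⟩, ⟨t, ht⟩, u, hu⟩ :=
    exists_ideal_triangle_near hg hδ (w := w) (x := x) (K := K + δ) fun N => by
      obtain ⟨a, b, h1, h2, h3, h4, h5⟩ := (h x N).exists_two_opposite hδ w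
      exact ⟨a, b, h1, h2, by linarith, h4, h5⟩
  exact ⟨a, b, α, β, ℓ, h0, h1, h2, h3, ⟨s, hs.trans (le_abs_self _)⟩,
    ⟨t, ht.trans (le_abs_self _)⟩, u, hu.trans (le_abs_self _)⟩

/-! ### Long paths -/

/-- A path of `2 ^ k` short steps which avoids a large ball around `w` stays in one direction,
up to `k * δ`. -/
theorem IsHyperbolicWith.le_gromovProduct_path (hδ : IsHyperbolicWith Y δ) {w : Y} {c : ℝ}
    (k : ℕ) : ∀ (n : ℕ) (x : ℕ → Y), n ≤ 2 ^ k → (∀ i ≤ n, c ≤ dist w (x i)) →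
      (∀ i < n, c ≤ gromovProduct w (x i) (x (i + 1))) →
      c - k * δ ≤ gromovProduct w (x 0) (x n) := by
  have hδ0 := hδ.nonneg w
  induction k with
  | zero =>
    intro n x hn h1 h2
    interval_cases n
    · have : gromovProduct w (x 0) (x 0) = dist w (x 0) := by
        unfold gromovProduct
        simp
      simpa [this] using h1 0 le_rfl
    · simpa using h2 0 one_pos
  | succ k ih =>
    intro n x hn h1 h2
    rw [pow_succ] at hn
    have e1 := ih (n / 2) x (by omega) (fun i hi => h1 i (by omega)) (fun i hi => h2 i (by omega))
    have e2 := ih (n - n / 2) (fun i => x (n / 2 + i)) (by omega)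
      (fun i hi => h1 _ (by omega)) (fun i hi => h2 _ (by omega))
    simp only [add_zero] at e2
    rw [Nat.add_sub_cancel' (Nat.div_le_self n 2)] at e2
    have := hδ.le_gromovProduct e1 e2
    push_cast
    linarith

theorem gromovProduct_le_dist_of_mem_segment {w x y z : Y} (h : dist x z + dist z y = dist x y) :
    gromovProduct w x y ≤ dist w z := by
  unfold gromovProduct
  linarith [dist_triangle w z x, dist_triangle w z y, dist_comm x z]

/-- Makes exponentially long legs beat errors linear in `k`. The witness is even because `2 ^ (2 *
m)` is at least `m * m`. -/
theorem exists_linear_le_two_pow (a b c : ℝ) (ha : 0 < a) : ∃ k : ℕ, b * k + c ≤ a * 2 ^ k := by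
  obtain ⟨m, hm⟩ := exists_nat_ge ((2 * |b| + |c|) / a + 1)
  have hm1 : (1 : ℝ) ≤ m := by
    have : 0 ≤ (2 * |b| + |c|) / a := by positivity
    linarith
  have hm2 : 2 * |b| + |c| ≤ a * m := by
    have : (2 * |b| + |c|) / a ≤ m := by linarith
    rwa [div_le_iff₀' ha] at this
  refine ⟨2 * m, ?_⟩
  have h1 : (m : ℝ) ≤ 2 ^ m := by exact_mod_cast (Nat.lt_two_pow_self (n := m)).le
  have h2 : (m : ℝ) * m ≤ 2 ^ (2 * m) := by
    rw [two_mul, pow_add]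
    gcongr
  calc b * (2 * m : ℕ) + c ≤ 2 * |b| * m + |c| * m := by
        push_cast
        have h3 : b * (2 * m) ≤ |b| * (2 * m) := by gcongr; exact le_abs_self b
        have h4 : c ≤ |c| * m := (le_abs_self c).trans (le_mul_of_one_le_right (abs_nonneg c) hm1)
        linarith
    _ = (2 * |b| + |c|) * m := by ring
    _ ≤ a * m * m := by gcongr
    _ ≤ a * 2 ^ (2 * m) := by
        rw [mul_assoc]
        gcongr

end Tripods

/-! ### Tripods in horoballs, and transport of tripods by isometries of the base space. -/

section CuspTripods

variable {X : Type*} [MetricSpace X] {𝓟 : Set (Set X)} {δ C L : ℝ}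

/-! ### Tripods at points of horoballs -/

/-- A discrete intermediate value theorem: the first point of a chain at which `f` reaches `r`
overshoots by at most one jump. -/
theorem IsCoarselyConnected.exists_between {ε : ℝ} {P : Set X} (h : IsCoarselyConnected ε P)
    (hε : 0 ≤ ε) (f : X → ℝ) (hf : ∀ x y, f y ≤ f x + dist x y) {y z : X} (hy : y ∈ P)
    (hz : z ∈ P) {r : ℝ} (hyr : f y ≤ r) (hrz : r ≤ f z) : ∃ x ∈ P, r ≤ f x ∧ f x ≤ r + ε := by
  have key : ∀ c : P, Relation.ReflTransGen (fun a b : P => dist a b ≤ ε) ⟨y, hy⟩ c →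
      r ≤ f c → ∃ x ∈ P, r ≤ f x ∧ f x ≤ r + ε := by
    intro c hc
    induction hc with
    | refl => exact fun h => ⟨y, hy, h, by linarith⟩
    | @tail b c _ hbc ih =>
      intro hc
      rcases le_or_gt r (f b) with hb | hb
      · exact ih hb
      · have hbc' : dist (b : X) c ≤ ε := hbc
        exact ⟨c, c.2, hc, by linarith [hf b c]⟩
  exact key ⟨z, hz⟩ (h _ _) hrz

variable (H : HoroballFamily 𝓟 δ C L)

/-- The rays from `y` and `y'`, whose distance is about `exp m`, have just come together at depth
`m`. From there one direction goes deeper into the horoball and two go down to `y` and `y'`; the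
latter are prolonged beyond the horoball by legs of the tripods at `y` and `y'`. -/
theorem Cusp.onRay_hasTripod {δ' : ℝ} (hδ : IsHyperbolicWith (Cusp H) δ') (P : 𝓟)
    {y y' : (H P).base} {m : ℝ≥0} {B K : ℝ} (hB : 0 ≤ B)
    (hd : Real.exp m ≤ dist (y : X) y') (hd' : dist (y : X) y' ≤ B * Real.exp m)
    (hy : ∀ N, HasTripod Set.univ (Cusp.ofSpace H (y : X)) N K)
    (hy' : ∀ N, HasTripod Set.univ (Cusp.ofSpace H (y' : X)) N K)
    (hm : 2 * (2 * Real.log (B + 1) + 3 * C + K + 5 * δ' + 1) ≤ m) (N : ℝ) :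
    HasTripod Set.univ (Cusp.onRay H P y m) N (2 * Real.log (B + 1) + 2 * C + 4 * δ') := by
  have hδ0 := hδ.nonneg (Cusp.onRay H P y m)
  have hC := (H P).C_pos
  have hK : 0 ≤ K := by
    obtain ⟨p, -, -, h3⟩ := hy 0
    exact (gromovProduct_nonneg _ _ _).trans (h3 0 1 (by decide))
  have hlog : 0 ≤ Real.log (B + 1) := Real.log_nonneg (by linarith)
  have hm0 := m.coe_nonneg
  set c₁ := 2 * Real.log (B + 1) + C with hc₁
  set x := Cusp.onRay H P y m with hx
  set x' := Cusp.onRay H P y' m with hx'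
  have hxx' : dist x x' ≤ c₁ := Cusp.dist_onRay_onRay_le H P y y' m hd'
  -- The summand `2 * C` compensates for the loss in the bound for paths that leave the horoball.
  let N' : ℝ≥0 := ⟨|N| + 2 * C, by positivity⟩
  have hN' : (N' : ℝ) = |N| + 2 * C := rfl
  set u := Cusp.onRay H P y (m + N') with hu
  -- Half depth is a compromise: there the two rays are already about `m` apart inside the horoball,
  -- and paths through the base space are not shorter, up to `2 * C`. At depth `0` the latter bound
  -- would be void.
  set a := Cusp.onRay H P y (m / 2) with ha
  set a' := Cusp.onRay H P y' (m / 2) with ha'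
  set s := Cusp.ofSpace H (y : X) with hs
  set s' := Cusp.ofSpace H (y' : X) with hs'
  have hm2 : ((m / 2 : ℝ≥0) : ℝ) = m / 2 := by simp
  have hmN : ((m + N' : ℝ≥0) : ℝ) = m + N' := by simp
  have xs : m - C ≤ dist x s := Cusp.le_dist_onRay_ofSpace H P y m y
  have xs' : m - C ≤ dist x s' := Cusp.le_dist_onRay_ofSpace H P y m y'
  have sx : dist s x ≤ m := Cusp.dist_ofSpace_onRay_le H P y m
  have sx' : dist s' x' ≤ m := Cusp.dist_ofSpace_onRay_le H P y' m
  have sxx' : dist s' x ≤ m + c₁ := by linarith [dist_triangle_right s' x x']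
  have sa : dist s a ≤ m / 2 := hm2 ▸ Cusp.dist_ofSpace_onRay_le H P y (m / 2)
  have sa' : dist s' a' ≤ m / 2 := hm2 ▸ Cusp.dist_ofSpace_onRay_le H P y' (m / 2)
  have xa : dist x a ≤ m / 2 := by
    have := Cusp.dist_onRay_le H P y m (m / 2)
    rw [hm2, abs_of_nonneg (by linarith)] at this
    linarith
  have xa' : dist x a' ≤ m / 2 + c₁ := by
    have := Cusp.dist_onRay_le H P y' m (m / 2)
    rw [hm2, abs_of_nonneg (by linarith)] at this
    linarith [dist_triangle x x' a']
  have ax : m / 2 - C ≤ dist x a := by linarith [dist_triangle x a s, dist_comm a s]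
  have ax' : m / 2 - C ≤ dist x a' := by linarith [dist_triangle x a' s', dist_comm a' s']
  have aa' : m - 2 * C ≤ dist a a' := by
    refine le_trans (le_min ?_ ?_) (Cusp.min_le_dist_onRay H P y y' (m / 2) (m / 2))
    · have h1 := (abs_le.1 ((H P).dist_estimate y y' (m / 2) (m / 2))).1
      have h2 : (m : ℝ) / 2 ≤ Real.log (dist (y : X) y' *
          Real.exp (-(max (m / 2 : ℝ≥0) (m / 2 : ℝ≥0) : ℝ)) + 1) := by
        rw [max_self, hm2, Real.le_log_iff_exp_le (by positivity)]
        have : Real.exp (m / 2) = Real.exp m * Real.exp (-(m / 2)) := by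
          rw [← Real.exp_add]
          congr 1
          ring
        rw [this]
        have := mul_le_mul_of_nonneg_right hd (Real.exp_pos (-((m : ℝ) / 2))).le
        linarith
      rw [sub_self, abs_zero, Subtype.dist_eq y] at h1
      linarith
    · rw [hm2]
      linarith
  have ux : dist x u ≤ N' := by
    have := Cusp.dist_onRay_le H P y m (m + N')
    rw [hmN, sub_add_cancel_left, abs_neg, abs_of_nonneg N'.coe_nonneg] at this
    exact this
  have xu : |N| ≤ dist x u := by
    refine le_trans (le_min ?_ ?_) (Cusp.min_le_dist_onRay H P y y m (m + N'))
    · rw [GeodesicRay.dist_eq, hmN, sub_add_cancel_left, abs_neg, abs_of_nonneg N'.coe_nonneg]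
      linarith
    · rw [hmN]
      linarith
  have us : m + N' - C ≤ dist u s := hmN ▸ Cusp.le_dist_onRay_ofSpace H P y (m + N') y
  have us' : m + N' - C ≤ dist u s' := hmN ▸ Cusp.le_dist_onRay_ofSpace H P y (m + N') y'
  have p1 : gromovProduct x a a' ≤ c₁ + C := by
    unfold gromovProduct
    linarith
  have p2 : m / 2 - C ≤ gromovProduct x s a := by
    unfold gromovProduct
    linarith
  have p3 : m / 2 - C ≤ gromovProduct x s' a' := by
    unfold gromovProduct
    linarith
  have p4 : gromovProduct x s s' ≤ c₁ + C + 2 * δ' :=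
    hδ.le_of_lt' p1 (by linarith) (by linarith)
  have p5 : gromovProduct x u s ≤ c₁ + C + 2 * δ' := by
    unfold gromovProduct
    linarith [dist_comm x s]
  have p6 : gromovProduct x u s' ≤ c₁ + C + 2 * δ' := by
    unfold gromovProduct
    linarith [dist_comm x s']
  -- Legs at `y` and `y'` pointing away from `x`, so that `x` sees `q` in the direction of `s` and
  -- `q'` in that of `s'`.
  obtain ⟨q, -, hq, hqx⟩ := (hy (N + m + c₁)).exists_opposite hδ x
  obtain ⟨q', -, hq', hqx'⟩ := (hy' (N + m + c₁)).exists_opposite hδ x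
  have r1 := gromovProduct_add x s q
  have r2 := gromovProduct_add x s' q'
  rw [gromovProduct_comm] at r1 r2
  refine HasTripod.of_points (p := u) (q := q) (r := q') trivial trivial trivial
    ((le_abs_self N).trans xu) ?_ ?_ ?_ ?_ ?_
  · linarith [dist_triangle s x q]
  · linarith [dist_triangle s' x q']
  · linarith [hδ.le_of_lt (z := q) p5 (by linarith)]
  · linarith [hδ.le_of_lt (z := q') p6 (by linarith)]
  · linarith [hδ.le_of_lt' p4 (x' := q) (y' := q') (by linarith) (by linarith)]

/-- If there are tripods of all sizes at the points of a dense enough subset of the base space,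
then the cusped space is visually complete. -/
theorem Cusp.isVisuallyComplete_of_hasTripod (hH : IsRelativelyHyperbolic H)
    (hP : ∀ P ∈ 𝓟, ∀ y ∈ P, ∀ r : ℝ, ∃ z ∈ P, r ≤ dist y z) {V : Set X}
    (hV : ∀ x, ∃ v ∈ V, dist x v ≤ 1) {K : ℝ}
    (h : ∀ v ∈ V, ∀ N, HasTripod Set.univ (Cusp.ofSpace H v) N K) (w : Cusp H) :
    IsVisuallyCompleteFrom (Cusp H) w := by
  obtain ⟨δ', hδ⟩ := hH.hyperbolic_cusp
  obtain ⟨ε, hε, hcc⟩ := hH.coarselyConnected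
  have := hH.proper_cusp
  have hδ0 := hδ.nonneg w
  have hspace : ∀ (x : X) N, HasTripod Set.univ (Cusp.ofSpace H x) N (K + 1) := by
    intro x N
    obtain ⟨v, hv, hxv⟩ := hV x
    exact ((h v hv (N + 1)).change_base ((Cusp.dist_ofSpace_le H x v).trans hxv)).mono
      (by linarith) le_rfl
  set B := 1 + 2 * C + ε with hB
  set m₀ := 2 * (2 * Real.log (B + 1) + 3 * C + (K + 1) + 5 * δ' + 1) with hm₀
  set c := 2 * Real.log (B + 1) + 2 * C + 4 * δ' with hc
  have hK : ∀ x : X, 0 ≤ K + 1 := fun x => by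
    obtain ⟨p, -, -, h3⟩ := hspace x 0
    exact (gromovProduct_nonneg _ _ _).trans (h3 0 1 (by decide))
  refine RelHyp.isVisuallyComplete_of_hasTripod (K := |c| + |K + 1| + |m₀| + |C|) hH.geodesic_cusp hδ
    (fun z N => ?_) w
  rcases Cusp.exists_rep H z with ⟨x, rfl⟩ | ⟨P, p, rfl⟩
  · refine (hspace x N).mono le_rfl ?_
    linarith [abs_nonneg c, le_abs_self (K + 1), abs_nonneg m₀, abs_nonneg C]
  · have hC := (H P).C_pos
    obtain ⟨y, m, hym⟩ := Cusp.exists_onRay_near H P p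
    have key : HasTripod Set.univ (Cusp.onRay H P y m) (N + C) (|c| + |K + 1| + |m₀|) := by
      rcases le_or_gt m₀ m with hm | hm
      -- Coarse connectedness gives a point of `P` at distance between `exp m + C` and `exp m + C +
      -- ε` from `y`. Moving it into the base of the horoball costs `C`, which leaves a distance
      -- between `exp m` and `B * exp m`.
      · obtain ⟨z, hz, hyz⟩ := hP P P.2 y ((H P).base_subset y.2) (Real.exp m + C)
        obtain ⟨y₁, hy₁, h1, h2⟩ := (hcc P P.2).exists_between hε.le (fun x => dist (y : X) x)
          (fun a b => dist_triangle _ _ _) ((H P).base_subset y.2) hz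
          (by simp only [dist_self]; positivity) hyz
        obtain ⟨y', hy', hyy'⟩ := (H P).base_dense y₁ hy₁
        refine (Cusp.onRay_hasTripod H hδ P (y := y) (y' := ⟨y', hy'⟩) (B := B) (by positivity)
          ?_ ?_ (hspace _) (hspace _) hm _).mono le_rfl ?_
        · change _ ≤ dist (y : X) y'
          linarith [dist_triangle_right (y : X) y₁ y']
        · change dist (y : X) y' ≤ _
          have e1 : 1 ≤ Real.exp m := Real.one_le_exp m.coe_nonneg
          have e2 : 2 * C + ε ≤ (2 * C + ε) * Real.exp m := le_mul_of_one_le_right (by positivity) e1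
          rw [hB]
          linarith [dist_triangle (y : X) y₁ y']
        · linarith [le_abs_self c, abs_nonneg (K + 1), abs_nonneg m₀]
      · have h1 := Cusp.dist_ofSpace_onRay_le H P y m
        rw [dist_comm] at h1
        refine ((hspace y (N + C + m₀)).change_base (h1.trans hm.le)).mono (by linarith) ?_
        linarith [abs_nonneg c, le_abs_self (K + 1), le_abs_self m₀]
    refine (key.change_base hym).mono (by linarith) ?_
    linarith [le_abs_self C]

/-! ### Coarse extension of isometries of the base space -/

/-- The points `z` and `z'` of the cusped space correspond to each other, coarsely, under an
isometry of the base space which permutes the peripheral sets. -/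
inductive Corresponds (τ : X ≃ᵢ X) : Cusp H → Cusp H → Prop
  | space (x : X) : Corresponds τ (Cusp.ofSpace H x) (Cusp.ofSpace H (τ x))
  | horoball (P Q : 𝓟) (hPQ : (Q : Set X) = τ '' P) (p : (H P).Carrier) (q : (H Q).Carrier)
      (x : (H P).base) (y : (H Q).base) (m : ℝ≥0) (hp : dist p ((H P).ray x m) ≤ C)
      (hq : dist q ((H Q).ray y m) ≤ C) (hxy : dist (τ x) y ≤ C) :
      Corresponds τ (Cusp.ofHoroball H P p) (Cusp.ofHoroball H Q q)

variable {H}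

theorem Corresponds.symm {τ : X ≃ᵢ X} {z z' : Cusp H} (h : Corresponds H τ z z') :
    Corresponds H τ.symm z' z := by
  cases h with
  | space x =>
    have := Corresponds.space (H := H) (τ := τ.symm) (τ x)
    rwa [τ.symm_apply_apply] at this
  | horoball P Q hPQ p q x y m hp hq hxy =>
    refine .horoball Q P ?_ q p y x m hq hp ?_
    · rw [hPQ, ← Set.image_comp]
      simp
    · rw [← τ.dist_eq, τ.apply_symm_apply, dist_comm]
      exact hxy

theorem Corresponds.exists_right {τ : X ≃ᵢ X} (hτ : ∀ P ∈ 𝓟, τ '' P ∈ 𝓟) (z : Cusp H) :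
    ∃ z', Corresponds H τ z z' := by
  rcases Cusp.exists_rep H z with ⟨x, rfl⟩ | ⟨P, p, rfl⟩
  · exact ⟨_, .space x⟩
  · obtain ⟨x, m, hp⟩ := (H P).ray_dense p
    let Q : 𝓟 := ⟨τ '' P, hτ P P.2⟩
    have hC := (H P).C_pos
    obtain ⟨y, hy, hxy⟩ := (H Q).base_dense (τ x) ⟨x, (H P).base_subset x.2, rfl⟩
    exact ⟨_, .horoball P Q rfl p ((H Q).ray ⟨y, hy⟩ m) x ⟨y, hy⟩ m hp (by simpa using hC.le) hxy⟩

theorem Corresponds.exists_left {τ : X ≃ᵢ X} (hτ : ∀ P ∈ 𝓟, τ.symm '' P ∈ 𝓟) (z : Cusp H) :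
    ∃ z', Corresponds H τ z' z := by
  obtain ⟨z', h⟩ := Corresponds.exists_right hτ z
  have := h.symm
  rw [IsometryEquiv.symm_symm] at this
  exact ⟨z', this⟩

/-- A coarse Lipschitz constant for coarse extensions of isometries. -/
noncomputable def correspondsConst (C L : ℝ) : ℝ :=
  max L 1 + 2 * (Real.exp (C + 1) * Real.exp (2 * C + 1) + 4 * C + 1) +
    (6 * C + 1 + 2 * Real.log (1 + 2 * C))

/-- A cheap exit is possible only from bounded depth, and there the distance estimate forces the
exit to be near the foot of the ray. -/
theorem AdmissibleHoroball.dist_base_le {P : Set X} (A : AdmissibleHoroball P δ C L)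
    {x x' : A.base} {m : ℝ≥0} (h : dist (A.ray x m) (A.incl x') ≤ C + 1) :
    m ≤ 2 * C + 1 ∧ dist (x : X) x' ≤ Real.exp (C + 1) * Real.exp (2 * C + 1) := by
  have hC := A.C_pos
  have h1 := A.le_dist_ray_incl x x' m
  have hm : (m : ℝ) ≤ 2 * C + 1 := by linarith
  refine ⟨hm, ?_⟩
  have h2 := (abs_le.1 (A.dist_estimate x x' m 0)).1
  rw [A.ray_zero, NNReal.coe_zero, max_eq_left m.coe_nonneg, Subtype.dist_eq x] at h2
  have h3 := abs_nonneg ((m : ℝ) - 0)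
  have h4 : Real.log (dist (x : X) x' * Real.exp (-(m : ℝ)) + 1) ≤ C + 1 := by linarith
  rw [Real.log_le_iff_le_exp (by positivity)] at h4
  calc dist (x : X) x' = dist (x : X) x' * Real.exp (-(m : ℝ)) * Real.exp m := by
        rw [mul_assoc, ← Real.exp_add, neg_add_cancel, Real.exp_zero, mul_one]
    _ ≤ Real.exp (C + 1) * Real.exp (2 * C + 1) := by
        gcongr
        linarith

/-- Horoball distances depend, up to `C`, only on depths and base distances. Adding `2 * C` to a
base distance multiplies the argument of the logarithm by at most `1 + 2 * C`. -/
theorem AdmissibleHoroball.dist_ray_le_of_dist_ray_le {P Q : Set X}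
    (A : AdmissibleHoroball P δ C L) (A' : AdmissibleHoroball Q δ C L) {x₁ x₂ : A.base}
    {y₁ y₂ : A'.base} {m n : ℝ≥0} (hy : dist (y₁ : X) y₂ ≤ dist (x₁ : X) x₂ + 2 * C) :
    dist (A'.ray y₁ m) (A'.ray y₂ n) ≤
      dist (A.ray x₁ m) (A.ray x₂ n) + 2 * C + 2 * Real.log (1 + 2 * C) := by
  have hC := A.C_pos
  have h1 := (abs_le.1 (A.dist_estimate x₁ x₂ m n)).1
  have h2 := (abs_le.1 (A'.dist_estimate y₁ y₂ m n)).2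
  rw [Subtype.dist_eq x₁] at h1
  rw [Subtype.dist_eq y₁] at h2
  set e := Real.exp (-(max m n : ℝ)) with he
  have he0 : 0 < e := Real.exp_pos _
  have he1 : e ≤ 1 := Real.exp_le_one_iff.2 (by
    have := m.coe_nonneg.trans (le_max_left (m : ℝ) n)
    linarith)
  have h3 : Real.log (dist (y₁ : X) y₂ * e + 1) ≤
      Real.log (dist (x₁ : X) x₂ * e + 1) + Real.log (1 + 2 * C) := by
    rw [← Real.log_mul (by positivity) (by positivity)]
    have : dist (y₁ : X) y₂ * e ≤ (dist (x₁ : X) x₂ + 2 * C) * e := by gcongr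
    have h0 : 0 ≤ dist (x₁ : X) x₂ * e := by positivity
    gcongr
    nlinarith
  linarith

/-- Below distance `1` two points either lie in the same horoball, where depths and base distances
are nearly preserved, or are joined by two cheap exits and a short link in the base space, which `τ`
carries along isometrically. The three summands of `correspondsConst` are the link, the two exits,
and the horoball case. -/
theorem Corresponds.dist_le_of_lt_one (hC : 0 ≤ C) {τ : X ≃ᵢ X} {z₁ z₂ z₁' z₂' : Cusp H}
    (h₁ : Corresponds H τ z₁ z₁') (h₂ : Corresponds H τ z₂ z₂') (h : dist z₁ z₂ < 1) :
    dist z₁' z₂' ≤ correspondsConst C L := by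
  have hlog : 0 ≤ Real.log (1 + 2 * C) := Real.log_nonneg (by linarith)
  have hL : 0 < max L 1 := by positivity
  have small : ∀ x₁ x₂ : X, ∀ s t r : ℝ, 0 ≤ s → 0 ≤ t →
      s + dist x₁ x₂ / max L 1 + t ≤ r → r < 1 → s < 1 ∧ t < 1 := by
    intro x₁ x₂ s t r hs ht h1 h2
    have h3 : 0 ≤ dist x₁ x₂ / max L 1 := by positivity
    constructor <;> linarith
  have exit : ∀ (P Q : 𝓟) (p : (H P).Carrier) (q : (H Q).Carrier)
      (x : (H P).base) (y : (H Q).base) (m : ℝ≥0), dist p ((H P).ray x m) ≤ C →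
      dist q ((H Q).ray y m) ≤ C → dist (τ x) y ≤ C → ∀ x₀ s,
      Exits H (Sum.inr ⟨P, p⟩) x₀ s → s < 1 →
      dist (Cusp.ofHoroball H Q q) (Cusp.ofSpace H (τ x₀)) ≤
        Real.exp (C + 1) * Real.exp (2 * C + 1) + 4 * C + 1 := by
    intro P Q p q x y m hp hq hxy x₀ s hs hs1
    cases hs with
    | horoball _ _ x' =>
      obtain ⟨e1, e2⟩ := (H P).dist_base_le (x := x) (x' := x') (m := m)
        (by linarith [dist_triangle_left ((H P).ray x m) ((H P).incl x') p])
      have e3 := (Cusp.dist_ofHoroball_le H Q _ _).trans hq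
      have e4 := Cusp.dist_ofSpace_onRay_le H Q y m
      have e5 := Cusp.dist_ofSpace_le H (y : X) (τ x')
      have e6 := dist_triangle (y : X) (τ x) (τ x')
      rw [τ.dist_eq, dist_comm (y : X) (τ x)] at e6
      have e7 := dist_triangle4 (Cusp.ofHoroball H Q q) (Cusp.onRay H Q y m)
        (Cusp.ofSpace H (y : X)) (Cusp.ofSpace H (τ x'))
      rw [dist_comm (Cusp.onRay H Q y m)] at e7
      change dist (Cusp.ofHoroball H Q q) (Cusp.onRay H Q y m) ≤ C at e3
      linarith
  have hM : 0 ≤ Real.exp (C + 1) * Real.exp (2 * C + 1) := by positivity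
  unfold correspondsConst
  set M := Real.exp (C + 1) * Real.exp (2 * C + 1) + 4 * C + 1 with hMdef
  have space : ∀ x₁ x₂ : X, ∀ s t r : ℝ, 0 ≤ s → 0 ≤ t →
      s + dist x₁ x₂ / max L 1 + t ≤ r → r < 1 →
      dist (Cusp.ofSpace H (τ x₁)) (Cusp.ofSpace H (τ x₂)) ≤ max L 1 := by
    intro x₁ x₂ s t r hs ht h1 h2
    have h3 := Cusp.dist_ofSpace_le H (τ x₁) (τ x₂)
    rw [τ.dist_eq] at h3
    have h4 : dist x₁ x₂ / max L 1 ≤ 1 := by linarith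
    rw [div_le_one hL] at h4
    linarith
  cases h₁ with
  | space x₁ =>
    cases h₂ with
    | space x₂ =>
      obtain ⟨r, hr, ⟨R, p, q, h1, -⟩ | ⟨_, _, s, t, hs, ht, -, h2⟩⟩ := Cusp.exists_shortcut H h
      · cases h1
      · have := space _ _ s t r hs.nonneg ht.nonneg (h2 hr) hr
        cases hs
        cases ht
        linarith
    | horoball P₂ Q₂ hPQ₂ p₂ q₂ x₂ y₂ m₂ hp₂ hq₂ hxy₂ =>
      obtain ⟨r, hr, ⟨R, p, q, h1, -⟩ | ⟨_, b, s, t, hs, ht, -, h2⟩⟩ := Cusp.exists_shortcut H h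
      · cases h1
      · have e1 := space _ _ s t r hs.nonneg ht.nonneg (h2 hr) hr
        have e2 := exit P₂ Q₂ p₂ q₂ x₂ y₂ m₂ hp₂ hq₂ hxy₂ b t ht
          (small _ _ s t r hs.nonneg ht.nonneg (h2 hr) hr).2
        cases hs
        linarith [dist_triangle_right (Cusp.ofSpace H (τ x₁)) (Cusp.ofHoroball H Q₂ q₂)
          (Cusp.ofSpace H (τ b))]
  | horoball P₁ Q₁ hPQ₁ p₁ q₁ x₁ y₁ m₁ hp₁ hq₁ hxy₁ =>
    cases h₂ with
    | space x₂ =>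
      obtain ⟨r, hr, ⟨R, p, q, -, h1, -⟩ | ⟨a, _, s, t, hs, ht, -, h2⟩⟩ :=
        Cusp.exists_shortcut H h
      · cases h1
      · have e1 := space _ _ s t r hs.nonneg ht.nonneg (h2 hr) hr
        have e2 := exit P₁ Q₁ p₁ q₁ x₁ y₁ m₁ hp₁ hq₁ hxy₁ a s hs
          (small _ _ s t r hs.nonneg ht.nonneg (h2 hr) hr).1
        cases ht
        linarith [dist_triangle (Cusp.ofHoroball H Q₁ q₁) (Cusp.ofSpace H (τ a))
          (Cusp.ofSpace H (τ x₂))]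
    | horoball P₂ Q₂ hPQ₂ p₂ q₂ x₂ y₂ m₂ hp₂ hq₂ hxy₂ =>
      obtain ⟨r, hr, ⟨R, p, q, h1, h2, h3⟩ | ⟨a, b, s, t, hs, ht, -, h2⟩⟩ :=
        Cusp.exists_shortcut H h
      · cases h1
        cases h2
        -- Both are the image of the same peripheral set under `τ`.
        obtain rfl : Q₁ = Q₂ := Subtype.ext (hPQ₁.trans hPQ₂.symm)
        have e1 := (H P₁).dist_ray_le_of_dist_ray_le (H Q₁) (x₁ := x₁) (x₂ := x₂)
          (y₁ := y₁) (y₂ := y₂) (m := m₁) (n := m₂) (by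
            have e := dist_triangle4 (y₁ : X) (τ x₁) (τ x₂) y₂
            rw [τ.dist_eq, dist_comm (y₁ : X) (τ x₁)] at e
            linarith)
        have e2 := dist_triangle4 ((H P₁).ray x₁ m₁) p₁ q ((H P₁).ray x₂ m₂)
        rw [dist_comm _ p₁] at e2
        have e3 := dist_triangle4 q₁ ((H Q₁).ray y₁ m₁) ((H Q₁).ray y₂ m₂) q₂
        rw [dist_comm ((H Q₁).ray y₂ m₂) q₂] at e3
        linarith [Cusp.dist_ofHoroball_le H Q₁ q₁ q₂]
      · have e1 := space _ _ s t r hs.nonneg ht.nonneg (h2 hr) hr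
        have e0 := small _ _ s t r hs.nonneg ht.nonneg (h2 hr) hr
        have e2 := exit P₁ Q₁ p₁ q₁ x₁ y₁ m₁ hp₁ hq₁ hxy₁ a s hs e0.1
        have e3 := exit P₂ Q₂ p₂ q₂ x₂ y₂ m₂ hp₂ hq₂ hxy₂ b t ht e0.2
        rw [dist_comm] at e3
        linarith [dist_triangle4 (Cusp.ofHoroball H Q₁ q₁) (Cusp.ofSpace H (τ a))
          (Cusp.ofSpace H (τ b)) (Cusp.ofHoroball H Q₂ q₂)]

theorem one_le_correspondsConst (hC : 0 ≤ C) : 1 ≤ correspondsConst C L := by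
  have hlog : 0 ≤ Real.log (1 + 2 * C) := Real.log_nonneg (by linarith)
  have hL : 1 ≤ max L 1 := le_max_right _ _
  have hM : 0 ≤ Real.exp (C + 1) * Real.exp (2 * C + 1) := by positivity
  unfold correspondsConst
  linarith

/-- Subdivide a geodesic into steps shorter than `1` and apply `dist_le_of_lt_one` to each. -/
theorem Corresponds.dist_le (hC : 0 ≤ C) (hg : IsGeodesicSpace (Cusp H)) {τ : X ≃ᵢ X}
    (hτ : ∀ P ∈ 𝓟, τ '' P ∈ 𝓟) {z₁ z₂ z₁' z₂' : Cusp H}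
    (h₁ : Corresponds H τ z₁ z₁') (h₂ : Corresponds H τ z₂ z₂') :
    dist z₁' z₂' ≤ correspondsConst C L * (dist z₁ z₂ + 1) := by
  have hB : 0 ≤ correspondsConst C L := zero_le_one.trans (one_le_correspondsConst hC)
  have key : ∀ (k : ℕ) (z₂ z₂' : Cusp H), Corresponds H τ z₂ z₂' → dist z₁ z₂ < k + 1 →
      dist z₁' z₂' ≤ correspondsConst C L * (k + 1) := by
    intro k
    induction k with
    | zero =>
      intro z₂ z₂' h₂ h
      simpa using h₁.dist_le_of_lt_one hC h₂ (by simpa using h)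
    | succ k ih =>
      intro z₂ z₂' h₂ h
      push_cast at h ⊢
      have hk : (0 : ℝ) < k + 1 + 1 := by positivity
      have hd : 0 ≤ dist z₁ z₂ := dist_nonneg
      set t := dist z₁ z₂ * ((k + 1) / (k + 1 + 1)) with ht
      have ht0 : 0 ≤ t := by positivity
      have ht1 : t ≤ dist z₁ z₂ :=
        mul_le_of_le_one_right hd ((div_le_one hk).2 (by linarith))
      have ht2 : t < k + 1 := by
        rw [ht, mul_div_assoc', div_lt_iff₀ hk, mul_comm]
        gcongr
      have ht3 : dist z₁ z₂ - t < 1 := by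
        have : dist z₁ z₂ - t = dist z₁ z₂ / (k + 1 + 1) := by
          rw [ht]
          field_simp
          ring
        rw [this, div_lt_one hk]
        exact h
      obtain ⟨y', hy⟩ := Corresponds.exists_right hτ (geod hg z₁ z₂ t)
      have e1 := ih _ _ hy (by rwa [dist_left_geod hg ht0 ht1])
      have e2 := hy.dist_le_of_lt_one hC h₂ (by rwa [dist_geod_right hg ht0 ht1])
      linarith [dist_triangle z₁' y' z₂']
  refine (key ⌊dist z₁ z₂⌋₊ z₂ z₂' h₂ (Nat.lt_floor_add_one _)).trans ?_
  gcongr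
  exact Nat.floor_le dist_nonneg

/-- Coarse extensions of isometries increase Gromov products at most by a factor and an additive
error logarithmic in the distance. -/
theorem Corresponds.gromovProduct_le (hC : 0 ≤ C) (hg : IsGeodesicSpace (Cusp H)) {δ' : ℝ}
    (hδ : IsHyperbolicWith (Cusp H) δ') {τ : X ≃ᵢ X} (hτ : ∀ P ∈ 𝓟, τ '' P ∈ 𝓟)
    (hτ' : ∀ P ∈ 𝓟, τ.symm '' P ∈ 𝓟) {v p q v' p' q' : Cusp H} (hv : Corresponds H τ v v')
    (hp : Corresponds H τ p p') (hq : Corresponds H τ q q') {K : ℝ}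
    (hK : gromovProduct v p q ≤ K) {k : ℕ} (hk : dist p' q' + 1 ≤ 2 ^ k) :
    gromovProduct v' p' q' ≤
      correspondsConst C L * (K + 1 + 3 * correspondsConst C L + k * δ') := by
  set B := correspondsConst C L with hB
  have hB1 : 1 ≤ B := one_le_correspondsConst hC
  set g := gromovProduct v' p' q' with hg'
  set n := ⌊dist p' q'⌋₊ + 1 with hn
  have hnpos : (0 : ℝ) < n := by positivity
  have hn1 : dist p' q' < n := by
    rw [hn]
    push_cast
    exact Nat.lt_floor_add_one _
  have hn2 : n ≤ 2 ^ k := by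
    have : (n : ℝ) ≤ 2 ^ k := by
      rw [hn]
      push_cast
      linarith [Nat.floor_le (dist_nonneg (x := p') (y := q'))]
    exact_mod_cast this
  set d := dist p' q' / n with hd
  have hd0 : 0 ≤ d := by positivity
  have hd1 : d < 1 := (div_lt_one hnpos).2 hn1
  have hdn : n * d = dist p' q' := by
    rw [hd]
    field_simp
  have hid : ∀ i : ℕ, i ≤ n → (i : ℝ) * d ≤ dist p' q' := by
    intro i hi
    rw [← hdn]
    gcongr
  -- A geodesic from `p'` to `q'` stays at distance at least `g` from `v'`. Pulled back by the
  -- correspondence, it is a path of at most `2 ^ k` steps of length at most `B` that stays at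
  -- distance at least `g / B - 1` from `v`, and so forces the product of `p` and `q` at `v` to be
  -- large.
  choose w hw using fun i : ℕ => Corresponds.exists_left (H := H) hτ' (geod hg p' q' (i * d))
  have hτs : ∀ P ∈ 𝓟, τ.symm.symm '' P ∈ 𝓟 := by simpa using hτ
  have hstep : ∀ i < n, dist (w i) (w (i + 1)) ≤ B := by
    intro i hi
    refine (hw i).symm.dist_le_of_lt_one hC (hw (i + 1)).symm ?_
    rw [dist_geod hg (by positivity) (hid i hi.le) (by positivity) (hid (i + 1) hi)]
    push_cast
    rw [add_mul, one_mul, sub_add_cancel_left, abs_neg, abs_of_nonneg hd0]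
    exact hd1
  have hfar : ∀ i ≤ n, g / B - 1 ≤ dist v (w i) := by
    intro i hi
    have h1 : g ≤ dist v' (geod hg p' q' (i * d)) :=
      gromovProduct_le_dist_of_mem_segment (by
        rw [dist_left_geod hg (by positivity) (hid i hi),
          dist_geod_right hg (by positivity) (hid i hi)]
        ring)
    have h2 := hv.dist_le hC hg hτ (hw i)
    have h3 : g / B ≤ dist v (w i) + 1 := by
      rw [div_le_iff₀' (by linarith)]
      linarith
    linarith
  have hpath := hδ.le_gromovProduct_path (w := v) (c := g / B - 1 - B) k n w hn2
    (fun i hi => by linarith [hfar i hi]) (fun i hi => by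
      have h1 := gromovProduct_le_change v (w i) (w (i + 1)) (w (i + 1))
      have h2 : gromovProduct v (w i) (w i) = dist v (w i) := by
        unfold gromovProduct
        simp
      have h3 := gromovProduct_le_change v (w i) (w (i + 1)) (w i)
      rw [gromovProduct_comm v (w (i + 1))] at h3
      linarith [hfar i hi.le, hstep i hi])
  have h0 : dist (w 0) p ≤ B := by
    refine (hw 0).symm.dist_le_of_lt_one hC hp.symm ?_
    simp [geod_zero]
  have h1 : dist (w n) q ≤ B := by
    refine (hw n).symm.dist_le_of_lt_one hC hq.symm ?_
    simp [hdn, geod_dist]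
  have h2 := gromovProduct_le_change v (w 0) p (w n)
  have h3 := gromovProduct_le_change v (w n) q p
  rw [gromovProduct_comm v _ p, gromovProduct_comm v q p] at h3
  have h4 : g / B ≤ K + 1 + 3 * B + k * δ' := by linarith
  rwa [div_le_iff₀' (by linarith)] at h4

/-- Tripods of bounded products and of all sizes at one point of the base space give tripods, of
one size which is large with respect to the products, at all its translates. -/
theorem Cusp.exists_hasTripod_translates (hC : 0 ≤ C) (hg : IsGeodesicSpace (Cusp H)) {δ' : ℝ}
    (hδ : IsHyperbolicWith (Cusp H) δ') {V : Set X} {v₀ : X}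
    (hV : ∀ v ∈ V, ∃ τ : X ≃ᵢ X, τ v₀ = v ∧ (∀ x ∈ V, τ x ∈ V) ∧ (∀ P ∈ 𝓟, τ '' P ∈ 𝓟) ∧
      ∀ P ∈ 𝓟, τ.symm '' P ∈ 𝓟) {E K : ℝ}
    (h : ∀ R : ℝ, 0 ≤ R → ∃ p : Fin 3 → X, (∀ i, p i ∈ V) ∧
      (∀ i, R ≤ dist (Cusp.ofSpace H v₀) (Cusp.ofSpace H (p i))) ∧
      (∀ i, dist (Cusp.ofSpace H v₀) (Cusp.ofSpace H (p i)) ≤ R + E) ∧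
      ∀ i j, i ≠ j → gromovProduct (Cusp.ofSpace H v₀) (Cusp.ofSpace H (p i))
        (Cusp.ofSpace H (p j)) ≤ K) :
    ∃ R' K' : ℝ, 2 * K' + 4 * δ' + 1 ≤ R' ∧ ∀ v ∈ Cusp.ofSpace H '' V,
      HasTripod (Cusp.ofSpace H '' V) v R' K' := by
  set B := correspondsConst C L with hB
  have hB1 : 1 ≤ B := one_le_correspondsConst hC
  have hδ0 := hδ.nonneg (Cusp.ofSpace H v₀)
  -- the size of the tripod at `v₀` is chosen such that paths have at most `2 ^ k` steps
  obtain ⟨k, hk⟩ := exists_linear_le_two_pow (1 / (2 * B) / B) (2 * B * δ')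
    (2 * B * (K + 1 + 3 * B) + 4 * δ' + 1 + 1 + ((1 + B) / (2 * B) + |E|) / B) (by positivity)
  set R := (2 ^ k - 1 - B) / (2 * B) - |E| with hR
  have hK0 : 0 ≤ K := by
    obtain ⟨p, -, -, -, h3⟩ := h 0 le_rfl
    exact (gromovProduct_nonneg _ _ _).trans (h3 0 1 (by decide))
  have hRB : R / B = 1 / (2 * B) / B * 2 ^ k - ((1 + B) / (2 * B) + |E|) / B := by
    rw [hR]
    field_simp
    ring
  -- The leg length grows like `2 ^ k`, the products of the translated legs only like `k`.
  have hbig : 2 * (B * (K + 1 + 3 * B + k * δ')) + 4 * δ' + 1 ≤ R / B - 1 := by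
    rw [hRB]
    linarith
  have hRpos : 0 ≤ R := by
    have h1 : 0 ≤ B * (K + 1 + 3 * B + k * δ') := by positivity
    have : 0 ≤ R / B := by linarith
    exact (div_nonneg_iff.1 this).elim (fun h => h.1) (fun h => by linarith [h.2])
  refine ⟨R / B - 1, B * (K + 1 + 3 * B + k * δ'), hbig, ?_⟩
  rintro _ ⟨v, hv, rfl⟩
  obtain ⟨τ, rfl, hτV, hτ, hτ'⟩ := hV v hv
  obtain ⟨p, hpV, hp1, hp2, hp3⟩ := h R hRpos
  have hτs : ∀ P ∈ 𝓟, τ.symm.symm '' P ∈ 𝓟 := by simpa using hτ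
  refine ⟨fun i => Cusp.ofSpace H (τ (p i)), fun i => ⟨_, hτV _ (hpV i), rfl⟩, fun i => ?_,
    fun i j hij => ?_⟩
  · have h1 := (Corresponds.space (H := H) (τ := τ) v₀).symm.dist_le hC hg hτ'
      (Corresponds.space (p i)).symm
    have h2 := (hp1 i).trans h1
    rw [sub_le_iff_le_add, div_le_iff₀' (by linarith)]
    exact h2
  · refine Corresponds.gromovProduct_le hC hg hδ hτ hτ' (.space v₀) (.space (p i))
      (.space (p j)) (hp3 i j hij) ?_
    have h1 := (Corresponds.space (H := H) (τ := τ) (p i)).dist_le hC hg hτ (.space (p j))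
    have h2 := dist_triangle_left (Cusp.ofSpace H (p i)) (Cusp.ofSpace H (p j))
      (Cusp.ofSpace H v₀)
    have h3 : dist (Cusp.ofSpace H (p i)) (Cusp.ofSpace H (p j)) + 1 ≤ 2 * R + 2 * |E| + 1 := by
      linarith [hp2 i, hp2 j, le_abs_self E]
    have h4 : B * (2 * R + 2 * |E| + 1) = 2 ^ k - 1 := by
      rw [hR]
      field_simp
      ring
    have h5 := mul_le_mul_of_nonneg_left h3 (by linarith : 0 ≤ B)
    linarith

end CuspTripods

/-! ### The realization of a graph: separation of vertices and induced isometries. -/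

section GraphRealization

variable {V : Type*} {Γ : SimpleGraph V} {hΓ : Γ.Preconnected}

/-! ### The realization of a graph -/

theorem Realization.exists_rep (p : Realization Γ hΓ) :
    (∃ v, p = Realization.vertex v) ∨ ∃ e t, p = Realization.edgePoint e t := by
  obtain ⟨v | ⟨e, t⟩, rfl⟩ := SeparationQuotient.surjective_mk (X := PreRealization Γ hΓ) p
  · exact Or.inl ⟨v, rfl⟩
  · exact Or.inr ⟨e, t, rfl⟩

theorem Realization.dist_mk_le {a b : PreRealization Γ hΓ} {r : ℝ}
    (h : Chain (GraphStep Γ hΓ) a b r) :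
    dist (SeparationQuotient.mk a : Realization Γ hΓ) (SeparationQuotient.mk b) ≤ r :=
  csInf_le ⟨0, fun _ hr => hr.nonneg (GraphStep.nonneg Γ hΓ)⟩ h

theorem Realization.dist_edgePoint_vertex_le (e : Γ.Dart) (t : unitInterval) :
    dist (Realization.edgePoint e t : Realization Γ hΓ) (Realization.vertex e.fst) ≤ 1 := by
  refine (Realization.dist_mk_le ((Chain.single (GraphStep.edge e t 0)).append
    (Chain.single' (GraphStep.start e)))).trans ?_
  rw [add_zero, Subtype.dist_eq, Real.dist_eq]
  simpa [abs_of_nonneg t.2.1] using t.2.2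

theorem Realization.exists_vertex_near (p : Realization Γ hΓ) :
    ∃ v, dist p (Realization.vertex v) ≤ 1 := by
  rcases p.exists_rep with ⟨v, rfl⟩ | ⟨e, t, rfl⟩
  · exact ⟨v, by simp⟩
  · exact ⟨e.fst, Realization.dist_edgePoint_vertex_le e t⟩

open Classical in
/-- The tent function at a vertex `v`, equal to `1` at `v` and to `0` outside the open star. -/
noncomputable def tent (v : V) : PreRealization Γ hΓ → ℝ
  | Sum.inl w => if w = v then 1 else 0
  | Sum.inr (e, t) => (if e.fst = v then 1 - (t : ℝ) else 0) + if e.snd = v then (t : ℝ) else 0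

theorem abs_tent_sub_le_of_step (v : V) {a b : PreRealization Γ hΓ} {r : ℝ}
    (h : GraphStep Γ hΓ a b r) : |tent v a - tent v b| ≤ r := by
  cases h with
  | edge e s t =>
    have hne : e.fst ≠ e.snd := e.adj.ne
    simp only [tent]
    rw [Subtype.dist_eq, Real.dist_eq]
    split_ifs with h1 h2 h2
    · exact absurd (h1.trans h2.symm) hne
    · rw [abs_sub_comm]
      simp
    · simp
    · simp
  | start e =>
    have hne : e.fst ≠ e.snd := e.adj.ne
    by_cases h1 : e.fst = v <;> by_cases h2 : e.snd = v <;> simp [tent, h1]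
  | flip e t =>
    simp only [tent]
    have h1 : e.symm.fst = e.snd := rfl
    have h2 : e.symm.snd = e.fst := rfl
    rw [h1, h2, unitInterval.coe_symm_eq, sub_sub_cancel, add_comm, sub_self, abs_zero]

/-- The distance is an infimum over chains, so a lower bound comes from a function that varies along
each link by at most its length. -/
theorem abs_tent_sub_le (v : V) (a b : PreRealization Γ hΓ) :
    |tent v a - tent v b| ≤
      dist (SeparationQuotient.mk a : Realization Γ hΓ) (SeparationQuotient.mk b) := by
  refine le_csInf (GraphStep.connected Γ hΓ a b) fun r hr => ?_
  induction hr with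
  | nil => simp
  | @fwd a b c r s h _ ih =>
    exact (abs_sub_le _ (tent v b) _).trans (add_le_add (abs_tent_sub_le_of_step v h) ih)
  | @bwd a b c r s h _ ih =>
    refine (abs_sub_le _ (tent v b) _).trans (add_le_add ?_ ih)
    rw [abs_sub_comm]
    exact abs_tent_sub_le_of_step v h

theorem Realization.one_le_dist_vertex {v w : V} (h : v ≠ w) :
    1 ≤ dist (Realization.vertex v : Realization Γ hΓ) (Realization.vertex w) := by
  refine le_trans ?_ (abs_tent_sub_le v (Sum.inl v) (Sum.inl w))
  simp [tent, h.symm]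

theorem Realization.eq_or_eq_of_vertex_eq_edgePoint {v : V} {e : Γ.Dart} {t : unitInterval}
    (h : (Realization.vertex v : Realization Γ hΓ) = Realization.edgePoint e t) :
    e.fst = v ∨ e.snd = v := by
  by_contra! hne
  have h1 := abs_tent_sub_le (hΓ := hΓ) v (Sum.inl v) (Sum.inr (e, t))
  change _ ≤ dist (Realization.vertex v : Realization Γ hΓ) (Realization.edgePoint e t) at h1
  rw [h, dist_self] at h1
  simp only [tent, hne.1, hne.2, if_true, if_false] at h1
  norm_num at h1

/-- The map induced on points by a graph endomorphism. -/
def PreRealization.map (φ : Γ →g Γ) : PreRealization Γ hΓ → PreRealization Γ hΓ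
  | Sum.inl v => Sum.inl (φ v)
  | Sum.inr (e, t) => Sum.inr (φ.mapDart e, t)

theorem GraphStep.map (φ : Γ →g Γ) {a b : PreRealization Γ hΓ} {r : ℝ}
    (h : GraphStep Γ hΓ a b r) :
    GraphStep Γ hΓ (PreRealization.map φ a) (PreRealization.map φ b) r := by
  cases h with
  | edge e s t => exact .edge _ _ _
  | start e => exact .start (φ.mapDart e)
  | flip e t => exact .flip (φ.mapDart e) t

theorem PreRealization.dist_map_le (φ : Γ →g Γ) (a b : PreRealization Γ hΓ) :
    dist (PreRealization.map φ a) (PreRealization.map φ b) ≤ dist a b := by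
  refine csInf_le_csInf ⟨0, fun _ hr => hr.nonneg (GraphStep.nonneg Γ hΓ)⟩
    (GraphStep.connected Γ hΓ a b) fun r hr => ?_
  change Chain _ _ _ _
  induction hr with
  | nil => exact .nil _
  | fwd h _ ih => exact .fwd (h.map φ) ih
  | bwd h _ ih => exact .bwd (h.map φ) ih

theorem PreRealization.map_map (φ ψ : Γ →g Γ) (h : ∀ v, φ (ψ v) = v) (a : PreRealization Γ hΓ) :
    PreRealization.map φ (PreRealization.map ψ a) = a := by
  rcases a with v | ⟨e, t⟩
  · exact congrArg Sum.inl (h v)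
  · have : φ.mapDart (ψ.mapDart e) = e := by
      ext <;> simp [h]
    exact congrArg Sum.inr (Prod.ext this rfl)

theorem PreRealization.dist_map (φ : Γ ≃g Γ) (a b : PreRealization Γ hΓ) :
    dist (PreRealization.map φ.toHom a) (PreRealization.map φ.toHom b) = dist a b := by
  refine le_antisymm (PreRealization.dist_map_le _ a b) ?_
  have := PreRealization.dist_map_le φ.symm.toHom (PreRealization.map φ.toHom a)
    (PreRealization.map φ.toHom b)
  rwa [PreRealization.map_map φ.symm.toHom φ.toHom φ.symm_apply_apply,
    PreRealization.map_map φ.symm.toHom φ.toHom φ.symm_apply_apply] at this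

/-- The map of the realization induced by a graph automorphism. -/
noncomputable def Realization.map (φ : Γ ≃g Γ) : Realization Γ hΓ → Realization Γ hΓ :=
  SeparationQuotient.lift
    (fun a : PreRealization Γ hΓ => SeparationQuotient.mk (PreRealization.map φ.toHom a))
    fun a b h => SeparationQuotient.mk_eq_mk.2 <| Metric.inseparable_iff.2 <|
      (PreRealization.dist_map φ a b).trans (Metric.inseparable_iff.1 h)

theorem Realization.isometry_map (φ : Γ ≃g Γ) :
    Isometry (Realization.map φ : Realization Γ hΓ → Realization Γ hΓ) := by
  refine Isometry.of_dist_eq fun p q => ?_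
  obtain ⟨a, rfl⟩ := SeparationQuotient.surjective_mk (X := PreRealization Γ hΓ) p
  obtain ⟨b, rfl⟩ := SeparationQuotient.surjective_mk (X := PreRealization Γ hΓ) q
  exact PreRealization.dist_map φ a b

theorem Realization.map_map_symm (φ : Γ ≃g Γ) (p : Realization Γ hΓ) :
    Realization.map φ (Realization.map φ.symm p) = p := by
  obtain ⟨a, rfl⟩ := SeparationQuotient.surjective_mk (X := PreRealization Γ hΓ) p
  exact congrArg SeparationQuotient.mk
    (PreRealization.map_map φ.toHom φ.symm.toHom φ.apply_symm_apply a)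

/-- The isometry of the realization induced by a graph automorphism. -/
noncomputable def Realization.isometryEquiv (φ : Γ ≃g Γ) : Realization Γ hΓ ≃ᵢ Realization Γ hΓ :=
  IsometryEquiv.mk' (Realization.map φ) (Realization.map φ.symm) (Realization.map_map_symm φ)
    (Realization.isometry_map φ)

end GraphRealization

/-! ### Translations of the Cayley graph and their action on peripheral sets. -/

section Cayley

variable {G : Type*} [Group G] {S : Set G} {hS : Subgroup.closure S = ⊤}

/-! ### Cayley graphs -/

/-- Left translations are automorphisms of the Cayley graph. -/
def mulCayleyLeft (S : Set G) (g : G) : SimpleGraph.mulCayley S ≃g SimpleGraph.mulCayley S where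
  toEquiv := Equiv.mulLeft g
  map_rel_iff' := by simp [SimpleGraph.mulCayley_adj, mul_assoc]

/-- Left translations are isometries of the Cayley graph. -/
noncomputable def translation (hS : Subgroup.closure S = ⊤) (g : G) :
    CayleySpace S hS ≃ᵢ CayleySpace S hS :=
  Realization.isometryEquiv (mulCayleyLeft S g)

/-- An element of the group, as a vertex of the Cayley graph. -/
noncomputable def cayleyVertex (hS : Subgroup.closure S = ⊤) (g : G) : CayleySpace S hS :=
  Realization.vertex g

theorem translation_vertex (g v : G) :
    translation hS g (cayleyVertex hS v) = cayleyVertex hS (g * v) := rfl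

theorem dist_cayleyVertex_mul (g v w : G) :
    dist (cayleyVertex hS (g * v)) (cayleyVertex hS (g * w)) =
      dist (cayleyVertex hS v) (cayleyVertex hS w) :=
  (translation hS g).dist_eq (cayleyVertex hS v) (cayleyVertex hS w)

theorem translation_symm (g : G) : (translation hS g).symm = translation hS g⁻¹ := by
  have : (mulCayleyLeft S g).symm = mulCayleyLeft S g⁻¹ := by
    ext v
    rfl
  ext p
  change Realization.map (mulCayleyLeft S g).symm p = Realization.map (mulCayleyLeft S g⁻¹) p
  rw [this]

variable {K : Subgroup G}

/-- The point is that the metric quotient does not identify a vertex with another vertex, nor with a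
point of an edge that does not end at it; both are read off from the tent functions. -/
theorem cayleyVertex_mem_cosetCopy {g v : G} :
    cayleyVertex hS v ∈ cosetCopy S hS K g ↔ g⁻¹ * v ∈ K := by
  constructor
  · rintro (⟨w, hw, h⟩ | ⟨e, t, h1, h2, h⟩)
    · rcases eq_or_ne v w with rfl | hvw
      · exact hw
      · have h1 : (1 : ℝ) ≤ dist (cayleyVertex hS v) (cayleyVertex hS w) :=
          Realization.one_le_dist_vertex hvw
        have h2 : cayleyVertex hS v = cayleyVertex hS w := h
        rw [h2, dist_self] at h1
        norm_num at h1
    · rcases Realization.eq_or_eq_of_vertex_eq_edgePoint h with rfl | rfl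
      · exact h1
      · exact h2
  · exact fun h => Or.inl ⟨v, h, rfl⟩

theorem exists_vertex_near_of_mem_cosetCopy {g : G} {p : CayleySpace S hS}
    (h : p ∈ cosetCopy S hS K g) : ∃ v, g⁻¹ * v ∈ K ∧ dist p (cayleyVertex hS v) ≤ 1 := by
  rcases h with ⟨v, hv, rfl⟩ | ⟨e, t, h1, -, rfl⟩
  · exact ⟨v, hv, by simp [cayleyVertex]⟩
  · exact ⟨e.fst, h1, Realization.dist_edgePoint_vertex_le e t⟩

theorem translation_mem_cosetCopy (a : G) {g : G} {p : CayleySpace S hS}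
    (h : p ∈ cosetCopy S hS K g) : translation hS a p ∈ cosetCopy S hS K (a * g) := by
  rcases h with ⟨v, hv, rfl⟩ | ⟨e, t, h1, h2, rfl⟩
  · exact Or.inl ⟨a * v, by simpa [mul_assoc] using hv, rfl⟩
  · refine Or.inr ⟨(mulCayleyLeft S a).toHom.mapDart e, t, ?_, ?_, rfl⟩
    · change (a * g)⁻¹ * (a * e.fst) ∈ K
      simpa [mul_assoc] using h1
    · change (a * g)⁻¹ * (a * e.snd) ∈ K
      simpa [mul_assoc] using h2

theorem translation_image_cosetCopy (a g : G) :
    translation hS a '' cosetCopy S hS K g = cosetCopy S hS K (a * g) := by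
  refine Set.Subset.antisymm ?_ fun p hp => ?_
  · rintro _ ⟨p, hp, rfl⟩
    exact translation_mem_cosetCopy a hp
  · refine ⟨(translation hS a).symm p, ?_, (translation hS a).apply_symm_apply p⟩
    rw [translation_symm]
    simpa using translation_mem_cosetCopy a⁻¹ hp

theorem translation_image_mem_peripherals {n : ℕ} {K : Fin n → Subgroup G} (a : G)
    {P : Set (CayleySpace S hS)} (hP : P ∈ peripherals S hS K) :
    translation hS a '' P ∈ peripherals S hS K := by
  obtain ⟨i, g, rfl⟩ := hP
  exact ⟨i, a * g, translation_image_cosetCopy a g⟩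

end Cayley

section Separated

/-- A uniformly separated family in a proper space has finitely many points in every ball. -/
theorem finite_of_separated {Y ι : Type*} [MetricSpace Y] [ProperSpace Y] (f : ι → Y) {c : ℝ}
    (hc : 0 < c) (hf : ∀ i j, i ≠ j → c ≤ dist (f i) (f j)) (y : Y) (r : ℝ) :
    {i | dist y (f i) ≤ r}.Finite := by
  by_contra hinf
  have hinf : {i | dist y (f i) ≤ r}.Infinite := hinf
  let e := hinf.natEmbedding
  obtain ⟨z, -, φ, hφ, hlim⟩ := (isCompact_closedBall y r).tendsto_subseq
    (x := fun n => f (e n)) (fun n => by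
      rw [Metric.mem_closedBall, dist_comm]
      exact (e n).2)
  obtain ⟨N, hN⟩ := Metric.cauchySeq_iff'.1 hlim.cauchySeq c hc
  have h1 := hN (N + 1) (by omega)
  refine absurd (hf (e (φ (N + 1))) (e (φ N)) fun h => ?_) (not_le.2 h1)
  have h2 := hφ.injective (e.injective (Subtype.ext h))
  omega

end Separated

/-! ### Tripods of all sizes at one point, from three peripheral sets. -/

section PeripheralTripods

variable {X : Type*} [MetricSpace X] {𝓟 : Set (Set X)} {δ C L : ℝ}
  (H : HoroballFamily 𝓟 δ C L)

/-! ### Tripods from three peripheral sets -/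

/-- Points far out in three distinct unbounded peripheral sets form tripods. -/
theorem Cusp.exists_tripods_of_peripherals {δ' : ℝ} (hδ : IsHyperbolicWith (Cusp H) δ') {ε : ℝ}
    (hε : 0 ≤ ε) (hcc : ∀ P ∈ 𝓟, IsCoarselyConnected ε P) {P : Fin 3 → 𝓟}
    (hP : Function.Injective P) (o : X) {V : Set X}
    (hV : ∀ i, ∀ x ∈ (P i : Set X), ∃ v ∈ V, v ∈ (P i : Set X) ∧ dist x v ≤ 1)
    (hunb : ∀ i, ∀ r : ℝ, ∃ z ∈ (P i : Set X), r ≤ dist (Cusp.ofSpace H o) (Cusp.ofSpace H z)) :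
    ∃ E K : ℝ, ∀ R : ℝ, 0 ≤ R → ∃ p : Fin 3 → X, (∀ i, p i ∈ V) ∧
      (∀ i, R ≤ dist (Cusp.ofSpace H o) (Cusp.ofSpace H (p i))) ∧
      (∀ i, dist (Cusp.ofSpace H o) (Cusp.ofSpace H (p i)) ≤ R + E) ∧
      ∀ i j, i ≠ j → gromovProduct (Cusp.ofSpace H o) (Cusp.ofSpace H (p i))
        (Cusp.ofSpace H (p j)) ≤ K := by
  have hδ0 := hδ.nonneg (Cusp.ofSpace H o)
  have hC := (H (P 0)).C_pos
  have hne : ∀ i, Nonempty (H (P i)).base := fun i => by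
    obtain ⟨z, hz, -⟩ := hunb i 0
    obtain ⟨y, hy, -⟩ := (H (P i)).base_dense z hz
    exact ⟨⟨y, hy⟩⟩
  have x : ∀ i, (H (P i)).base := fun i => Classical.choice (hne i)
  set D := ∑ i, dist (Cusp.ofSpace H o) (Cusp.ofSpace H (x i : X)) with hD
  have hDi : ∀ i, dist (Cusp.ofSpace H o) (Cusp.ofSpace H (x i : X)) ≤ D := fun i =>
    Finset.single_le_sum (f := fun i => dist (Cusp.ofSpace H o) (Cusp.ofSpace H (x i : X)))
      (fun _ _ => dist_nonneg) (Finset.mem_univ i)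
  have hD0 : 0 ≤ D := dist_nonneg.trans (hDi 0)
  have hlog : (0 : ℝ) ≤ Real.log 2 := Real.log_nonneg one_le_two
  -- Large enough for the points `v i` chosen below to lie in the directions of their horoballs, as
  -- seen from `o`.
  set R₀ := 2 * (D + C + 2 * δ') + 3 * C + 2 * Real.log 2 + 1 with hR₀
  have hR₀0 : 0 ≤ R₀ := by positivity
  refine ⟨R₀ + D + ε + 2, D + C + 2 * δ', fun R hR => ?_⟩
  -- The upper bound, which comes from coarse connectedness, is needed later: it limits the number
  -- of steps of the paths between translated points.
  have hpt : ∀ i, ∃ v ∈ V, v ∈ (P i : Set X) ∧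
      R + R₀ + D ≤ dist (Cusp.ofSpace H o) (Cusp.ofSpace H v) ∧
      dist (Cusp.ofSpace H o) (Cusp.ofSpace H v) ≤ R + R₀ + D + 2 + ε := by
    intro i
    obtain ⟨z, hz, hzr⟩ := hunb i (R + R₀ + D + 1)
    obtain ⟨y, hy, h1, h2⟩ := (hcc (P i) (P i).2).exists_between hε
      (fun x => dist (Cusp.ofSpace H o) (Cusp.ofSpace H x))
      (fun a b => (dist_triangle _ (Cusp.ofSpace H a) _).trans
        (by gcongr; exact Cusp.dist_ofSpace_le H a b))
      ((H (P i)).base_subset (x i).2) hz (r := R + R₀ + D + 1) (by linarith [hDi i]) hzr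
    obtain ⟨v, hv, hvP, hyv⟩ := hV i y hy
    have h3 := (Cusp.dist_ofSpace_le H y v).trans hyv
    refine ⟨v, hv, hvP, ?_, ?_⟩
    · linarith [dist_triangle_right (Cusp.ofSpace H o) (Cusp.ofSpace H y) (Cusp.ofSpace H v)]
    · linarith [dist_triangle (Cusp.ofSpace H o) (Cusp.ofSpace H y) (Cusp.ofSpace H v)]
  choose v hvV hvP hv1 hv2 using hpt
  have hbase : ∀ i, ∃ y : (H (P i)).base, dist (v i) y ≤ C := fun i => by
    obtain ⟨y, hy, h⟩ := (H (P i)).base_dense _ (hvP i)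
    exact ⟨⟨y, hy⟩, h⟩
  choose y hy using hbase
  obtain ⟨m, hm⟩ := exists_le_exp (∑ i, dist (x i : X) (y i))
  have hxy : ∀ i, dist (x i : X) (y i) ≤ 1 * Real.exp m := fun i => by
    rw [one_mul]
    exact (Finset.single_le_sum (f := fun i => dist (x i : X) (y i))
      (fun _ _ => dist_nonneg) (Finset.mem_univ i)).trans (hm m le_rfl)
  -- At depth `m` the rays from `x i` and `y i` have come together. The way from `v i` to that deep
  -- point costs about `m`, as it does from `o`, so the product retains about half of the distance
  -- of `v i` from `o`.
  have hlarge : ∀ i, D + C + 2 * δ' < gromovProduct (Cusp.ofSpace H o) (Cusp.ofSpace H (v i))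
      (Cusp.onRay H (P i) (x i) m) := by
    intro i
    have e1 := Cusp.dist_onRay_onRay_le H (P i) (x i) (y i) m (hxy i)
    have e2 := Cusp.dist_ofSpace_onRay_le H (P i) (y i) m
    have e3 := (Cusp.dist_ofSpace_le H (v i) (y i)).trans (hy i)
    have e4 := Cusp.le_dist_onRay_ofSpace H (P i) (x i) m o
    have e6 := dist_triangle4 (Cusp.ofSpace H (v i)) (Cusp.ofSpace H (y i : X))
      (Cusp.onRay H (P i) (y i) m) (Cusp.onRay H (P i) (x i) m)
    have e : (1 : ℝ) + 1 = 2 := by norm_num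
    rw [e, dist_comm] at e1
    unfold gromovProduct
    rw [dist_comm] at e4
    linarith [hv1 i]
  refine ⟨v, hvV, fun i => by linarith [hv1 i], fun i => by linarith [hv2 i], fun i j hij => ?_⟩
  -- Deep points of distinct horoballs are at least `2 * m - 2 * C` apart and each within `D + m` of
  -- `o`, so their product is at most `D + C`.
  refine hδ.le_of_lt' ?_ (hlarge i) (hlarge j)
  have e1 := Cusp.le_dist_onRay_of_ne H (fun h => hij (hP h)) (x i) (x j) m m
  have e2 : ∀ i, dist (Cusp.ofSpace H o) (Cusp.onRay H (P i) (x i) m) ≤ D + m := fun i => by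
    linarith [dist_triangle (Cusp.ofSpace H o) (Cusp.ofSpace H (x i : X))
      (Cusp.onRay H (P i) (x i) m), hDi i, Cusp.dist_ofSpace_onRay_le H (P i) (x i) m]
  unfold gromovProduct
  linarith [e2 i, e2 j]

end PeripheralTripods

/-! ### Groups acting on a hyperbolic space: a quasi-geodesic of powers, and tripods in orbits. -/

section GroupOrbit

variable {Y : Type*} [MetricSpace Y] {G : Type*} [Group G] {δ : ℝ} {f : G → Y}

/-! ### Hyperbolic groups -/

theorem gromovProduct_mul_left (hf : ∀ g a b, dist (f (g * a)) (f (g * b)) = dist (f a) (f b))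
    (g w x y : G) : gromovProduct (f (g * w)) (f (g * x)) (f (g * y)) =
      gromovProduct (f w) (f x) (f y) := by
  unfold gromovProduct
  rw [hf, hf, hf]

theorem dist_one_inv (hf : ∀ g a b, dist (f (g * a)) (f (g * b)) = dist (f a) (f b)) (u : G) :
    dist (f 1) (f u⁻¹) = dist (f 1) (f u) := by
  rw [← hf u 1 u⁻¹, mul_one, mul_inv_cancel, dist_comm]

/-- An infinite group acting properly and coboundedly on a hyperbolic space has an element whose
powers run along a quasi-geodesic. -/
theorem exists_hyperbolic_element (hg : IsGeodesicSpace Y) (hδ : IsHyperbolicWith Y δ)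
    (hf : ∀ g a b, dist (f (g * a)) (f (g * b)) = dist (f a) (f b))
    (hdense : ∀ y, ∃ g, dist y (f g) ≤ 1) (hunb : ∀ r : ℝ, ∃ g, r ≤ dist (f 1) (f g)) :
    ∃ u : G, 2 * gromovProduct (f 1) (f u) (f u⁻¹) + 4 * δ + 2 ≤ dist (f 1) (f u) := by
  have hδ0 := hδ.nonneg (f 1)
  -- A group element `g` near the midpoint of a long geodesic from `1` to `h` is moved to the
  -- identity. This gives two long elements `u = g⁻¹` and `v = g⁻¹ * h` with product at most `1`;
  -- one of `u`, `v`, `u * v` will do.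
  obtain ⟨h, hh⟩ := hunb (2 * (20 * δ + 20) + 2)
  set m := geod hg (f 1) (f h) (dist (f 1) (f h) / 2) with hm
  have hd := dist_nonneg (x := f 1) (y := f h)
  have hm1 : dist (f 1) m = dist (f 1) (f h) / 2 := dist_left_geod hg (by linarith) (by linarith)
  have hm2 : dist m (f h) = dist (f 1) (f h) - dist (f 1) (f h) / 2 :=
    dist_geod_right hg (by linarith) (by linarith)
  obtain ⟨g, hgm⟩ := hdense m
  set u := g⁻¹ with hu
  set v := g⁻¹ * h with hv
  have hu1 : 20 * δ + 20 ≤ dist (f 1) (f u) := by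
    rw [dist_one_inv hf]
    linarith [dist_triangle_right (f 1) m (f g)]
  have hv1 : 20 * δ + 20 ≤ dist (f 1) (f v) := by
    rw [← hf g 1 v, hv, mul_one, mul_inv_cancel_left]
    linarith [dist_triangle_left m (f h) (f g), dist_comm m (f g)]
  have huv : gromovProduct (f 1) (f u) (f v) ≤ 1 := by
    rw [← gromovProduct_mul_left hf g, hu, hv, mul_one, mul_inv_cancel, mul_inv_cancel_left]
    refine (gromovProduct_le_base (f g) m _ _).trans ?_
    have : gromovProduct m (f 1) (f h) = 0 := by
      unfold gromovProduct
      rw [dist_comm m, hm1, hm2]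
      ring
    rw [this, zero_add, dist_comm]
    exact hgm
  -- If `u` and `v` both fail, then `u⁻¹` points in the direction of `u` and `v⁻¹` in that of `v`.
  -- So `u * v` is long and points along `u`, while its inverse points along `v⁻¹`, hence along `v`;
  -- therefore `u * v` does not fail.
  by_contra! hcon
  have hu2 := hcon u
  have hv2 := hcon v
  have hiv : gromovProduct (f 1) (f v) (f u⁻¹) ≤ 1 + δ := by
    rw [gromovProduct_comm] at huv
    exact hδ.le_of_lt huv (by rw [gromovProduct_comm]; linarith)
  have hui : gromovProduct (f 1) (f u) (f v⁻¹) ≤ 1 + δ :=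
    hδ.le_of_lt huv (by rw [gromovProduct_comm]; linarith)
  have e1 : gromovProduct (f u) (f 1) (f (u * v)) ≤ 1 + δ := by
    have := gromovProduct_mul_left hf u 1 u⁻¹ v
    rw [mul_one, mul_inv_cancel] at this
    rwa [this, gromovProduct_comm]
  have e2 : gromovProduct (f v⁻¹) (f 1) (f (u * v)⁻¹) ≤ 1 + δ := by
    have := gromovProduct_mul_left hf v⁻¹ 1 v u⁻¹
    rw [mul_one, inv_mul_cancel, ← mul_inv_rev] at this
    rwa [this]
  have e3 := gromovProduct_add (f 1) (f u) (f (u * v))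
  have e4 := gromovProduct_add (f 1) (f v⁻¹) (f (u * v)⁻¹)
  rw [dist_one_inv hf] at e4
  rw [gromovProduct_comm (f 1)] at e3 e4
  have e5 := hδ.le_of_lt' hui (x' := f (u * v)) (y' := f (u * v)⁻¹) (by linarith) (by linarith)
  have e6 := hcon (u * v)
  have e8 : dist (f 1) (f (u * v)) =
      dist (f u) (f 1) + dist (f 1) (f v) - 2 * gromovProduct (f u) (f 1) (f (u * v)) := by
    have := hf u 1 v
    rw [mul_one] at this
    unfold gromovProduct
    rw [this]
    ring
  rw [dist_comm (f u)] at e8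
  linarith

theorem hasTripod_range_of_one (hf : ∀ g a b, dist (f (g * a)) (f (g * b)) = dist (f a) (f b))
    {N K : ℝ} (h : HasTripod (Set.range f) (f 1) N K) (g : G) :
    HasTripod (Set.range f) (f g) N K := by
  obtain ⟨p, h1, h2, h3⟩ := h
  choose a ha using h1
  refine ⟨fun i => f (g * a i), fun i => ⟨_, rfl⟩, fun i => ?_, fun i j hij => ?_⟩
  · have := hf g 1 (a i)
    rw [mul_one] at this
    rw [this, ha]
    exact h2 i
  · have := gromovProduct_mul_left hf g 1 (a i) (a j)
    rw [mul_one] at this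
    rw [this, ha, ha]
    exact h3 i j hij

/-- Writing `g⁻¹ = u ^ j * b` with `b` short shows that the coset of `g` is that of `b⁻¹`, and there
are only finitely many short `b`. -/
theorem isVirtuallyCyclic_of_near_powers
    (hf : ∀ g a b, dist (f (g * a)) (f (g * b)) = dist (f a) (f b))
    (hfin : ∀ r : ℝ, {g | dist (f 1) (f g) ≤ r}.Finite) {u : G} {r : ℝ}
    (h : ∀ g, ∃ j : ℤ, dist (f g) (f (u ^ j)) < r) : IsVirtuallyCyclic G := by
  refine ⟨Subgroup.zpowers u, inferInstance, ?_⟩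
  have : Finite {g | dist (f 1) (f g) ≤ r} := (hfin r).to_subtype
  have hsurj : Function.Surjective fun b : {g | dist (f 1) (f g) ≤ r} =>
      (((b : G)⁻¹ : G) : G ⧸ Subgroup.zpowers u) := by
    intro q
    obtain ⟨g, rfl⟩ := QuotientGroup.mk_surjective q
    obtain ⟨j, hj⟩ := h g⁻¹
    refine ⟨⟨(u ^ j)⁻¹ * g⁻¹, ?_⟩, ?_⟩
    · have := hf (u ^ j) 1 ((u ^ j)⁻¹ * g⁻¹)
      rw [mul_one, mul_inv_cancel_left, dist_comm] at this
      change dist _ _ ≤ r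
      rw [← this]
      exact hj.le
    · refine QuotientGroup.eq.2 ?_
      simp only [mul_inv_rev, inv_inv, mul_assoc]
      simp
  have := Finite.of_surjective _ hsurj
  exact Subgroup.finiteIndex_of_finite_quotient

/-- Orbits of groups which are not virtually cyclic contain tripods of all sizes. -/
theorem exists_hasTripod_of_not_isVirtuallyCyclic [Infinite G] (hg : IsGeodesicSpace Y)
    (hδ : IsHyperbolicWith Y δ)
    (hf : ∀ g a b, dist (f (g * a)) (f (g * b)) = dist (f a) (f b))
    (hdense : ∀ y, ∃ g, dist y (f g) ≤ 1)
    (hfin : ∀ r : ℝ, {g | dist (f 1) (f g) ≤ r}.Finite) (hG : ¬ IsVirtuallyCyclic G) :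
    ∃ K : ℝ, ∀ g N, HasTripod (Set.range f) (f g) N K := by
  have hδ0 := hδ.nonneg (f 1)
  obtain ⟨u, hu⟩ := exists_hyperbolic_element hg hδ hf hdense fun r => by
    obtain ⟨g, hg⟩ := (hfin r).exists_notMem
    exact ⟨g, (not_le.1 hg).le⟩
  set R := dist (f 1) (f u) with hR
  set K₀ := gromovProduct (f 1) (f u) (f u⁻¹) with hK₀
  have hK₀0 : 0 ≤ K₀ := gromovProduct_nonneg _ _ _
  refine ⟨R + 1 + δ, fun g N => hasTripod_range_of_one hf ?_ g⟩
  have hpow : ∀ t : G, dist (f 1) (f t) = R → gromovProduct (f 1) (f t) (f t⁻¹) = K₀ → ∀ n : ℕ,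
      (n + 1 : ℝ) ≤ dist (f 1) (f (t ^ (n + 1))) ∧
        R - K₀ - δ ≤ gromovProduct (f 1) (f (t ^ (n + 1))) (f t) := by
    intro t ht ht' n
    have hd : ∀ i < n + 1, R ≤ dist (f (t ^ i)) (f (t ^ (i + 1))) := fun i _ => by
      have := hf (t ^ i) 1 t
      rw [mul_one, ← pow_succ, ht] at this
      exact this.ge
    have hp : ∀ i < n, gromovProduct (f (t ^ (i + 1))) (f (t ^ i)) (f (t ^ (i + 2))) ≤ K₀ := by
      intro i _
      have := gromovProduct_mul_left hf (t ^ (i + 1)) 1 t⁻¹ t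
      rw [mul_one, ← pow_succ, pow_succ t i, mul_inv_cancel_right, ← pow_succ,
        gromovProduct_comm (f 1), ht'] at this
      exact this.le
    have h1 := (hδ.chain_end hK₀0 (by linarith) (fun i => f (t ^ i)) n hd hp).1
    have h2 := hδ.chain_start hK₀0 (by linarith) (fun i => f (t ^ i)) n hd hp
    simp only [pow_zero, pow_one] at h1 h2
    rw [gromovProduct_comm] at h2
    exact ⟨h1, h2⟩
  -- Some `g` is far from all powers of `u`; translating an almost nearest power to the identity
  -- gives `h`. The summand `1` is there because the infimum is taken up to an error.
  have hfar : ∀ r : ℝ, ∃ h : G, r ≤ dist (f 1) (f h) ∧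
      dist (f 1) (f h) ≤ dist (f h) (f u) + 1 ∧ dist (f 1) (f h) ≤ dist (f h) (f u⁻¹) + 1 := by
    intro r
    by_contra! hcon
    refine hG (isVirtuallyCyclic_of_near_powers hf hfin (u := u) (r := r) fun g => ?_)
    set T := Set.range fun j : ℤ => dist (f g) (f (u ^ j)) with hT
    have hbdd : BddBelow T := ⟨0, by rintro _ ⟨j, rfl⟩; exact dist_nonneg⟩
    obtain ⟨_, ⟨j, rfl⟩, hj⟩ := Real.lt_sInf_add_pos (s := T) ⟨_, 0, rfl⟩ one_pos
    have hmin : ∀ i : ℤ, dist (f g) (f (u ^ j)) ≤ dist (f g) (f (u ^ i)) + 1 := fun i =>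
      hj.le.trans (by gcongr; exact csInf_le hbdd ⟨i, rfl⟩)
    refine ⟨j, ?_⟩
    by_contra! hjr
    have t0 : dist (f 1) (f ((u ^ j)⁻¹ * g)) = dist (f g) (f (u ^ j)) := by
      rw [← hf (u ^ j), mul_one, mul_inv_cancel_left, dist_comm]
    have t1 : ∀ i : ℤ, dist (f ((u ^ j)⁻¹ * g)) (f (u ^ i)) = dist (f g) (f (u ^ (j + i))) :=
      fun i => by rw [← hf (u ^ j), mul_inv_cancel_left, ← zpow_add]
    have s1 := t1 1
    have s2 := t1 (-1)
    rw [zpow_one] at s1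
    rw [zpow_neg_one] at s2
    refine (hcon ((u ^ j)⁻¹ * g) (t0 ▸ hjr) ?_).not_ge ?_
    · rw [t0, s1]
      exact hmin _
    · rw [t0, s2]
      exact hmin _
  obtain ⟨n, hn⟩ := exists_nat_ge N
  obtain ⟨h, h1, h2, h3⟩ := hfar N
  obtain ⟨a1, a2⟩ := hpow u rfl rfl n
  obtain ⟨b1, b2⟩ := hpow u⁻¹ (dist_one_inv hf u) (by rw [inv_inv, gromovProduct_comm]) n
  -- The identity is almost as near to `h` as `u` and `u⁻¹` are, so `h` does not point far along
  -- either. The margin `4 * δ + 2` in the choice of `u` makes `R - K₀ - δ` exceed `(R + 1) / 2 +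
  -- δ`, so the same holds for all powers.
  have hhu : ∀ t : G, dist (f 1) (f t) = R → dist (f 1) (f h) ≤ dist (f h) (f t) + 1 →
      gromovProduct (f 1) (f h) (f t) ≤ (R + 1) / 2 := by
    intro t ht hle
    unfold gromovProduct
    linarith
  refine HasTripod.of_points (p := f h) (q := f (u ^ (n + 1))) (r := f (u⁻¹ ^ (n + 1))) ⟨_, rfl⟩
    ⟨_, rfl⟩ ⟨_, rfl⟩ h1 (by linarith) (by linarith) ?_ ?_ ?_
  · linarith [hδ.le_of_lt (hhu u rfl h2) (z := f (u ^ (n + 1))) (by linarith)]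
  · linarith [hδ.le_of_lt (hhu u⁻¹ (dist_one_inv hf u) h3) (z := f (u⁻¹ ^ (n + 1)))
      (by linarith)]
  · linarith [hδ.le_of_lt' (c := K₀) (x := f u) (y := f u⁻¹) le_rfl (x' := f (u ^ (n + 1)))
      (y' := f (u⁻¹ ^ (n + 1))) (by linarith) (by linarith)]

end GroupOrbit

/-! ### Assembly for relatively hyperbolic groups. -/

section RelativelyHyperbolicGroups

variable {G : Type*} [Group G] {S : Set G} {hS : Subgroup.closure S = ⊤} {n : ℕ}
  {K : Fin n → Subgroup G} {δ C L : ℝ}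

/-! ### Relatively hyperbolic groups -/

theorem HasTripod.univ {Y : Type*} [MetricSpace Y] {V : Set Y} {v : Y} {R K : ℝ}
    (h : HasTripod V v R K) : HasTripod Set.univ v R K := by
  obtain ⟨p, -, h2, h3⟩ := h
  exact ⟨p, fun _ => trivial, h2, h3⟩

theorem Cusp.dist_ofSpace_of_isEmpty {X : Type*} [MetricSpace X] {𝓟 : Set (Set X)} [IsEmpty 𝓟]
    (H : HoroballFamily 𝓟 δ C L) (x y : X) :
    dist (Cusp.ofSpace H x) (Cusp.ofSpace H y) = dist x y := by
  refine le_antisymm (Cusp.dist_ofSpace_le H x y) ?_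
  have key : ∀ (a b : PreCusp H) (r : ℝ), Chain (CuspStep H) a b r →
      ∀ x y, a = Sum.inl x → b = Sum.inl y → dist x y ≤ r := by
    intro a b r h
    induction h with
    | nil a =>
      rintro x y rfl h
      cases h
      simp
    | fwd h _ ih =>
      rintro x y rfl rfl
      cases h with
      | space _ z => exact (dist_triangle x z y).trans (by gcongr; exact ih z y rfl rfl)
      | glue P => exact (IsEmpty.false P).elim
    | bwd h _ ih =>
      rintro x y rfl rfl
      cases h with
      | space z => exact (dist_triangle_left x y z).trans (by gcongr; exact ih z y rfl rfl)
  exact le_csInf (CuspStep.connected H _ _) fun r hr => key _ _ r hr x y rfl rfl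

variable (H : HoroballFamily (peripherals S hS K) δ C L)

/-- Distinct vertices are `1 / max L 1`-separated in the cusped space, which is proper. This
replaces a proper action on the cusped space, where the group need not act. -/
theorem finite_vertices_in_ball [ProperSpace (Cusp H)] (y : Cusp H) (r : ℝ) :
    {g | dist y (Cusp.ofSpace H (cayleyVertex hS g)) ≤ r}.Finite := by
  have hL : 0 < max L 1 := by positivity
  refine finite_of_separated (fun g => Cusp.ofSpace H (cayleyVertex hS g))
    (c := 1 / max L 1) (by positivity) (fun g h hgh => ?_) y r
  rcases lt_or_ge (dist (Cusp.ofSpace H (cayleyVertex hS g)) (Cusp.ofSpace H (cayleyVertex hS h))) 1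
    with h1 | h1
  · have h2 : 1 ≤ dist (cayleyVertex hS g) (cayleyVertex hS h) :=
      Realization.one_le_dist_vertex hgh
    rw [div_le_iff₀' hL]
    exact h2.trans (Cusp.dist_le_of_ofSpace_lt H h1)
  · exact ((div_le_one hL).2 (le_max_right _ _)).trans h1

theorem exists_far_in_peripheral [ProperSpace (Cusp H)] (hK : ∀ i, Infinite (K i))
    {P : Set (CayleySpace S hS)} (hP : P ∈ peripherals S hS K) (y : Cusp H) (r : ℝ) :
    ∃ z ∈ P, r ≤ dist y (Cusp.ofSpace H z) := by
  obtain ⟨i, a, rfl⟩ := hP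
  have := hK i
  have hinf : (Set.range fun k : K i => a * (k : G)).Infinite :=
    Set.infinite_range_of_injective fun k k' h => Subtype.ext (mul_left_cancel h)
  obtain ⟨_, ⟨k, rfl⟩, hk⟩ := hinf.exists_notMem_finset (finite_vertices_in_ball H y r).toFinset
  refine ⟨cayleyVertex hS (a * k), cayleyVertex_mem_cosetCopy.2 (by simp), ?_⟩
  have hk' : ¬ dist y (Cusp.ofSpace H (cayleyVertex hS (a * k))) ≤ r := by simpa using hk
  exact (not_le.1 hk').le

/-- An infinite proper peripheral subgroup has at least three peripheral cosets. -/
theorem exists_three_peripherals (hH : IsRelativelyHyperbolic H) (hK : ∀ i, Infinite (K i))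
    (hK' : ∀ i, K i ≠ ⊤) (i : Fin n) :
    ∃ P : Fin 3 → peripherals S hS K, Function.Injective P := by
  obtain ⟨δ', hδ⟩ := hH.hyperbolic_cusp
  have := hH.proper_cusp
  have := hK i
  obtain ⟨g, hg⟩ : ∃ g, g ∉ K i := by
    by_contra! h
    exact hK' i (eq_top_iff.2 fun g _ => h g)
  let P : peripherals S hS K := ⟨cosetCopy S hS (K i) 1, i, 1, rfl⟩
  let Q : K i → peripherals S hS K := fun k => ⟨cosetCopy S hS (K i) (k * g), i, k * g, rfl⟩
  have hPQ : ∀ k, P ≠ Q k := by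
    intro k h
    have h1 : cayleyVertex hS (k * g) ∈ (Q k : Set (CayleySpace S hS)) :=
      cayleyVertex_mem_cosetCopy.2 (by simp)
    rw [← h] at h1
    have h2 := cayleyVertex_mem_cosetCopy.1 h1
    rw [inv_one, one_mul] at h2
    exact hg (((K i).mul_mem_cancel_left k.2).1 h2)
  obtain ⟨k, hk⟩ : ∃ k, Q 1 ≠ Q k := by
    -- If all cosets `k g K i` with `k` in `K i` agreed, every `k` would be within the distance of
    -- `1` and `g` from the single coset `g K i`. As that differs from `K i`, the coarse
    -- intersection bound would put the infinite group `K i` into a ball with finitely many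
    -- vertices.
    by_contra! hcon
    have hC := (H P).C_pos
    have hbase : ∀ k : K i, ∃ (p : (H P).base) (q : (H (Q 1)).base),
        dist (cayleyVertex hS (k : G)) p ≤ C ∧ dist (cayleyVertex hS (k * g)) q ≤ C := by
      intro k
      obtain ⟨p, hp, h1⟩ := (H P).base_dense (cayleyVertex hS (k : G))
        (cayleyVertex_mem_cosetCopy.2 (by simp))
      obtain ⟨q, hq, h2⟩ := (H (Q 1)).base_dense (cayleyVertex hS (k * g)) (by
        rw [hcon k]
        exact cayleyVertex_mem_cosetCopy.2 (by simp))
      exact ⟨⟨p, hp⟩, ⟨q, hq⟩, h1, h2⟩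
    choose p q hp hq using hbase
    set D := dist (cayleyVertex hS 1) (cayleyVertex hS g) + 2 * C with hD
    have hpq : ∀ k, dist (p k : CayleySpace S hS) (q k) ≤ D := by
      intro k
      have e1 := dist_cayleyVertex_mul (hS := hS) (k : G) 1 g
      rw [mul_one] at e1
      have e2 := dist_triangle4 (p k : CayleySpace S hS) (cayleyVertex hS (k : G))
        (cayleyVertex hS (k * g)) (q k)
      linarith [hp k, hq k, dist_comm (p k : CayleySpace S hS) (cayleyVertex hS (k : G))]
    refine (Set.infinite_range_of_injective (f := fun k : K i => (k : G))
      Subtype.val_injective).not_finite ((finite_vertices_in_ball H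
        (Cusp.ofSpace H (p 1 : CayleySpace S hS))
        (D + 4 * Real.log 2 + 4 * C + 2 * δ' + C)).subset ?_)
    rintro _ ⟨k, rfl⟩
    have e1 := Cusp.dist_le_of_near_distinct H hδ (hPQ 1) (p 1) (p k) (q 1) (q k) (hpq 1) (hpq k)
    have e2 := (Cusp.dist_ofSpace_le H (cayleyVertex hS (k : G)) (p k)).trans (hp k)
    have e3 := dist_triangle_right (Cusp.ofSpace H (p 1 : CayleySpace S hS))
      (Cusp.ofSpace H (cayleyVertex hS (k : G))) (Cusp.ofSpace H (p k : CayleySpace S hS))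
    change dist _ _ ≤ _
    linarith
  refine ⟨![P, Q 1, Q k], fun a b hab => ?_⟩
  have h1 := hPQ 1
  have h2 := hPQ k
  fin_cases a <;> fin_cases b <;>
    first
    | rfl
    | exact absurd hab h1
    | exact absurd hab h2
    | exact absurd hab hk
    | exact absurd hab.symm h1
    | exact absurd hab.symm h2
    | exact absurd hab.symm hk

/-- Without peripherals the group acts isometrically on the cusped space and tripods come from an
orbit. Otherwise they come from three peripheral sets, are translated coarsely at one well chosen
size, and are enlarged by concatenation. -/
theorem exists_hasTripod_at_vertices (hH : IsRelativelyHyperbolic H) (hK : ∀ i, Infinite (K i))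
    (hK' : ∀ i, K i ≠ ⊤) (hG : ¬ IsVirtuallyCyclic G) :
    ∃ B : ℝ, ∀ v ∈ Set.range (cayleyVertex hS), ∀ N,
      HasTripod Set.univ (Cusp.ofSpace H v) N B := by
  obtain ⟨δ', hδ⟩ := hH.hyperbolic_cusp
  have := hH.proper_cusp
  rcases isEmpty_or_nonempty (Fin n) with hn | ⟨⟨i⟩⟩
  · have : IsEmpty (peripherals S hS K) := ⟨fun ⟨_, i, _⟩ => isEmptyElim i⟩
    have : Infinite G := by
      by_contra h
      -- A finite group is virtually cyclic, by its trivial subgroup.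
      have : Finite G := not_infinite_iff_finite.1 h
      exact hG ⟨⊥, inferInstance, inferInstance⟩
    obtain ⟨B, hB⟩ := exists_hasTripod_of_not_isVirtuallyCyclic
      (f := fun g => Cusp.ofSpace H (cayleyVertex hS g)) hH.geodesic_cusp hδ (fun g a b => by
        rw [Cusp.dist_ofSpace_of_isEmpty, Cusp.dist_ofSpace_of_isEmpty, dist_cayleyVertex_mul])
      (fun z => by
        rcases Cusp.exists_rep H z with ⟨x, rfl⟩ | ⟨P, -, -⟩
        · obtain ⟨v, hv⟩ := Realization.exists_vertex_near x
          exact ⟨v, (Cusp.dist_ofSpace_le H _ _).trans hv⟩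
        · exact isEmptyElim P)
      (finite_vertices_in_ball H _) hG
    refine ⟨B, ?_⟩
    rintro _ ⟨g, rfl⟩ N
    exact (hB g N).univ
  · obtain ⟨P, hP⟩ := exists_three_peripherals H hH hK hK' i
    obtain ⟨ε, hε, hcc⟩ := hH.coarselyConnected
    have hC := (H (P 0)).C_pos
    obtain ⟨E, B, hEB⟩ := Cusp.exists_tripods_of_peripherals H hδ hε.le hcc hP (cayleyVertex hS 1)
      (V := Set.range (cayleyVertex hS)) (fun j x hx => by
        obtain ⟨i, a, h⟩ := (P j).2
        rw [h] at hx ⊢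
        obtain ⟨v, hv, hxv⟩ := exists_vertex_near_of_mem_cosetCopy hx
        exact ⟨_, ⟨v, rfl⟩, cayleyVertex_mem_cosetCopy.2 hv, hxv⟩)
      (fun j r => exists_far_in_peripheral H hK (P j).2 _ r)
    obtain ⟨R', B', hR', htri⟩ := Cusp.exists_hasTripod_translates hC.le hH.geodesic_cusp hδ
      (v₀ := cayleyVertex hS 1) (V := Set.range (cayleyVertex hS)) (by
        rintro _ ⟨g, rfl⟩
        refine ⟨translation hS g, by rw [translation_vertex, mul_one], ?_,
          fun P hP => translation_image_mem_peripherals g hP, fun P hP => ?_⟩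
        · rintro _ ⟨a, rfl⟩
          exact ⟨g * a, rfl⟩
        · rw [translation_symm]
          exact translation_image_mem_peripherals _ hP) hEB
    exact ⟨B' + 2 * δ', fun v hv N => (HasTripod.extend hδ htri hR' ⟨v, hv, rfl⟩ N).univ⟩

theorem isVisuallyComplete_of_not_isVirtuallyCyclic (hH : IsRelativelyHyperbolic H)
    (hK : ∀ i, Infinite (K i)) (hK' : ∀ i, K i ≠ ⊤) (hG : ¬ IsVirtuallyCyclic G) :
    IsVisuallyComplete (Cusp H) := by
  have := hH.proper_cusp
  obtain ⟨B, hB⟩ := exists_hasTripod_at_vertices H hH hK hK' hG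
  refine ⟨Cusp.ofSpace H (cayleyVertex hS 1), Cusp.isVisuallyComplete_of_hasTripod H hH ?_
    (fun x => ?_) hB _⟩
  · intro P hP y _ r
    obtain ⟨z, hz, h⟩ := exists_far_in_peripheral H hK hP (Cusp.ofSpace H y) r
    exact ⟨z, hz, h.trans (Cusp.dist_ofSpace_le H y z)⟩
  · obtain ⟨v, hv⟩ := Realization.exists_vertex_near x
    exact ⟨_, ⟨v, rfl⟩, hv⟩

end RelativelyHyperbolicGroups

end RelHyp

theorem proposition2p15 :
    -- visual completeness of a relatively hyperbolic space, and the boundary of its cusped space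
    (∀ {X : Type*} [MetricSpace X] {𝓟 : Set (Set X)} {δ C L : ℝ} (H : HoroballFamily 𝓟 δ C L),
      IsRelativelyHyperbolic H →
        (∀ w : Cusp H, IsVisuallyCompleteFrom (Cusp H) w ↔ IsVisuallyComplete (Cusp H)) ∧
        (∀ w : Cusp H, IsVisualFrom (Cusp H) w ↔ IsVisual (Cusp H)) ∧
        ∀ (o : Cusp H) (ε : ℝ) (ρ : MetricSpace (GromovBoundary (Cusp H))),
          IsVisualMetric o ε ρ →
            (IsVisuallyComplete (Cusp H) ↔
              IsVisual (Cusp H) ∧ Nontrivial (GromovBoundary (Cusp H)) ∧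
                @UniformlyPerfect (GromovBoundary (Cusp H)) ρ)) ∧
    -- relatively hyperbolic groups
    (∀ {G : Type*} [Group G] (S : Finset G) (hS : Subgroup.closure (S : Set G) = ⊤) (n : ℕ)
      (K : Fin n → Subgroup G),
      (∀ i, Subgroup.closure ((S : Set G) ∩ K i) = K i) →
      (∀ i, K i ≠ ⊤) → (∀ i, Infinite (K i)) →
      ¬ IsVirtuallyCyclic G →
      ∀ {δ C L : ℝ} (H : HoroballFamily (peripherals (S : Set G) hS K) δ C L),
        IsRelativelyHyperbolic H → IsVisuallyComplete (Cusp H)) :=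
  ⟨fun _ hH => visuallyComplete_characterization hH.proper_cusp hH.geodesic_cusp hH.hyperbolic_cusp,
    fun _ _ _ _ _ hK' hK hG _ _ _ H hH =>
      isVisuallyComplete_of_not_isVirtuallyCyclic H hH hK hK' hG⟩
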